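/- **Setting.** Let $l>0$, $q=5^{2^l}$, let $\mathbb F_q\subset\mathbb F_{q^2}$ be fields with $q$ and $q^2$ elements, let $\omega\in\mathbb F_q^\times$ have order $2^{l+2}$ and let $z\in\mathbb F_{q^2}$ satisfy $z^2=\omega$. Put $$x=\begin{pmatrix}\omega&0\\0&\omega^{-1}\end{pmatrix},\qquad y=\begin{pmatrix}0&-1\\1&0\end{pmatrix},\qquad c=\begin{pmatrix}z^{-1}&0\\0&z\end{pmatrix},$$ $$R=\langle x,y\rangle,\qquad Q=\langle x^{2^l},y\rangle,\qquad Q'=\langle x^{2^l},xy\rangle .$$ Let $N$ be the normalizer of $\mathrm{SL}_2(q)$ in $\mathrm{SL}_2(q^2)$ (so $c\in N$). Let $W=N\wr S_3$ be the wreath product with base group $N_0=N^3$ and acting group $X=S_3$. Let $\hat K\le W$ be the subgroup generated by $\mathrm{SL}_2(q)^3\le N_0$, $X$ and $C_{N_0}(X)$, and let $K=\hat K/Z(\hat K)$. Write $[n_1,n_2,n_3]$ for the image in $K$ of $(n_1,n_2,n_3)\in\hat K\cap N_0$. Let $L_0\le K$ be the image of $\mathrm{SL}_2(q)^3$ and let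 $U=Z(L_0)$. For $A,B,C\le \mathrm{SL}_2(q)$ write $A_1B_2C_3$ for the image of $A\times B\times C$ in $K$. Let $\tau\in K$ be the image of the permutation $(1,2)\in X$, and put $$\mathbf d=[y,y,y]\,[c,c,c],\qquad \tau'=\mathbf d\tau,\qquad S=R_1R_2R_3\,\langle\mathbf d,\tau\rangle .$$ Let $\mathcal K=\mathcal F_S(K)$ be the fusion system on $S$ (a Sylow $2$-subgroup of $K$) whose morphisms are the homomorphisms between subgroups of $S$ induced by conjugation by elements of $K$. For $P\le S$ let $\mathrm{Out}_{\mathcal K}(P)=\mathrm{Aut}_{\mathcal K}(P)/\mathrm{Inn}(P)$. A subgroup $P\le S$ is $\mathcal K$-centric radical if $C_S(P^*)=Z(P^*)$ for each $\mathcal K$-conjugate $P^*$ of $P$ and $O_2(\mathrm{Out}_{\mathcal K}(P))=1$. **Proposition.** There are exactly eleven $\mathcal K$-conjugacy classes of $\mathcal K$-centric radical subgroups of $S$. The following eleven subgroups are $\mathcal K$-centric radical, each class contains exactly one of them, and their orders and outer automorphism groups in $\mathcal K$ are as listed: | $P$ | $\lvert P\rvert$ | $\mathrm{Out}_{\mathcal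 K}(P)$ | |---|---|---| | $S$ | $2^{10+3l}$ | $1$ | | $C_S(U)$ | $2^{9+3l}$ | $S_3$ | | $Q_1Q_2Q_3$ | $2^8$ | $S_3\wr S_3$ | | $Q_1Q_2Q_3'$ | $2^8$ | $(S_3\wr C_2)\times S_3$ | | $Q_1Q_2R_3$ | $2^{8+l}$ | $S_3\wr C_2$ | | $Q_1Q_2'R_3$ | $2^{8+l}$ | $S_3\wr C_2$ | | $Q_1Q_2Q_3\langle\tau\rangle$ | $2^9$ | $S_3\times S_3$ | | $Q_1Q_2Q_3'\langle\tau\rangle$ | $2^9$ | $S_3\times S_3$ | | $Q_1Q_2R_3\langle\tau\rangle$ | $2^{9+l}$ | $S_3$ | | $Q_1Q_2'R_3\langle\tau'\rangle$ | $2^{9+l}$ | $S_3$ | | $R_1R_2Q_3\langle\tau\rangle$ | $2^{9+2l}$ | $S_3$ | Here $S_3\wr S_3$ and $S_3\wr C_2$ are the wreath products for the natural actions on three and on two points. -/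

import Mathlib

/-! ### Fusion systems -/

/-- A fusion system over a group `S` (in practice a finite `p`-group): for subgroups `P`, `Q` of `S`
a set of injective homomorphisms `P → Q` that contains all those induced by conjugation in `S`, is
closed under composition, and in which each morphism is an isomorphism of the system followed by
an inclusion. -/
structure FusionSystem (S : Type*) [Group S] where
  Hom : (P Q : Subgroup S) → Set (P →* Q)
  injective_of_mem : ∀ {P Q : Subgroup S} {φ : P →* Q}, φ ∈ Hom P Q → Function.Injective φ
  conj_mem : ∀ {P Q : Subgroup S} (s : S) (φ : P →* Q),
    (∀ x : P, (φ x : S) = s * x * s⁻¹) → φ ∈ Hom P Q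
  comp_mem : ∀ {P Q R : Subgroup S} {φ : P →* Q} {ψ : Q →* R},
    φ ∈ Hom P Q → ψ ∈ Hom Q R → ψ.comp φ ∈ Hom P R
  factor : ∀ {P Q : Subgroup S} {φ : P →* Q}, φ ∈ Hom P Q →
    ∃ (R : Subgroup S) (h : R ≤ Q) (e : P ≃* R),
      e.toMonoidHom ∈ Hom P R ∧ e.symm.toMonoidHom ∈ Hom R P ∧
        (Subgroup.inclusion h).comp e.toMonoidHom = φ

/-- `O_p(G)`: the subgroup generated by all normal `p`-subgroups of `G` (for finite `G`, the largest
normal `p`-subgroup). -/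
def pCore (p : ℕ) (G : Type*) [Group G] : Subgroup G :=
  sSup {H : Subgroup G | H.Normal ∧ IsPGroup p H}

/-- The group of inner automorphisms of `G`. -/
def innerAut (G : Type*) [Group G] : Subgroup (MulAut G) := (MulAut.conj : G →* MulAut G).range

instance innerAut_normal (G : Type*) [Group G] : (innerAut G).Normal where
  conj_mem := by
    rintro _ ⟨g, rfl⟩ f
    refine ⟨f g, ?_⟩
    ext x
    simp [MulAut.conj_apply, MulAut.mul_apply]

namespace FusionSystem

variable {S : Type*} [Group S] (𝓕 : FusionSystem S)

/-- `P` and `Q` are isomorphic in the category `𝓕`. -/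
def IsConj (P Q : Subgroup S) : Prop :=
  ∃ e : P ≃* Q, e.toMonoidHom ∈ 𝓕.Hom P Q ∧ e.symm.toMonoidHom ∈ 𝓕.Hom Q P

/-- `Aut_𝓕(P)`. -/
def Aut (P : Subgroup S) : Subgroup (MulAut P) where
  carrier := {e | e.toMonoidHom ∈ 𝓕.Hom P P}
  one_mem' := 𝓕.conj_mem 1 _ (by
    intro x
    rw [one_mul, inv_one, mul_one]
    rfl)
  mul_mem' := by
    intro a b ha hb
    exact 𝓕.comp_mem hb ha
  inv_mem' := by
    intro a ha
    obtain ⟨R, h, e, -, he, hae⟩ := 𝓕.factor ha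
    have hval : ∀ x : P, ((e x : R) : S) = ((a x : P) : S) := fun x =>
      congrArg Subtype.val (DFunLike.congr_fun hae x)
    have hR : P ≤ R := by
      intro x hx
      have h1 := hval (a.symm ⟨x, hx⟩)
      rw [MulEquiv.apply_symm_apply] at h1
      have h2 := (e (a.symm ⟨x, hx⟩)).2
      rw [h1] at h2
      exact h2
    have hi : Subgroup.inclusion hR ∈ 𝓕.Hom P R := 𝓕.conj_mem 1 _ (by intro x; simp)
    have hc := 𝓕.comp_mem hi he
    have heq : e.symm.toMonoidHom.comp (Subgroup.inclusion hR) = (a⁻¹ : MulAut P).toMonoidHom := by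
      ext x
      obtain ⟨y, rfl⟩ := a.surjective x
      have h2 : Subgroup.inclusion hR (a y) = e y := Subtype.ext (hval y).symm
      have h3 : (a⁻¹ : MulAut P) (a y) = y := a.symm_apply_apply y
      change ((e.symm (Subgroup.inclusion hR (a y)) : P) : S) = (((a⁻¹ : MulAut P) (a y) : P) : S)
      rw [h2, h3, MulEquiv.symm_apply_apply]
    rw [heq] at hc
    exact hc

/-- `Out_𝓕(P) = Aut_𝓕(P) / Inn(P)`. -/
abbrev Out (P : Subgroup S) : Type _ := 𝓕.Aut P ⧸ (innerAut P).subgroupOf (𝓕.Aut P)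

/-- `P` is `𝓕`-centric: `C_S(Q) = Z(Q)` for each `𝓕`-conjugate `Q` of `P`. -/
def IsCentric (P : Subgroup S) : Prop :=
  ∀ Q : Subgroup S, 𝓕.IsConj P Q →
    Subgroup.centralizer (Q : Set S) = (Subgroup.center Q).map Q.subtype

/-- `P` is `𝓕`-radical: `O_p(Out_𝓕(P)) = 1`. -/
def IsRadical (p : ℕ) (P : Subgroup S) : Prop := pCore p (𝓕.Out P) = ⊥

/-- `P` is `𝓕`-centric radical. -/
def IsCentricRadical (p : ℕ) (P : Subgroup S) : Prop := 𝓕.IsCentric P ∧ 𝓕.IsRadical p P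

/-- The set of `𝓕`-conjugacy classes of `𝓕`-centric radical subgroups. -/
def centricRadicalClasses (p : ℕ) : Set (Set (Subgroup S)) :=
  {C | ∃ P : Subgroup S, 𝓕.IsCentricRadical p P ∧ C = {Q | 𝓕.IsConj P Q}}

/-- The fusion system `𝓕_S(G)`: its morphisms are the homomorphisms between subgroups of `S` that
are induced by conjugation by elements of `G`. -/
def ofGroup {G : Type*} [Group G] (S : Subgroup G) : FusionSystem S where
  Hom P Q := {φ | ∃ g : G, ∀ x : P, ((φ x : S) : G) = g * ((x : S) : G) * g⁻¹}
  injective_of_mem := by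
    rintro P Q φ ⟨g, hg⟩ x y hxy
    have h := hg x
    rw [hxy, hg y] at h
    exact Subtype.ext (Subtype.ext (by simpa using h.symm))
  conj_mem := by
    intro P Q s φ h
    exact ⟨s, fun x => by rw [h x]; rfl⟩
  comp_mem := by
    rintro P Q R φ ψ ⟨g, hg⟩ ⟨k, hk⟩
    refine ⟨k * g, fun x => ?_⟩
    rw [MonoidHom.comp_apply, hk, hg]
    group
  factor := by
    rintro P Q φ ⟨g, hg⟩
    have hinj : Function.Injective φ := by
      intro x y hxy
      have h := hg x
      rw [hxy, hg y] at h
      exact Subtype.ext (Subtype.ext (by simpa using h.symm))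
    let e₀ : P ≃* φ.range := MonoidHom.ofInjective hinj
    let e₁ := φ.range.equivMapOfInjective Q.subtype Q.subtype_injective
    let e := e₀.trans e₁
    have he : ∀ x : P, ((e x : _) : S) = ((φ x : Q) : S) := fun x => rfl
    refine ⟨φ.range.map Q.subtype, ?_, e, ⟨g, fun x => ?_⟩, ⟨g⁻¹, fun x => ?_⟩, ?_⟩
    · rintro _ ⟨y, -, rfl⟩
      exact y.2
    · rw [← hg x, ← he x]
      rfl
    · obtain ⟨y, rfl⟩ := e.surjective x
      have h1 : e.symm.toMonoidHom (e y) = y := e.symm_apply_apply y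
      rw [h1, he y, hg y]
      group
    · ext x
      exact congrArg Subtype.val (he x)

end FusionSystem

/-! ### Wreath products -/

/-- The wreath product `H ≀ S_n` for the natural action of the symmetric group `S_n` on `n` points.
In particular `H ≀ C_2` is `PermWreath H 2`. -/
abbrev PermWreath (H : Type*) [Group H] (n : ℕ) : Type _ :=
  (Fin n → H) ⋊[(mulAutArrow : Equiv.Perm (Fin n) →* MulAut (Fin n → H))] Equiv.Perm (Fin n)

/-- The symmetric group of degree three. -/
abbrev Sym3 : Type := Equiv.Perm (Fin 3)

/-! ### The group `K` -/

/-- The choices on which the construction depends: an element `ω` of order `2^(l+2)` of the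
multiplicative group of `k` and a square root `z` of `ω` in the extension field `F`. -/
structure SolSetup (l : ℕ) (k F : Type*) [Field k] [Field F] [Algebra k F] where
  ω : kˣ
  orderOf_ω : orderOf ω = 2 ^ (l + 2)
  z : Fˣ
  z_sq : (z : F) ^ 2 = algebraMap k F ω

section GroupK

open Matrix

variable (k F : Type*) [Field k] [Field F] [Algebra k F]

/-- The natural inclusion `SL₂(k) → SL₂(F)`. -/
def slIncl : SpecialLinearGroup (Fin 2) k →* SpecialLinearGroup (Fin 2) F :=
  SpecialLinearGroup.map (algebraMap k F)

/-- `N`, the normalizer of `SL₂(k)` in `SL₂(F)`. -/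
def slNormalizer : Subgroup (SpecialLinearGroup (Fin 2) F) :=
  Subgroup.normalizer ((slIncl k F).range : Set (SpecialLinearGroup (Fin 2) F))

/-- The inclusion `SL₂(k) → N`. -/
def slToNormalizer : SpecialLinearGroup (Fin 2) k →* slNormalizer k F :=
  (slIncl k F).codRestrict (slNormalizer k F) fun g => Subgroup.le_normalizer ⟨g, rfl⟩

/-- `W = N ≀ S₃`. -/
abbrev WGroup : Type _ := PermWreath (slNormalizer k F) 3

/-- `N₀ = N₁ × N₂ × N₃`, the base group of `W`. -/
def baseN : Subgroup (WGroup k F) := (SemidirectProduct.inl : _ →* WGroup k F).range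

/-- `X = S₃`, the acting group of `W`. -/
def actingX : Subgroup (WGroup k F) := (SemidirectProduct.inr : _ →* WGroup k F).range

/-- The embedding of `SL₂(k) × SL₂(k) × SL₂(k)` in the base group of `W`. -/
def slCube : (Fin 3 → SpecialLinearGroup (Fin 2) k) →* WGroup k F :=
  (SemidirectProduct.inl : _ →* WGroup k F).comp ((slToNormalizer k F).compLeft (Fin 3))

/-- `K̂ = (L₁ × L₂ × L₃) X C_{N₀}(X)`, where the `Lᵢ` are the three copies of `SL₂(k)` in the base
group. -/
def Khat : Subgroup (WGroup k F) :=
  (slCube k F).range ⊔ actingX k F ⊔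
    (baseN k F ⊓ Subgroup.centralizer (actingX k F : Set (WGroup k F)))

/-- `K = K̂ / Z(K̂)`. -/
abbrev KGroup : Type _ := Khat k F ⧸ Subgroup.center (Khat k F)

/-- The map `(g₁, g₂, g₃) ↦ [g₁, g₂, g₃]` from `SL₂(k) × SL₂(k) × SL₂(k)` to `K`. -/
def cubeToK : (Fin 3 → SpecialLinearGroup (Fin 2) k) →* KGroup k F :=
  (QuotientGroup.mk' (Subgroup.center (Khat k F))).comp <|
    (slCube k F).codRestrict (Khat k F) fun g =>
      (le_sup_left.trans le_sup_left : (slCube k F).range ≤ Khat k F) ⟨g, rfl⟩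

/-- The map `X → K`. -/
def permToK : Equiv.Perm (Fin 3) →* KGroup k F :=
  (QuotientGroup.mk' (Subgroup.center (Khat k F))).comp <|
    (SemidirectProduct.inr : _ →* WGroup k F).codRestrict (Khat k F) fun g =>
      (le_sup_right.trans le_sup_left : actingX k F ≤ Khat k F) ⟨g, rfl⟩

variable {k F} in
theorem inl_const_mem_Khat (n : slNormalizer k F) :
    (SemidirectProduct.inl (fun _ => n) : WGroup k F) ∈ Khat k F := by
  refine (le_sup_right : _ ≤ Khat k F) ⟨⟨_, rfl⟩, ?_⟩
  refine Subgroup.mem_centralizer_iff.mpr ?_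
  rintro _ ⟨σ, rfl⟩
  apply SemidirectProduct.ext <;> simp
  rfl

/-- The map `n ↦ [n, n, n]` from `N` to `K`. -/
def diagToK (n : slNormalizer k F) : KGroup k F :=
  QuotientGroup.mk' (Subgroup.center (Khat k F))
    ⟨SemidirectProduct.inl (fun _ => n), inl_const_mem_Khat n⟩

/-- `L₀ = L₁ L₂ L₃ ≤ K`. -/
def L0 : Subgroup (KGroup k F) := (cubeToK k F).range

/-- `U = Z(L₀)`. -/
def USub : Subgroup (KGroup k F) := (Subgroup.center (L0 k F)).map (L0 k F).subtype

/-- The product `A₁ A₂ A₃ ≤ L₁ L₂ L₃`, where `Aᵢ` is the copy in `Lᵢ` of the subgroup `A i` of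
`SL₂(k)`. -/
def prodSub (A : Fin 3 → Subgroup (SpecialLinearGroup (Fin 2) k)) : Subgroup (KGroup k F) :=
  (Subgroup.pi Set.univ A).map (cubeToK k F)

/-- `τ ∈ X`, the transposition that interchanges the first two coordinates. -/
def tauK : KGroup k F := permToK k F (Equiv.swap 0 1)

end GroupK

/-! ### The Sylow subgroup `S` and the representatives -/

namespace SolSetup

open Matrix

variable {l : ℕ} {k F : Type*} [Field k] [Field F] [Algebra k F] (D : SolSetup l k F)

/-- `x = diag(ω, ω⁻¹)`. -/
def x : SpecialLinearGroup (Fin 2) k :=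
  ⟨!![(D.ω : k), 0; 0, ((D.ω⁻¹ : kˣ) : k)], by simp [Matrix.det_fin_two_of]⟩

/-- `y = (0, -1; 1, 0)`. -/
def y (_D : SolSetup l k F) : SpecialLinearGroup (Fin 2) k :=
  ⟨!![0, -1; 1, 0], by simp [Matrix.det_fin_two_of]⟩

/-- `c = diag(z⁻¹, z)` as an element of `SL₂(F)`. -/
def cSL : SpecialLinearGroup (Fin 2) F :=
  ⟨!![((D.z⁻¹ : Fˣ) : F), 0; 0, (D.z : F)], by simp [Matrix.det_fin_two_of]⟩

theorem conj_cSL_mem (g : SpecialLinearGroup (Fin 2) k) :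
    D.cSL * slIncl k F g * D.cSL⁻¹ ∈ (slIncl k F).range := by
  obtain ⟨g, hg⟩ := g
  have hdet : g 0 0 * g 1 1 - g 0 1 * g 1 0 = 1 := by rw [← Matrix.det_fin_two]; exact hg
  have hk : (D.ω : k) ≠ 0 := D.ω.ne_zero
  have hz : (D.z : F) ≠ 0 := D.z.ne_zero
  have hdet' : (!![g 0 0, g 0 1 * (D.ω : k)⁻¹; g 1 0 * (D.ω : k), g 1 1]).det = 1 := by
    rw [Matrix.det_fin_two_of]
    field_simp
    linear_combination hdet
  refine ⟨⟨_, hdet'⟩, ?_⟩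
  rw [eq_mul_inv_iff_mul_eq]
  apply Subtype.ext
  change (!![g 0 0, g 0 1 * (D.ω : k)⁻¹; g 1 0 * (D.ω : k), g 1 1]).map (algebraMap k F) *
    !![((D.z⁻¹ : Fˣ) : F), 0; 0, (D.z : F)] =
      !![((D.z⁻¹ : Fˣ) : F), 0; 0, (D.z : F)] * g.map (algebraMap k F)
  ext i j
  fin_cases i <;> fin_cases j <;>
    simp [Matrix.mul_apply, Fin.sum_univ_two, ← D.z_sq] <;> field_simp

theorem conj_cSL_inv_mem (g : SpecialLinearGroup (Fin 2) k) :
    D.cSL⁻¹ * slIncl k F g * D.cSL ∈ (slIncl k F).range := by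
  obtain ⟨g, hg⟩ := g
  have hdet : g 0 0 * g 1 1 - g 0 1 * g 1 0 = 1 := by rw [← Matrix.det_fin_two]; exact hg
  have hk : (D.ω : k) ≠ 0 := D.ω.ne_zero
  have hz : (D.z : F) ≠ 0 := D.z.ne_zero
  have hdet' : (!![g 0 0, g 0 1 * (D.ω : k); g 1 0 * (D.ω : k)⁻¹, g 1 1]).det = 1 := by
    rw [Matrix.det_fin_two_of]
    field_simp
    linear_combination hdet
  refine ⟨⟨_, hdet'⟩, ?_⟩
  rw [mul_assoc, eq_inv_mul_iff_mul_eq]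
  apply Subtype.ext
  change !![((D.z⁻¹ : Fˣ) : F), 0; 0, (D.z : F)] *
    (!![g 0 0, g 0 1 * (D.ω : k); g 1 0 * (D.ω : k)⁻¹, g 1 1]).map (algebraMap k F) =
      g.map (algebraMap k F) * !![((D.z⁻¹ : Fˣ) : F), 0; 0, (D.z : F)]
  ext i j
  fin_cases i <;> fin_cases j <;>
    simp [Matrix.mul_apply, Fin.sum_univ_two, ← D.z_sq] <;> field_simp

theorem cSL_mem : D.cSL ∈ slNormalizer k F := by
  rw [slNormalizer, Subgroup.mem_normalizer_iff]
  intro n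
  constructor
  · rintro ⟨g, rfl⟩
    exact D.conj_cSL_mem g
  · rintro ⟨g, hg⟩
    have h := D.conj_cSL_inv_mem g
    rw [hg] at h
    simpa [mul_assoc] using h

/-- `c` as an element of `N`. -/
def c : slNormalizer k F := ⟨D.cSL, D.cSL_mem⟩

/-- `R = ⟨x, y⟩ ≤ SL₂(k)`. -/
def R : Subgroup (SpecialLinearGroup (Fin 2) k) := Subgroup.closure {D.x, D.y}

/-- `Q = ⟨x^(2^l), y⟩ ≤ R`. -/
def Q : Subgroup (SpecialLinearGroup (Fin 2) k) := Subgroup.closure {D.x ^ 2 ^ l, D.y}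

/-- `Q' = ⟨x^(2^l), x y⟩ ≤ R`. -/
def Q' : Subgroup (SpecialLinearGroup (Fin 2) k) := Subgroup.closure {D.x ^ 2 ^ l, D.x * D.y}

/-- `𝐝 = [y, y, y] [c, c, c]`. -/
def d : KGroup k F := cubeToK k F (fun _ => D.y) * diagToK k F D.c

/-- `τ' = 𝐝 τ`. -/
def tau' : KGroup k F := D.d * tauK k F

/-- `R₀ = R₁ R₂ R₃`. -/
def R0 : Subgroup (KGroup k F) := prodSub k F fun _ => D.R

/-- `S = R₀ ⟨𝐝, τ⟩`. -/
def S : Subgroup (KGroup k F) := D.R0 ⊔ Subgroup.closure {D.d, tauK k F}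

/-- The fusion system `𝒦 = 𝓕_S(K)`. -/
def fusionK : FusionSystem D.S := FusionSystem.ofGroup D.S

end SolSetup

/-- Labels of the eleven representatives; in order
`S`, `C_S(U)`, `Q₁Q₂Q₃`, `Q₁Q₂Q₃'`, `Q₁Q₂R₃`, `Q₁Q₂'R₃`, `Q₁Q₂Q₃⟨τ⟩`, `Q₁Q₂Q₃'⟨τ⟩`, `Q₁Q₂R₃⟨τ⟩`,
`Q₁Q₂'R₃⟨τ'⟩`, `R₁R₂Q₃⟨τ⟩`. -/
inductive TableRow : Type
  | S | CSU | QQQ | QQQ' | QQR | QQ'R | QQQτ | QQQ'τ | QQRτ | QQ'Rτ' | RRQτ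

namespace SolSetup

variable {l : ℕ} {k F : Type*} [Field k] [Field F] [Algebra k F] (D : SolSetup l k F)

/-- The representatives, as subgroups of `K`. -/
def repK : TableRow → Subgroup (KGroup k F)
  | .S => D.S
  | .CSU => D.S ⊓ Subgroup.centralizer (USub k F : Set (KGroup k F))
  | .QQQ => prodSub k F ![D.Q, D.Q, D.Q]
  | .QQQ' => prodSub k F ![D.Q, D.Q, D.Q']
  | .QQR => prodSub k F ![D.Q, D.Q, D.R]
  | .QQ'R => prodSub k F ![D.Q, D.Q', D.R]
  | .QQQτ => prodSub k F ![D.Q, D.Q, D.Q] ⊔ Subgroup.zpowers (tauK k F)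
  | .QQQ'τ => prodSub k F ![D.Q, D.Q, D.Q'] ⊔ Subgroup.zpowers (tauK k F)
  | .QQRτ => prodSub k F ![D.Q, D.Q, D.R] ⊔ Subgroup.zpowers (tauK k F)
  | .QQ'Rτ' => prodSub k F ![D.Q, D.Q', D.R] ⊔ Subgroup.zpowers D.tau'
  | .RRQτ => prodSub k F ![D.R, D.R, D.Q] ⊔ Subgroup.zpowers (tauK k F)

theorem Q_le_R : D.Q ≤ D.R := by
  rw [Q, Subgroup.closure_le]
  have hx : D.x ∈ D.R := Subgroup.subset_closure (by simp)
  have hy : D.y ∈ D.R := Subgroup.subset_closure (by simp)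
  rintro _ (rfl | rfl)
  · exact pow_mem hx _
  · exact hy

theorem Q'_le_R : D.Q' ≤ D.R := by
  rw [Q', Subgroup.closure_le]
  have hx : D.x ∈ D.R := Subgroup.subset_closure (by simp)
  have hy : D.y ∈ D.R := Subgroup.subset_closure (by simp)
  rintro _ (rfl | rfl)
  · exact pow_mem hx _
  · exact mul_mem hx hy

/-- All the representatives are contained in `S`. -/
theorem repK_le_S (r : TableRow) : D.repK r ≤ D.S := by
  have hd : D.d ∈ D.S :=
    (le_sup_right : _ ≤ D.S) (Subgroup.subset_closure (by simp))
  have ht : tauK k F ∈ D.S :=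
    (le_sup_right : _ ≤ D.S) (Subgroup.subset_closure (by simp))
  have ht' : D.tau' ∈ D.S := mul_mem hd ht
  have hp : ∀ A : Fin 3 → Subgroup _, (∀ i, A i ≤ D.R) → prodSub k F A ≤ D.S := by
    intro A hA
    refine le_trans (Subgroup.map_mono ?_) (le_sup_left : D.R0 ≤ D.S)
    intro f hf i hi
    exact hA i (hf i hi)
  have hQ := D.Q_le_R
  have hQ' := D.Q'_le_R
  cases r <;> simp only [repK, sup_le_iff, Subgroup.zpowers_le, ht, ht', and_true, le_refl,
    inf_le_left] <;>
    (apply hp; intro i; fin_cases i <;> simp [hQ, hQ'])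

/-- The representatives, as subgroups of `S`. -/
def rep (r : TableRow) : Subgroup D.S := (D.repK r).subgroupOf D.S

end SolSetup

/-! The group `K̂` consists of all `(f₁, f₂, f₃) σ` in `N ≀ S₃` whose coordinates lie in one coset
of `L = SL₂(q)` in `N`; this group of triples is called `M`. The centre of `M` is generated by `(ε,
ε, ε)` with `ε = -1`, and `K` is the quotient by it. Conjugacy, centralizers and outer automorphism
groups of subgroups of `S` are therefore read off from their full preimages in `M`
(`isConj_iff_hat`, `nonempty_out_mulEquiv`).

Let `Y` be the preimage of a centric radical subgroup. Centricity and radicality together force `Y`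
to contain every `2`-subgroup normalized by `N_M(Y)` (`le_hat`). More generally `Y` meets a subgroup
`H` normalized by `N_M(Y)` in a subgroup of odd index, provided that the elements of odd order of
`H` normalizing `Y` centralize `Y` (`not_dvd_relIndex`). Hence `Y ∩ L³` is the product of its
coordinate projections `Aᵢ`. If some element of odd order of `N_L(Aᵢ)` acts nontrivially on `Aᵢ`,
then `Aᵢ`, being up to conjugacy a subgroup of the generalized quaternion group `R`, is quaternion
of order eight and `N`-conjugate to `Q`. Otherwise `Aᵢ` has odd index in `N_L(Aᵢ)`, hence is a Sylow
subgroup of `L` and conjugate to `R` (`exists_proj_eq`).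

The groups `Q` and `Q' = e Q e⁻¹`, with `e = y c`, are conjugate in `N` but not in `L`, because
`N_N(Q) ≤ L`. As the coordinates of an element of `M` share their coset, six products remain up to
conjugacy: `QQQ`, `QQQ'`, `QQR`, `QQ'R`, `RRQ`, `RRR` (`stdTypes`). The normalizer of such a product
acts on its quaternion factors through `psi`, with values in `S₃ ≀ S₃`. The kernel `lam` is a
`2`-group and so lies in `Y`. The image of `Y` is a `2`-group meeting the base group trivially, so
it has order at most two, and after conjugation it is trivial or generated by the transposition
`swapW` (`IsOver.exists_conj_eq`). For `RRQ` the transposition is central in the range of `psi`, so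
the trivial image cannot occur. This leaves `2 · 6 - 1 = 11` candidates.

Conversely, the candidates are pairwise nonconjugate: `Y ∩ L³` determines the type, and the order
decides whether the transposition is present. Each contains a product of three quaternion groups,
whose centralizer modulo `(ε, ε, ε)` is `{1, ε}³`, so each is centric. Its outer automorphism group
is the range of `psi`, or the centralizer of `swapW` there modulo `swapW`. These groups are built
from `S₃` by products and wreath products, or are trivial, and have no nontrivial normal
`2`-subgroup.

The facts about `N` that are used come from the torus of diagonal matrices, from the equality of the
`2`-part of `q - 1` with `2^(l+2)`, and from `N / L` having order two. -/

section

/-! ### Conjugates of subgroups -/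

section ConjSub

open scoped Pointwise

variable {G : Type*} [Group G]

/-- The conjugate `g A g⁻¹`. -/
def conjSub (g : G) (A : Subgroup G) : Subgroup G := A.comap (MulAut.conj g⁻¹).toMonoidHom

@[simp] theorem mem_conjSub {g x : G} {A : Subgroup G} :
    x ∈ conjSub g A ↔ g⁻¹ * x * g ∈ A := by
  simp [conjSub, Subgroup.mem_comap]

theorem conj_mem_conjSub {g x : G} {A : Subgroup G} :
    g * x * g⁻¹ ∈ conjSub g A ↔ x ∈ A := by
  simp [mul_assoc]

theorem conjSub_mul (g h : G) (A : Subgroup G) :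
    conjSub (g * h) A = conjSub g (conjSub h A) := by
  ext x
  simp [mul_assoc]

@[simp] theorem conjSub_one (A : Subgroup G) : conjSub 1 A = A := by
  ext x
  simp

theorem conjSub_inv_eq {g : G} {A B : Subgroup G} (h : conjSub g A = B) : conjSub g⁻¹ B = A := by
  rw [← h, ← conjSub_mul, inv_mul_cancel, conjSub_one]

theorem conjSub_mono {g : G} {A B : Subgroup G} (h : A ≤ B) : conjSub g A ≤ conjSub g B :=
  fun _ hx => h hx

theorem conjSub_eq_iff {g : G} {A B : Subgroup G} :
    conjSub g A = B ↔ ∀ x, x ∈ A ↔ g * x * g⁻¹ ∈ B := by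
  constructor
  · rintro rfl x
    exact conj_mem_conjSub.symm
  · intro h
    ext x
    rw [mem_conjSub, h]
    simp [mul_assoc]

theorem mem_normalizer_iff_conjSub {g : G} {A : Subgroup G} :
    g ∈ Subgroup.normalizer (A : Set G) ↔ conjSub g A = A := by
  rw [Subgroup.mem_normalizer_iff, conjSub_eq_iff]

theorem conjSub_eq_self_of_mem {g : G} {A : Subgroup G} (h : g ∈ A) : conjSub g A = A :=
  mem_normalizer_iff_conjSub.mp (Subgroup.le_normalizer h)

theorem conjSub_eq_map (g : G) (A : Subgroup G) :
    conjSub g A = A.map (MulAut.conj g).toMonoidHom := by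
  ext x
  rw [mem_conjSub, Subgroup.mem_map]
  constructor
  · intro h
    exact ⟨_, h, by simp [mul_assoc]⟩
  · rintro ⟨y, hy, rfl⟩
    simpa [mul_assoc] using hy

theorem card_conjSub (g : G) (A : Subgroup G) : Nat.card (conjSub g A) = Nat.card A := by
  rw [conjSub_eq_map]
  exact Subgroup.card_map_of_injective (MulAut.conj g).injective

theorem IsPGroup.conjSub {p : ℕ} {A : Subgroup G} (h : IsPGroup p A) (g : G) :
    IsPGroup p (conjSub g A) := by
  rw [conjSub_eq_map]
  exact h.map _

theorem conjSub_le_of_normal {g : G} {A B : Subgroup G} [B.Normal] (h : A ≤ B) :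
    conjSub g A ≤ B := by
  intro x hx
  have := Subgroup.Normal.conj_mem ‹B.Normal› _ (h (mem_conjSub.mp hx)) g
  simpa [mul_assoc] using this

/-- A `p`-subgroup is conjugate to a subgroup of a given `p`-subgroup of index prime to `p`. -/
theorem exists_conjSub_le [Finite G] {p : ℕ} [Fact p.Prime] {S P : Subgroup G}
    (hS : IsPGroup p S) (hi : ¬ p ∣ S.index) (hP : IsPGroup p P) : ∃ g, conjSub g P ≤ S := by
  obtain ⟨Y, hY⟩ := hP.exists_le_sylow
  obtain ⟨g, hg⟩ := MulAction.exists_smul_eq G Y (hS.toSylow hi)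
  refine ⟨g, ?_⟩
  have h1 : ((g • Y : Sylow p G) : Subgroup G) = S := by rw [hg]; simp
  intro x hx
  rw [← h1, Sylow.coe_subgroup_smul, Subgroup.mem_pointwise_smul_iff_inv_smul_mem]
  have := hY (mem_conjSub.mp hx)
  simpa [MulAut.smul_def, mul_assoc] using this

/-- A proper subgroup of a finite `p`-subgroup is properly contained in its normalizer there. -/
theorem IsPGroup.exists_mem_normalizer [Finite G] {p : ℕ} [Fact p.Prime] {P Y : Subgroup G}
    (hYp : IsPGroup p Y) (hY : P ≤ Y) (hne : P ≠ Y) :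
    ∃ y ∈ Y, y ∉ P ∧ y ∈ Subgroup.normalizer (P : Set G) := by
  have hne' : P.subgroupOf Y ≠ ⊤ := by
    intro h
    rw [Subgroup.subgroupOf_eq_top] at h
    exact hne (le_antisymm hY h)
  have : Group.IsNilpotent Y := hYp.isNilpotent
  have hlt := Group.normalizerCondition_of_isNilpotent (G := Y) (P.subgroupOf Y)
    (lt_top_iff_ne_top.mpr hne')
  obtain ⟨y, hy, hyP⟩ := SetLike.exists_of_lt hlt
  refine ⟨y, y.2, fun h => hyP (by simpa [Subgroup.mem_subgroupOf] using h), ?_⟩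
  rw [Subgroup.mem_normalizer_iff] at hy ⊢
  intro h
  constructor
  · intro hh
    exact (hy ⟨h, hY hh⟩).mp hh
  · intro hh
    have hmem : h ∈ Y := by
      have h1 := mul_mem (mul_mem (inv_mem y.2) (hY hh)) y.2
      simpa [mul_assoc] using h1
    exact (hy ⟨h, hmem⟩).mpr hh

/-- In a finite group, a `p`-subgroup of index divisible by `p` is properly contained in its
normalizer in some `p`-subgroup. -/
theorem exists_mem_normalizer_of_dvd_index [Finite G] {p : ℕ} [Fact p.Prime] {P : Subgroup G}
    (hP : IsPGroup p P) (hi : p ∣ P.index) :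
    ∃ T : Subgroup G, IsPGroup p T ∧ P ≤ T ∧
      ∃ y ∈ T, y ∉ P ∧ y ∈ Subgroup.normalizer (P : Set G) := by
  obtain ⟨Y, hY⟩ := hP.exists_le_sylow
  exact ⟨Y, Y.2, hY, Y.2.exists_mem_normalizer hY fun h => Y.not_dvd_index (h ▸ hi)⟩

/-- As `P` normalizes `H`, the join is the set `H P`, so every left coset of `P` in it has a
representative in `H`. Normality of `P` is not required. -/
theorem relIndex_sup_of_le_normalizer {P H : Subgroup G}
    (h : P ≤ Subgroup.normalizer (H : Set G)) : P.relIndex (P ⊔ H) = P.relIndex H := by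
  let f := Subgroup.quotientSubgroupOfEmbeddingOfLE P (le_sup_right : H ≤ P ⊔ H)
  refine (Nat.card_congr (Equiv.ofBijective f ⟨f.injective, fun y => ?_⟩)).symm
  obtain ⟨⟨y, hy⟩, rfl⟩ := QuotientGroup.mk_surjective y
  have h1 : y ∈ ((H ⊔ P : Subgroup G) : Set G) := by rw [sup_comm]; exact hy
  rw [Subgroup.coe_mul_of_right_le_normalizer_left _ _ h] at h1
  obtain ⟨a, ha, b, hb, hab⟩ := Set.mem_mul.mp h1
  refine ⟨QuotientGroup.mk ⟨a, ha⟩, ?_⟩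
  change QuotientGroup.mk _ = QuotientGroup.mk _
  rw [QuotientGroup.eq, Subgroup.mem_subgroupOf]
  have : b = a⁻¹ * y := by rw [← hab]; group
  simpa [this] using hb

end ConjSub

/-! ### Fusion systems of groups, read in a group `M` that maps onto the ambient group -/

namespace FusionSystem

section OfGroup

open scoped Pointwise

variable {M G : Type*} [Group M] [Group G] (π : M →* G) {S : Subgroup G}

/-- The preimage in `M` of a subgroup of `S`. -/
def hat (P : Subgroup S) : Subgroup M := (P.map S.subtype).comap π

variable {π}

theorem mem_hat {P : Subgroup S} {m : M} : m ∈ hat π P ↔ ∃ x : P, ((x : S) : G) = π m := by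
  simp only [hat, Subgroup.mem_comap, Subgroup.mem_map]
  constructor
  · rintro ⟨x, hx, h⟩
    exact ⟨⟨x, hx⟩, h⟩
  · rintro ⟨x, h⟩
    exact ⟨x, x.2, h⟩

theorem ker_le_hat (P : Subgroup S) : π.ker ≤ hat π P := by
  intro m hm
  rw [MonoidHom.mem_ker] at hm
  exact mem_hat.mpr ⟨1, by simp [hm]⟩

theorem hat_subgroupOf {P : Subgroup G} (hP : P ≤ S) : hat π (P.subgroupOf S) = P.comap π := by
  rw [hat, Subgroup.map_subgroupOf_eq_of_le hP]

theorem exists_hat_eq {T : Subgroup M} (hk : π.ker ≤ T)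
    (hT : T ≤ S.comap π) : ∃ P : Subgroup S, hat π P = T := by
  refine ⟨(T.map π).subgroupOf S, ?_⟩
  rw [hat_subgroupOf (Subgroup.map_le_iff_le_comap.mpr hT), Subgroup.comap_map_eq_self hk]

theorem isConj_ofGroup_iff {P Q : Subgroup S} :
    (ofGroup S).IsConj P Q ↔ ∃ g : G, conjSub g (P.map S.subtype) = Q.map S.subtype := by
  constructor
  · rintro ⟨f, ⟨g, hg⟩, -⟩
    refine ⟨g, conjSub_eq_iff.mpr fun x => ⟨?_, ?_⟩⟩
    · rintro ⟨y, hy, rfl⟩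
      exact ⟨f ⟨y, hy⟩, (f ⟨y, hy⟩).2, hg ⟨y, hy⟩⟩
    · rintro ⟨y, hy, hxy⟩
      have h := hg (f.symm ⟨y, hy⟩)
      have h2 : f.toMonoidHom (f.symm ⟨y, hy⟩) = ⟨y, hy⟩ := f.apply_symm_apply _
      rw [h2] at h
      have h3 : (S.subtype y : G) = y := rfl
      rw [h3] at hxy
      refine ⟨f.symm ⟨y, hy⟩, (f.symm ⟨y, hy⟩).2, ?_⟩
      have h4 : g * (((f.symm ⟨y, hy⟩ : P) : S) : G) * g⁻¹ = g * x * g⁻¹ := by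
        rw [← h, ← hxy]
      simpa using h4
  · rintro ⟨g, hg⟩
    rw [conjSub_eq_iff] at hg
    have hPQ : ∀ x : P, g * ((x : S) : G) * g⁻¹ ∈ Q.map S.subtype := fun x =>
      (hg _).mp ⟨x, x.2, rfl⟩
    have hQP : ∀ y : Q, g⁻¹ * ((y : S) : G) * g ∈ P.map S.subtype := fun y =>
      (hg _).mpr ⟨y, y.2, by simp [mul_assoc]⟩
    have hl : ∀ {T : Subgroup S} {x : G}, x ∈ T.map S.subtype → ∃ t : T, ((t : S) : G) = x := by
      rintro T x ⟨y, hy, rfl⟩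
      exact ⟨⟨y, hy⟩, rfl⟩
    choose f hf using fun x => hl (hPQ x)
    choose f' hf' using fun y => hl (hQP y)
    refine ⟨{ toFun := f, invFun := f', left_inv := ?_, right_inv := ?_, map_mul' := ?_ },
      ⟨g, hf⟩, ⟨g⁻¹, ?_⟩⟩
    · intro x
      refine Subtype.ext (Subtype.ext ?_)
      rw [hf', hf]
      simp [mul_assoc]
    · intro x
      refine Subtype.ext (Subtype.ext ?_)
      rw [hf, hf']
      simp [mul_assoc]
    · intro x y
      refine Subtype.ext (Subtype.ext ?_)
      simp [hf, mul_assoc]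
    · intro x
      rw [inv_inv]
      exact hf' x

/-- Full preimages contain the kernel, so an equality of conjugates lifts along the surjection and
descends again without loss. -/
theorem isConj_iff_hat (hπ : Function.Surjective π) {P Q : Subgroup S} :
    (ofGroup S).IsConj P Q ↔ ∃ m : M, conjSub m (hat π P) = hat π Q := by
  rw [isConj_ofGroup_iff]
  constructor
  · rintro ⟨g, hg⟩
    obtain ⟨m, rfl⟩ := hπ g
    refine ⟨m, conjSub_eq_iff.mpr fun x => ?_⟩
    rw [hat, Subgroup.mem_comap, conjSub_eq_iff.mp hg, hat, Subgroup.mem_comap]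
    simp
  · rintro ⟨m, hm⟩
    refine ⟨π m, conjSub_eq_iff.mpr fun x => ?_⟩
    obtain ⟨x, rfl⟩ := hπ x
    have := conjSub_eq_iff.mp hm x
    simpa [hat] using this

/-- The action of the normalizer of `P` on `P` by conjugation. -/
noncomputable def autHom (P : Subgroup S) :
    Subgroup.normalizer ((P.map S.subtype : Subgroup G) : Set G) →* MulAut P :=
  (MulAut.congr (P.equivMapOfInjective S.subtype S.subtype_injective).symm).toMonoidHom.comp
    (P.map S.subtype).normalizerMonoidHom

theorem coe_autHom (P : Subgroup S)
    (g : Subgroup.normalizer ((P.map S.subtype : Subgroup G) : Set G)) (x : P) :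
    ((autHom P g x : S) : G) = g * ((x : S) : G) * (g : G)⁻¹ := by
  set E := P.equivMapOfInjective S.subtype S.subtype_injective
  have h : ∀ y, ((E.symm y : S) : G) = y := by
    intro y
    obtain ⟨z, rfl⟩ := E.surjective y
    rw [E.symm_apply_apply]
    rfl
  change ((E.symm _ : S) : G) = _
  rw [h]
  rfl

theorem map_mem_normalizer {P : Subgroup S} {m : M}
    (hm : m ∈ Subgroup.normalizer (hat π P : Set M)) (hπ : Function.Surjective π) :
    π m ∈ Subgroup.normalizer ((P.map S.subtype : Subgroup G) : Set G) := by
  rw [Subgroup.mem_normalizer_iff] at hm ⊢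
  intro x
  obtain ⟨x, rfl⟩ := hπ x
  have := hm x
  simpa [hat] using this

/-- The map from the normalizer of `P` to `Out_𝓕(P)`. -/
noncomputable def outHom (hπ : Function.Surjective π) (P : Subgroup S) :
    Subgroup.normalizer (hat π P : Set M) →* (ofGroup S).Out P :=
  (QuotientGroup.mk' ((innerAut P).subgroupOf ((ofGroup S).Aut P))).comp <|
    ((autHom P).codRestrict ((ofGroup S).Aut P) fun g =>
      (⟨(g : G), coe_autHom P g⟩ : ∃ g' : G, ∀ x : P,
        ((autHom P g x : S) : G) = g' * ((x : S) : G) * g'⁻¹)).comp <|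
      (π.comp (Subgroup.subtype (Subgroup.normalizer (hat π P : Set M)))).codRestrict _
        fun m => map_mem_normalizer (P := P) (m := (m : M)) m.2 hπ

theorem outHom_surjective (hπ : Function.Surjective π) (P : Subgroup S) :
    Function.Surjective (outHom hπ P) := by
  intro a
  obtain ⟨⟨a, ha⟩, rfl⟩ := QuotientGroup.mk'_surjective _ a
  obtain ⟨g, hg⟩ := ha
  obtain ⟨m, rfl⟩ := hπ g
  have hg' : ∀ x : P, ((a x : S) : G) = π m * ((x : S) : G) * (π m)⁻¹ := hg
  have hm : m ∈ Subgroup.normalizer (hat π P : Set M) := by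
    rw [Subgroup.mem_normalizer_iff]
    intro y
    rw [mem_hat, mem_hat]
    constructor
    · rintro ⟨x, hx⟩
      exact ⟨a x, by rw [hg', hx]; simp⟩
    · rintro ⟨x, hx⟩
      refine ⟨a.symm x, ?_⟩
      have := hg' (a.symm x)
      rw [a.apply_symm_apply, hx] at this
      simpa using this.symm
  refine ⟨⟨m, hm⟩, ?_⟩
  refine congrArg (QuotientGroup.mk' _) (Subtype.ext ?_)
  ext x
  change ((autHom P ⟨π m, _⟩ x : S) : G) = _
  rw [coe_autHom, hg']

/-- The action of `m` agrees with that of `p` exactly when `p⁻¹ m` centralizes `P`. Commutation is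
tested after applying `π`, since in `M` the commutators may be nontrivial elements of the kernel. -/
theorem outHom_eq_one_iff (hπ : Function.Surjective π) (P : Subgroup S)
    (m : Subgroup.normalizer (hat π P : Set M)) :
    outHom hπ P m = 1 ↔
      ∃ p ∈ hat π P, ∀ x ∈ hat π P, π (p⁻¹ * m * x) = π (x * (p⁻¹ * m)) := by
  have key : outHom hπ P m = 1 ↔ autHom P ⟨π m, map_mem_normalizer m.2 hπ⟩ ∈ innerAut P :=
    QuotientGroup.eq_one_iff _
  rw [key]
  constructor
  · rintro ⟨p, hp⟩
    obtain ⟨p', hp'⟩ := hπ ((p : S) : G)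
    refine ⟨p', mem_hat.mpr ⟨p, hp'.symm⟩, fun x hx => ?_⟩
    obtain ⟨x', hx'⟩ := mem_hat.mp hx
    have h := congrArg (fun f : MulAut P => ((f x' : S) : G)) hp
    simp only [coe_autHom, MulAut.conj_apply, Subgroup.coe_mul, Subgroup.coe_inv] at h
    simp only [map_mul, map_inv, hp', ← hx']
    rw [eq_mul_inv_iff_mul_eq] at h
    rw [mul_assoc, inv_mul_eq_iff_eq_mul, ← h]
    simp [mul_assoc]
  · rintro ⟨p', hp', h⟩
    obtain ⟨p, hp⟩ := mem_hat.mp hp'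
    refine ⟨p, ?_⟩
    ext x
    obtain ⟨x', hx'⟩ := hπ ((x : S) : G)
    have h1 := h x' (mem_hat.mpr ⟨x, hx'.symm⟩)
    simp only [map_mul, map_inv, ← hp, hx'] at h1
    simp only [coe_autHom, MulAut.conj_apply, Subgroup.coe_mul, Subgroup.coe_inv]
    rw [eq_mul_inv_iff_mul_eq]
    rw [mul_assoc, inv_mul_eq_iff_eq_mul] at h1
    rw [h1]
    simp [mul_assoc]

/-- If the centralizer of `P` is contained in `P`, then `Out_𝓕(P)` is isomorphic to every group
that arises as the image of a homomorphism on the normalizer of `P` with kernel `P`. -/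
theorem nonempty_out_mulEquiv (hπ : Function.Surjective π) {P : Subgroup S}
    (hC : ∀ m, (∀ x ∈ hat π P, π (m * x) = π (x * m)) → m ∈ hat π P)
    {W T : Type*} [Group W] [Group T] (ψ : Subgroup.normalizer (hat π P : Set M) →* W)
    (hψ : ∀ m, ψ m = 1 ↔ (m : M) ∈ hat π P) (ρ : T →* W) (hρ : Function.Injective ρ)
    (hr : ρ.range = ψ.range) : Nonempty ((ofGroup S).Out P ≃* T) := by
  -- Elements centralizing `P` lie in its preimage, so acting as an inner automorphism means
  -- belonging to the preimage. Both homomorphisms thus have the same kernel.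
  have hker : (outHom hπ P).ker = ψ.ker := by
    ext m
    rw [MonoidHom.mem_ker, MonoidHom.mem_ker, hψ, outHom_eq_one_iff]
    constructor
    · rintro ⟨p, hp, h⟩
      have := mul_mem hp (hC _ h)
      simpa using this
    · intro hm
      exact ⟨m, hm, by simp⟩
  exact ⟨(QuotientGroup.quotientKerEquivOfSurjective _ (outHom_surjective hπ P)).symm.trans <|
    (QuotientGroup.quotientMulEquivOfEq hker).trans <|
    (QuotientGroup.quotientKerEquivRange ψ).trans <|
    (MulEquiv.subgroupCongr hr.symm).trans (MonoidHom.ofInjective hρ).symm⟩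

/-- The hypothesis concerns the centralizer in all of `G`, not only in `S`, and is therefore
inherited by every conjugate of `P`. -/
theorem isCentric_of_centralizer_le (hπ : Function.Surjective π) {P : Subgroup S}
    (hC : ∀ m, (∀ x ∈ hat π P, π (m * x) = π (x * m)) → m ∈ hat π P) :
    (ofGroup S).IsCentric P := by
  intro Q hQ
  obtain ⟨m, hm⟩ := (isConj_iff_hat hπ).mp hQ
  apply le_antisymm
  · intro s hs
    rw [Subgroup.mem_centralizer_iff] at hs
    obtain ⟨t, ht⟩ := hπ (s : G)
    have h1 : m⁻¹ * t * m ∈ hat π P := by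
      apply hC
      intro x hx
      obtain ⟨y, hy⟩ := mem_hat.mp (show m * x * m⁻¹ ∈ hat π Q from
        (conjSub_eq_iff.mp hm x).mp hx)
      have h2 := congrArg (Subtype.val) (hs y y.2)
      simp only [Subgroup.coe_mul] at h2
      rw [hy, ← ht] at h2
      simp only [map_mul, map_inv] at h2 ⊢
      calc (π m)⁻¹ * π t * π m * π x = (π m)⁻¹ * (π t * (π m * π x * (π m)⁻¹)) * π m := by group
        _ = _ := by rw [← h2]; group
    have h3 : t ∈ hat π Q := by
      have := (conjSub_eq_iff.mp hm _).mp h1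
      simpa [mul_assoc] using this
    obtain ⟨y, hy⟩ := mem_hat.mp h3
    have hsy : (y : S) = s := Subtype.ext (by rw [hy, ht])
    refine ⟨y, ?_, hsy⟩
    rw [SetLike.mem_coe, Subgroup.mem_center_iff]
    intro x
    exact Subtype.ext (by simpa [hsy] using hs x x.2)
  · rintro _ ⟨y, hy, rfl⟩
    rw [Subgroup.mem_centralizer_iff]
    intro x hx
    exact congrArg Subtype.val (Subgroup.mem_center_iff.mp hy ⟨x, hx⟩)

/-- A `p`-subgroup of `G` that contains `P` and an element centralizing `P` forces this element
into `P`, if `P` is centric. -/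
theorem IsCentric.mem_hat {p : ℕ} [Fact p.Prime] [Finite G] (hπ : Function.Surjective π)
    (hS : IsPGroup p S) (hi : ¬ p ∣ S.index) {P : Subgroup S} (hP : (ofGroup S).IsCentric P)
    {T : Subgroup M} (hT : IsPGroup p T) (hPT : hat π P ≤ T) {c : M} (hcT : c ∈ T)
    (hc : ∀ x ∈ hat π P, π (c * x) = π (x * c)) : c ∈ hat π P := by
  -- Some conjugate of `T` maps into `S`. The same element carries `P` to a conjugate `Q ≤ S` and
  -- `c` to an element of `C_S(Q) = Z(Q)`.
  obtain ⟨g, hg⟩ := exists_conjSub_le hS hi (hT.map π)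
  obtain ⟨m, rfl⟩ := hπ g
  have hTS : ∀ t ∈ T, π (m * t * m⁻¹) ∈ S := by
    intro t ht
    apply hg
    have := conj_mem_conjSub (g := π m).mpr (Subgroup.mem_map_of_mem π ht)
    simpa using this
  obtain ⟨Q, hQ⟩ := exists_hat_eq (π := π) (S := S) (T := conjSub m (hat π P)) (by
      intro x hx
      rw [mem_conjSub]
      apply ker_le_hat
      rw [MonoidHom.mem_ker] at hx ⊢
      simp [hx]) (by
      intro x hx
      have := hTS _ (hPT (mem_conjSub.mp hx))
      simpa [mul_assoc] using this)
  have h1 := hP Q ((isConj_iff_hat hπ).mpr ⟨m, hQ.symm⟩)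
  have h2 : (⟨π (m * c * m⁻¹), hTS c hcT⟩ : S) ∈ Subgroup.centralizer (Q : Set S) := by
    rw [Subgroup.mem_centralizer_iff]
    intro y hy
    obtain ⟨x, hx⟩ := hπ (y : G)
    have hx' : x ∈ conjSub m (hat π P) := by
      rw [← hQ, FusionSystem.mem_hat]
      exact ⟨⟨y, hy⟩, hx.symm⟩
    have h3 := hc _ (mem_conjSub.mp hx')
    apply Subtype.ext
    simp only [Subgroup.coe_mul, ← hx]
    simp only [map_mul, map_inv] at h3 ⊢
    calc π x * (π m * π c * (π m)⁻¹) = π m * ((π m)⁻¹ * π x * π m * π c) * (π m)⁻¹ := by group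
      _ = _ := by rw [← h3]; group
  rw [h1] at h2
  obtain ⟨y, -, hy⟩ := h2
  have h4 : m * c * m⁻¹ ∈ hat π Q :=
    FusionSystem.mem_hat.mpr ⟨y, congrArg Subtype.val hy⟩
  rw [hQ] at h4
  exact conj_mem_conjSub.mp h4

/-- Elements of a normal subgroup of the normalizer of a radical subgroup `P` that acts on `P` as
a `p`-group act as inner automorphisms. -/
theorem IsRadical.exists_mem_hat {p : ℕ} (hπ : Function.Surjective π)
    {P : Subgroup S} (hP : (ofGroup S).IsRadical p P) {H : Subgroup M}
    (hH : ∀ m ∈ Subgroup.normalizer (hat π P : Set M), conjSub m H = H)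
    (hp : ∀ h ∈ H, h ∈ Subgroup.normalizer (hat π P : Set M) →
      ∃ k, ∀ x ∈ hat π P, h ^ p ^ k * x = x * h ^ p ^ k)
    {h : M} (hh : h ∈ H) (hn : h ∈ Subgroup.normalizer (hat π P : Set M)) :
    ∃ q ∈ hat π P, ∀ x ∈ hat π P, π (q⁻¹ * h * x) = π (x * (q⁻¹ * h)) := by
  rw [← outHom_eq_one_iff hπ P ⟨h, hn⟩]
  set N := Subgroup.normalizer (hat π P : Set M)
  set Y := (H.subgroupOf N).map (outHom hπ P)
  -- The image in `Out(P)` of the elements of `H` normalizing `P` is normal. It is a `p`-group,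
  -- because each of these elements has a `p`-power that centralizes `P`.
  have hY : Y ≤ pCore p ((ofGroup S).Out P) := by
    apply le_sSup
    constructor
    · have : (H.subgroupOf N).Normal := by
        constructor
        intro x hx m
        rw [Subgroup.mem_subgroupOf] at hx ⊢
        have := conj_mem_conjSub (g := (m : M)).mpr hx
        rw [hH m m.2] at this
        exact this
      exact this.map _ (outHom_surjective hπ P)
    · rintro ⟨_, x, hx, rfl⟩
      obtain ⟨k, hk⟩ := hp x hx x.2
      refine ⟨k, Subtype.ext ?_⟩
      simp only [Subgroup.coe_pow, ← map_pow, OneMemClass.coe_one]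
      rw [outHom_eq_one_iff]
      refine ⟨1, one_mem _, fun y hy => ?_⟩
      rw [inv_one, one_mul]
      exact congrArg π (hk y hy)
  rw [hP] at hY
  exact Subgroup.mem_bot.mp (hY ⟨⟨h, hn⟩, hh, rfl⟩)

/-- A subgroup `H` that is normalized by the normalizer of a centric radical subgroup `P` and in
which all `p'`-elements that normalize `P` centralize it meets `P` in a subgroup of `p'`-index. -/
theorem IsCentricRadical.not_dvd_relIndex {p : ℕ} [Fact p.Prime] [Finite M] [Finite G] (hπ : Function.Surjective π)
    (hk : IsPGroup p π.ker)
    (hS : IsPGroup p S) (hi : ¬ p ∣ S.index) {P : Subgroup S}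
    (hP : (ofGroup S).IsCentricRadical p P) {H : Subgroup M}
    (hH : ∀ m ∈ Subgroup.normalizer (hat π P : Set M), conjSub m H = H)
    (hp : ∀ h ∈ H, h ∈ Subgroup.normalizer (hat π P : Set M) → (orderOf h).Coprime p →
      ∀ x ∈ hat π P, h * x = x * h) :
    ¬ p ∣ (hat π P).relIndex H := by
  intro hdvd
  set Ph := hat π P with hPh
  have hPp : IsPGroup p Ph := by
    have h1 : IsPGroup p (P.map S.subtype) := (hS.to_subgroup P).map _
    exact h1.comap_of_ker_isPGroup π hk
  have hPH : Ph ≤ Subgroup.normalizer (H : Set M) := by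
    intro x hx
    exact mem_normalizer_iff_conjSub.mpr (hH x (Subgroup.le_normalizer hx))
  set J := Ph ⊔ H with hJ
  have hidx : (Ph.subgroupOf J).index = Ph.relIndex H := by
    exact relIndex_sup_of_le_normalizer hPH
  have hPJ : IsPGroup p (Ph.subgroupOf J) := hPp.comap_subtype
  -- If the index were divisible by `p`, then `Ph` would not be Sylow in `Ph H`, and some `y ∉ Ph`
  -- in a larger `p`-group would normalize it. Write `y = q h`. Radicality provides `c ∈ Ph` acting
  -- as `h` does, and centricity puts `c⁻¹ h` into `Ph`; hence `y ∈ Ph`, a contradiction.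
  obtain ⟨T, hT, hPT, y, hyT, hyP, hyn⟩ := exists_mem_normalizer_of_dvd_index hPJ (hidx ▸ hdvd)
  have hPleJ : Ph ≤ J := le_sup_left
  have hyn' : (y : M) ∈ Subgroup.normalizer (Ph : Set M) := by
    rw [Subgroup.mem_normalizer_iff] at hyn ⊢
    intro h
    constructor
    · intro hh
      have := (hyn ⟨h, hPleJ hh⟩).mp hh
      exact this
    · intro hh
      have hmem : h ∈ J := by
        have h1 := mul_mem (mul_mem (inv_mem y.2) (hPleJ hh)) y.2
        simpa [mul_assoc] using h1
      exact (hyn ⟨h, hmem⟩).mpr hh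
  obtain ⟨q, hq, h, hh, hqh⟩ : ∃ q ∈ Ph, ∃ h ∈ H, q * h = y := by
    have h1 : (y : M) ∈ ((Ph ⊔ H : Subgroup M) : Set M) := y.2
    rw [Subgroup.coe_mul_of_left_le_normalizer_right _ _ hPH] at h1
    exact Set.mem_mul.mp h1
  have hhn : h ∈ Subgroup.normalizer (Ph : Set M) := by
    have : h = q⁻¹ * y := by rw [← hqh]; group
    rw [this]
    exact mul_mem (inv_mem (Subgroup.le_normalizer hq)) hyn'
  set T' := T.map J.subtype with hT'
  have hT'p : IsPGroup p T' := hT.map _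
  have hPT' : Ph ≤ T' := by
    intro x hx
    exact ⟨⟨x, hPleJ hx⟩, hPT hx, rfl⟩
  obtain ⟨c, hc, hcc⟩ := IsRadical.exists_mem_hat hπ hP.2 hH (by
    intro x hx hxn
    -- Raising to the `p`-part of the order leaves an element of order prime to `p`.
    refine ⟨(orderOf x).factorization p, fun z hz => ?_⟩
    refine hp _ (pow_mem hx _) (pow_mem hxn _) ?_ z hz
    have ho : 0 < orderOf x := orderOf_pos x
    rw [orderOf_pow_of_dvd (pow_ne_zero _ (Fact.out : p.Prime).ne_zero) (Nat.ordProj_dvd _ _)]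
    exact (Nat.coprime_ordCompl Fact.out ho.ne').symm) hh hhn
  have hhT : h ∈ T' := by
    have : h = q⁻¹ * y := by rw [← hqh]; group
    rw [this]
    exact mul_mem (inv_mem (hPT' hq)) ⟨y, hyT, rfl⟩
  have h5 := IsCentric.mem_hat hπ hS hi hP.1 hT'p hPT' (mul_mem (inv_mem (hPT' hc)) hhT) hcc
  apply hyP
  rw [Subgroup.mem_subgroupOf, ← hqh]
  have h6 := mul_mem hc h5
  rw [mul_inv_cancel_left] at h6
  exact mul_mem hq h6

/-- A centric radical subgroup contains every `p`-subgroup normalized by its normalizer. -/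
theorem IsCentricRadical.le_hat {p : ℕ} [Fact p.Prime] [Finite M] [Finite G] (hπ : Function.Surjective π)
    (hk : IsPGroup p π.ker)
    (hS : IsPGroup p S) (hi : ¬ p ∣ S.index) {P : Subgroup S}
    (hP : (ofGroup S).IsCentricRadical p P) {H : Subgroup M} (hHp : IsPGroup p H)
    (hH : ∀ m ∈ Subgroup.normalizer (hat π P : Set M), conjSub m H = H) : H ≤ hat π P := by
  have h1 := IsCentricRadical.not_dvd_relIndex hπ hk hS hi hP hH (by
    intro h hh _ ho x _
    have : h = 1 := by
      obtain ⟨k, hk⟩ := (isPGroup_iff_orderOf_dvd_pow.mp hHp) ⟨h, hh⟩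
      rw [Subgroup.orderOf_mk] at hk
      have h2 : orderOf h = 1 := Nat.eq_one_of_dvd_coprimes (ho.pow_right k) dvd_rfl hk
      exact orderOf_eq_one_iff.mp h2
    simp [this])
  -- The index in the `p`-group `H` is a power of `p`; not being divisible by `p`, it equals one.
  rw [← Subgroup.relIndex_eq_one]
  obtain ⟨n, hn⟩ := hHp.index ((hat π P).subgroupOf H)
  change (hat π P).relIndex H = _ at hn
  rw [hn] at h1 ⊢
  rcases n with - | n
  · simp
  · exact absurd (dvd_pow_self p (Nat.succ_ne_zero n)) h1

end OfGroup

end FusionSystem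

end

section

/-! ### Triples -/

/-- The configuration of a group `N` with a normal subgroup `L` of index two, a Sylow
`2`-subgroup `R` of `L`, and a quaternion subgroup `Q` of `R` whose normalizer in `N` is contained
in `L` and acts on `Q` as a symmetric group modulo inner automorphisms, via `θ`. -/
structure QuaternionData (N : Type*) [Group N] where
  L : Subgroup N
  R : Subgroup N
  Q : Subgroup N
  ε : N
  e : N
  θ : N → Sym3
  normal_L : L.Normal
  mul_inv_mem : ∀ g h, g ∉ L → h ∉ L → g * h⁻¹ ∈ L
  e_notMem : e ∉ L
  e_mul_e : e * e = ε
  ε_ne_one : ε ≠ 1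
  ε_mul_ε : ε * ε = 1
  ε_comm : ∀ g, ε * g = g * ε
  R_le : R ≤ L
  Q_le : Q ≤ R
  ε_mem : ε ∈ Q
  conj_e_R : conjSub e R = R
  card_Q : Nat.card Q = 8
  card_R_gt : 8 < Nat.card R
  isPGroup_R : IsPGroup 2 R
  relIndex_R : ¬ 2 ∣ R.relIndex L
  eq_of_comm : ∀ g, (∀ a ∈ Q, g * a = a * g) → g = 1 ∨ g = ε
  mem_R_of_conj : ∀ g ∈ L, conjSub g R = R → g ∈ R
  θ_mul : ∀ a b, conjSub a Q = Q → conjSub b Q = Q → θ (a * b) = θ a * θ b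
  θ_eq_one_iff : ∀ a, conjSub a Q = Q → (θ a = 1 ↔ a ∈ Q)
  θ_surj : ∀ s, ∃ a ∈ L, conjSub a Q = Q ∧ θ a = s
  exists_eq_conj_Q : ∀ A ≤ R, ∀ h ∈ L, Odd (orderOf h) → conjSub h A = A →
    ¬ (∀ a ∈ A, h * a = a * h) → ∃ u, A = conjSub u Q

namespace QuaternionData

@[simp] theorem perm_symm_one {α : Type*} : Equiv.symm (1 : Equiv.Perm α) = 1 := rfl
@[simp] theorem perm_symm_inv {α : Type*} (σ : Equiv.Perm α) : Equiv.symm σ⁻¹ = σ := rfl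

variable {N : Type*} [Group N] (T : QuaternionData N)

attribute [instance] QuaternionData.normal_L

theorem Q_le_L : T.Q ≤ T.L := T.Q_le.trans T.R_le

theorem ε_mem_L : T.ε ∈ T.L := T.Q_le_L T.ε_mem

/-- Some `b ∈ L` induces the same permutation as `a`, so `a b⁻¹ ∈ Q ≤ L`. Thus `N_N(Q) ≤ L`, which
is why `Q` and `e Q e⁻¹` are not conjugate in `L`. -/
theorem mem_L_of_conj {a : N} (ha : conjSub a T.Q = T.Q) : a ∈ T.L := by
  obtain ⟨b, hb, hbQ, hθ⟩ := T.θ_surj (T.θ a)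
  have hb' : conjSub b⁻¹ T.Q = T.Q := conjSub_inv_eq hbQ
  have h1 : T.θ (a * b⁻¹) = 1 := by
    have h2 : T.θ (b * b⁻¹) = 1 := by
      rw [mul_inv_cancel, T.θ_eq_one_iff _ (conjSub_one _)]
      exact one_mem _
    rw [T.θ_mul _ _ hbQ hb'] at h2
    rw [T.θ_mul _ _ ha hb', ← hθ, h2]
  rw [T.θ_eq_one_iff _ (by rw [conjSub_mul, hb', ha])] at h1
  have := mul_mem (T.Q_le_L h1) hb
  simpa using this

theorem conj_mem_L {g x : N} : g * x * g⁻¹ ∈ T.L ↔ x ∈ T.L :=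
  ⟨fun h => by simpa [mul_assoc] using T.normal_L.conj_mem _ h g⁻¹,
    fun h => T.normal_L.conj_mem _ h g⟩

theorem mul_mem_L_iff {g h : N} : g * h ∈ T.L ↔ (g ∈ T.L ↔ h ∈ T.L) := by
  by_cases hg : g ∈ T.L
  · simp [hg, mul_mem_cancel_left]
  · by_cases hh : h ∈ T.L
    · simp [hg, hh, mul_mem_cancel_right]
    · have := T.mul_inv_mem g h⁻¹ hg (by simpa using hh)
      simpa [hg, hh] using this

/-- The group of all `(f₁, f₂, f₃) σ` with `f₁`, `f₂`, `f₃` in the same coset of `L`. -/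
def M : Subgroup (PermWreath N 3) where
  carrier := {w | ∀ i j, w.left i ∈ T.L ↔ w.left j ∈ T.L}
  one_mem' := by intro i j; simp
  mul_mem' := by
    intro a b ha hb i j
    have h1 : ∀ k, (a * b).left k = a.left k * b.left (a.right⁻¹ k) := fun k => rfl
    rw [h1, h1, T.mul_mem_L_iff, T.mul_mem_L_iff, ha i j, hb (a.right⁻¹ i) (a.right⁻¹ j)]
  inv_mem' := by
    intro a ha i j
    have h1 : ∀ k, a⁻¹.left k = (a.left (a.right k))⁻¹ := fun k => by simp; rfl
    rw [h1, h1, inv_mem_iff, inv_mem_iff]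
    exact ha _ _

variable {T}

/-- The coordinates of an element of `M`. -/
def co (m : T.M) (i : Fin 3) : N := m.1.left i

/-- The permutation part of an element of `M`. -/
def pm (m : T.M) : Equiv.Perm (Fin 3) := m.1.right

theorem co_iff (m : T.M) (i j : Fin 3) : co m i ∈ T.L ↔ co m j ∈ T.L := m.2 i j

@[ext] theorem M_ext {m n : T.M} (h : ∀ i, co m i = co n i) (h' : pm m = pm n) : m = n :=
  Subtype.ext (SemidirectProduct.ext (funext h) h')

@[simp] theorem co_mul (m n : T.M) (i : Fin 3) : co (m * n) i = co m i * co n ((pm m).symm i) := rfl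
@[simp] theorem pm_mul (m n : T.M) : pm (m * n) = pm m * pm n := rfl
@[simp] theorem co_one (i : Fin 3) : co (1 : T.M) i = 1 := rfl
@[simp] theorem pm_one : pm (1 : T.M) = 1 := rfl
@[simp] theorem pm_inv (m : T.M) : pm m⁻¹ = (pm m)⁻¹ := rfl
@[simp] theorem co_inv (m : T.M) (i : Fin 3) : co m⁻¹ i = (co m (pm m i))⁻¹ := by
  simp [co, pm]
  rfl

variable (T) in
/-- The element `(f₁, f₂, f₃) σ` of `M`. -/
def tri (f : Fin 3 → N) (σ : Equiv.Perm (Fin 3)) (h : ∀ i j, f i ∈ T.L ↔ f j ∈ T.L) : T.M :=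
  ⟨⟨f, σ⟩, h⟩

@[simp] theorem co_tri (f : Fin 3 → N) (σ : Equiv.Perm (Fin 3)) (h) (i : Fin 3) :
    co (T.tri f σ h) i = f i := rfl
@[simp] theorem pm_tri (f : Fin 3 → N) (σ : Equiv.Perm (Fin 3)) (h) : pm (T.tri f σ h) = σ := rfl

variable (T) in
/-- `A₁ × A₂ × A₃`. -/
def box (A : Fin 3 → Subgroup N) : Subgroup T.M where
  carrier := {m | pm m = 1 ∧ ∀ i, co m i ∈ A i}
  one_mem' := ⟨rfl, fun i => one_mem _⟩
  mul_mem' := by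
    rintro a b ⟨ha, ha'⟩ ⟨hb, hb'⟩
    refine ⟨by simp [ha, hb], fun i => ?_⟩
    rw [co_mul, ha]
    exact mul_mem (ha' i) (hb' i)
  inv_mem' := by
    rintro a ⟨ha, ha'⟩
    refine ⟨by simp [ha], fun i => ?_⟩
    rw [co_inv, ha]
    exact inv_mem (ha' i)

theorem mem_box {A : Fin 3 → Subgroup N} {m : T.M} :
    m ∈ T.box A ↔ pm m = 1 ∧ ∀ i, co m i ∈ A i := Iff.rfl

theorem box_mono {A B : Fin 3 → Subgroup N} (h : ∀ i, A i ≤ B i) : T.box A ≤ T.box B :=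
  fun _ hm => ⟨hm.1, fun i => h i (hm.2 i)⟩

theorem conjSub_box (m : T.M) (A : Fin 3 → Subgroup N) :
    conjSub m (T.box A) = T.box fun i => conjSub (co m i) (A ((pm m).symm i)) := by
  ext x
  simp only [mem_conjSub, mem_box, pm_mul, pm_inv, co_mul, co_inv]
  constructor
  · rintro ⟨h1, h2⟩
    have h3 : pm x = 1 := by
      have := congrArg (fun s => pm m * s * (pm m)⁻¹) h1
      simpa [mul_assoc] using this
    refine ⟨h3, fun i => ?_⟩
    have := h2 ((pm m).symm i)
    simpa [h3] using this
  · rintro ⟨h1, h2⟩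
    refine ⟨by simp [h1], fun i => ?_⟩
    have := h2 (pm m i)
    simpa [h1] using this

/-- The element of `L × L × L` with one nontrivial coordinate. -/
theorem exists_single (i : Fin 3) {a : N} (ha : a ∈ T.L) :
    ∃ m : T.M, pm m = 1 ∧ co m i = a ∧ ∀ j, j ≠ i → co m j = 1 := by
  refine ⟨T.tri (Function.update 1 i a) 1 ?_, rfl, Function.update_self _ _ _,
    fun j hj => Function.update_of_ne hj _ _⟩
  have : ∀ j, (Function.update (1 : Fin 3 → N) i a) j ∈ T.L := by
    intro j
    by_cases hj : j = i
    · subst hj; simpa using ha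
    · simp [hj]
  intro j k
  simp [this]

/-- An element supported in one coordinate belongs to `M` as soon as this coordinate lies in `L`.
Inside `L` the coordinates can therefore be varied independently. -/
theorem box_le_box_iff {A B : Fin 3 → Subgroup N} (hA : ∀ i, A i ≤ T.L) :
    T.box A ≤ T.box B ↔ ∀ i, A i ≤ B i := by
  refine ⟨fun h i a ha => ?_, box_mono⟩
  obtain ⟨m, h1, h2, h3⟩ := exists_single i (hA i ha)
  rw [← h2]
  refine (h (show m ∈ T.box A from ⟨h1, fun j => ?_⟩)).2 i
  by_cases hj : j = i
  · subst hj; rwa [h2]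
  · rw [h3 j hj]; exact one_mem _

theorem box_inj {A B : Fin 3 → Subgroup N} (hA : ∀ i, A i ≤ T.L) (hB : ∀ i, B i ≤ T.L) :
    T.box A = T.box B ↔ ∀ i, A i = B i := by
  constructor
  · intro h i
    exact le_antisymm ((box_le_box_iff hA).mp h.le i) ((box_le_box_iff hB).mp h.ge i)
  · intro h
    rw [funext h]

theorem isPGroup_box {p : ℕ} {A : Fin 3 → Subgroup N} (h : ∀ i, IsPGroup p (A i)) :
    IsPGroup p (T.box A) := by
  rintro ⟨m, hm⟩
  choose k hk using fun i => h i ⟨co m i, hm.2 i⟩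
  have hpow : ∀ n i, co (m ^ n) i = co m i ^ n ∧ pm (m ^ n) = 1 := by
    intro n
    induction n with
    | zero => simp
    | succ n ih => intro i; simp [pow_succ, (ih i).1, (ih i).2, hm.1]
  refine ⟨∑ i, k i, Subtype.ext (M_ext (fun i => ?_) (hpow _ 0).2)⟩
  change co (m ^ _) i = _
  rw [(hpow _ i).1, ← Finset.add_sum_erase _ _ (Finset.mem_univ i), pow_add, pow_mul]
  have : co m i ^ p ^ k i = 1 := congrArg Subtype.val (hk i)
  simp [this]

variable (T) in
/-- `L × L × L`. -/
abbrev boxL : Subgroup T.M := T.box fun _ => T.L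

theorem box_le_boxL {A : Fin 3 → Subgroup N} (hA : ∀ i, A i ≤ T.L) : T.box A ≤ T.boxL :=
  box_mono hA

theorem conjSub_boxL (m : T.M) : conjSub m T.boxL = T.boxL := by
  rw [conjSub_box]
  congr 1
  funext i
  ext x
  simpa using T.conj_mem_L (g := (co m i)⁻¹) (x := x)

/-- The projection of `P ∩ (L × L × L)` to a coordinate. -/
def proj (P : Subgroup T.M) (i : Fin 3) : Subgroup N where
  carrier := {a | ∃ m ∈ P, m ∈ T.boxL ∧ co m i = a}
  one_mem' := ⟨1, one_mem _, one_mem _, rfl⟩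
  mul_mem' := by
    rintro _ _ ⟨m, hm, hm', rfl⟩ ⟨n, hn, hn', rfl⟩
    exact ⟨m * n, mul_mem hm hn, mul_mem hm' hn', by simp [hm'.1]⟩
  inv_mem' := by
    rintro _ ⟨m, hm, hm', rfl⟩
    exact ⟨m⁻¹, inv_mem hm, inv_mem hm', by simp [hm'.1]⟩

theorem proj_le (P : Subgroup T.M) (i : Fin 3) : proj P i ≤ T.L := by
  rintro _ ⟨m, -, hm, rfl⟩
  exact hm.2 i

theorem inf_boxL_le (P : Subgroup T.M) : P ⊓ T.boxL ≤ T.box (proj P) :=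
  fun m hm => ⟨hm.2.1, fun _ => ⟨m, hm.1, hm.2, rfl⟩⟩

theorem conj_proj_le {P : Subgroup T.M} {m : T.M} (hm : conjSub m P = P) (i : Fin 3) :
    conjSub (co m i) (proj P ((pm m).symm i)) ≤ proj P i := by
  intro a ha
  rw [mem_conjSub] at ha
  obtain ⟨x, hx, hx', h⟩ := ha
  refine ⟨m * x * m⁻¹, conjSub_eq_iff.mp hm x |>.mp hx,
    conjSub_eq_iff.mp (conjSub_boxL m) x |>.mp hx', ?_⟩
  simp [hx'.1, h, mul_assoc]

theorem conj_proj {P : Subgroup T.M} {m : T.M} (hm : conjSub m P = P) (i : Fin 3) :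
    conjSub (co m i) (proj P ((pm m).symm i)) = proj P i := by
  refine le_antisymm (conj_proj_le hm i) ?_
  -- The reverse inclusion is the one already proved, for `m⁻¹`, conjugated back by the coordinate
  -- of `m`.
  have h := conj_proj_le (conjSub_inv_eq hm) ((pm m).symm i)
  have h2 := conjSub_mono (g := co m i) h
  rw [← conjSub_mul] at h2
  simpa using h2

theorem conjSub_box_proj {P : Subgroup T.M} {m : T.M} (hm : conjSub m P = P) :
    conjSub m (T.box (proj P)) = T.box (proj P) := by
  rw [conjSub_box, funext (conj_proj hm)]

theorem isPGroup_proj {p : ℕ} {P : Subgroup T.M} (hP : IsPGroup p P) (i : Fin 3) :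
    IsPGroup p (proj P i) := by
  rintro ⟨_, m, hm, hm', rfl⟩
  obtain ⟨k, hk⟩ := hP ⟨m, hm⟩
  have hpow : ∀ n, co (m ^ n) i = co m i ^ n ∧ pm (m ^ n) = 1 := by
    intro n
    induction n with
    | zero => simp
    | succ n ih => simp [pow_succ, ih, hm'.1]
  refine ⟨k, Subtype.ext ?_⟩
  change co m i ^ p ^ k = 1
  rw [← (hpow _).1, show m ^ p ^ k = 1 from congrArg Subtype.val hk, co_one]

end QuaternionData

end

/-! ### Radical `2`-subgroups of `M` and their coordinate projections -/

section

theorem IsPGroup.eq_one_of_pow_eq_one {G : Type*} [Group G] {p n : ℕ} {P : Subgroup G}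
    (hP : IsPGroup p P) {u : G} (hu : u ∈ P) (hn : n.Coprime p) (h : u ^ n = 1) : u = 1 := by
  obtain ⟨k, hk⟩ := (isPGroup_iff_orderOf_dvd_pow.mp hP) ⟨u, hu⟩
  rw [Subgroup.orderOf_mk] at hk
  exact orderOf_eq_one_iff.mp
    (Nat.eq_one_of_dvd_coprimes (hn.pow_right k) (orderOf_dvd_of_pow_eq_one h) hk)

/-- An element of odd order normalizing a `p`-subgroup commutes with `x` as soon as it commutes
with the commutator, and this lies in the `p`-subgroup. -/
theorem commute_of_commutator {G : Type*} [Group G] {p : ℕ} {P : Subgroup G}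
    (hP : IsPGroup p P) {h x : G} (ho : (orderOf h).Coprime p) (hu : h * x * h⁻¹ * x⁻¹ ∈ P)
    (hc : h * (h * x * h⁻¹ * x⁻¹) = (h * x * h⁻¹ * x⁻¹) * h) : h * x = x * h := by
  set u := h * x * h⁻¹ * x⁻¹ with hu'
  have hx : h * x * h⁻¹ = u * x := by rw [hu']; group
  -- Since `h` commutes with the commutator `u`, moving `x` past powers of `h` accumulates powers of
  -- `u`. At `n` equal to the order of `h` this yields `uⁿ = 1`, and `u` lies in a `p`-group.
  have hpow : ∀ n : ℕ, h ^ n * x = u ^ n * x * h ^ n := by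
    intro n
    induction n with
    | zero => simp
    | succ n ih =>
      have h1 : h * u ^ n = u ^ n * h := (Commute.pow_right (show Commute h u from hc) n)
      calc h ^ (n + 1) * x = h * (h ^ n * x) := by rw [pow_succ', mul_assoc]
        _ = (h * u ^ n) * x * h ^ n := by rw [ih]; group
        _ = u ^ n * (h * x * h⁻¹) * h * h ^ n := by rw [h1]; group
        _ = u ^ (n + 1) * x * h ^ (n + 1) := by
          rw [hx, pow_succ u, pow_succ' h]; simp only [mul_assoc]
  have h1 := hpow (orderOf h)
  rw [pow_orderOf_eq_one, one_mul, mul_one] at h1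
  have h2 : u = 1 := hP.eq_one_of_pow_eq_one hu ho (mul_eq_right.mp h1.symm)
  rw [h2, one_mul] at hx
  exact mul_inv_eq_iff_eq_mul.mp hx

/-- `Y` is a `2`-subgroup that contains every `2`-subgroup normalized by its normalizer. -/
def IsRadicalTwo {G : Type*} [Group G] (Y : Subgroup G) : Prop :=
  IsPGroup 2 Y ∧ ∀ H : Subgroup G, IsPGroup 2 H →
    (∀ m ∈ Subgroup.normalizer (Y : Set G), conjSub m H = H) → H ≤ Y

theorem IsRadicalTwo.conjSub {G : Type*} [Group G] {Y : Subgroup G} (hY : IsRadicalTwo Y) (g : G) :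
    IsRadicalTwo (conjSub g Y) := by
  refine ⟨hY.1.conjSub g, fun H hH hn => ?_⟩
  have h1 := hY.2 (_root_.conjSub g⁻¹ H) (hH.conjSub _) (by
    intro m hm
    rw [mem_normalizer_iff_conjSub] at hm
    have h2 := hn (g * m * g⁻¹) (by
      rw [mem_normalizer_iff_conjSub, ← conjSub_mul, inv_mul_cancel_right, conjSub_mul, hm])
    conv_rhs => rw [← h2]
    rw [← conjSub_mul, ← conjSub_mul]
    congr 1
    group)
  have h2 := conjSub_mono (g := g) h1
  rwa [← conjSub_mul, mul_inv_cancel, conjSub_one] at h2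

namespace QuaternionData

variable {N : Type*} [Group N] {T : QuaternionData N}

variable (T) in
/-- The element `(ε, ε, ε)`. -/
def εM : T.M := T.tri (fun _ => T.ε) 1 fun _ _ => Iff.rfl

/-- `π` is a surjection from `M` with kernel generated by `(ε, ε, ε)`, and `S` is a Sylow
`2`-subgroup of its image. -/
structure IsModel {G : Type*} [Group G] (π : T.M →* G) (S : Subgroup G) : Prop where
  surj : Function.Surjective π
  ker_iff : ∀ m, π m = 1 ↔ m = 1 ∨ m = T.εM
  isPGroup : IsPGroup 2 S
  index : ¬ 2 ∣ S.index

theorem εM_mul_εM : T.εM * T.εM = 1 := by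
  ext i
  · exact T.ε_mul_ε
  · rfl

section

variable {G : Type*} [Group G] {π : T.M →* G} {S : Subgroup G}

theorem IsModel.isPGroup_ker (h : IsModel π S) : IsPGroup 2 π.ker := by
  rintro ⟨m, hm⟩
  refine ⟨1, Subtype.ext ?_⟩
  rcases (h.ker_iff m).mp hm with rfl | rfl
  · simp
  · simpa [pow_two] using εM_mul_εM

end

theorem co_pow {m : T.M} (hm : pm m = 1) (n : ℕ) (i : Fin 3) :
    co (m ^ n) i = co m i ^ n ∧ pm (m ^ n) = 1 := by
  induction n with
  | zero => simp
  | succ n ih => simp [pow_succ, ih.1, ih.2, hm]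

/-- The product of the projections is a `2`-group, and it is normalized by the normalizer of `Y`
because `L × L × L` is normal in `M`. Radicality then places it in `Y`. -/
theorem IsRadicalTwo.inf_boxL {Y : Subgroup T.M} (hY : IsRadicalTwo Y) :
    Y ⊓ T.boxL = T.box (proj Y) := by
  refine le_antisymm (inf_boxL_le Y) (le_inf ?_ (box_le_boxL (proj_le Y)))
  refine hY.2 _ (isPGroup_box (isPGroup_proj hY.1)) fun m hm => ?_
  exact conjSub_box_proj (mem_normalizer_iff_conjSub.mp hm)

variable (T) in
/-- All elements of odd order in the normalizer of `A` in `L` centralize `A`. -/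
def OddCentralizes (A : Subgroup N) : Prop :=
  ∀ h ∈ T.L, Odd (orderOf h) → conjSub h A = A → ∀ a ∈ A, h * a = a * h

theorem OddCentralizes.conjSub {A : Subgroup N} (hA : T.OddCentralizes A) (g : N) :
    T.OddCentralizes (conjSub g A) := by
  intro h hh ho hc a ha
  have h1 := hA (g⁻¹ * h * g) (by simpa using T.normal_L.conj_mem _ hh g⁻¹)
    (by
      have : g⁻¹ * h * g = MulAut.conj g⁻¹ h := by simp
      rwa [this, MulEquiv.orderOf_eq])
    (by
      rw [conjSub_mul, conjSub_mul, hc, ← conjSub_mul, inv_mul_cancel, conjSub_one])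
    _ (mem_conjSub.mp ha)
  have h2 := congrArg (fun x => g * x * g⁻¹) h1
  simpa [mul_assoc] using h2

open Classical in
variable (T) in
/-- The normalizer of `A` in `L`, if all elements of odd order in it centralize `A`. -/
noncomputable def oddNormalizer (A : Subgroup N) : Subgroup N :=
  if T.OddCentralizes A then Subgroup.normalizer (A : Set N) ⊓ T.L else ⊥

/-- The construction is canonical, so the product of these groups over the projections of `Y` is
invariant under the normalizer of `Y`. -/
theorem conjSub_oddNormalizer (g : N) (A : Subgroup N) :
    conjSub g (T.oddNormalizer A) = T.oddNormalizer (conjSub g A) := by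
  have hiff : T.OddCentralizes (conjSub g A) ↔ T.OddCentralizes A := by
    refine ⟨fun h => ?_, fun h => h.conjSub g⟩
    have := h.conjSub g⁻¹
    rwa [← conjSub_mul, inv_mul_cancel, conjSub_one] at this
  unfold oddNormalizer
  by_cases h : T.OddCentralizes A
  · rw [if_pos h, if_pos (hiff.mpr h)]
    ext x
    rw [mem_conjSub, Subgroup.mem_inf, Subgroup.mem_inf, mem_normalizer_iff_conjSub,
      mem_normalizer_iff_conjSub]
    have h1 : g⁻¹ * x * g ∈ T.L ↔ x ∈ T.L := by
      simpa using T.conj_mem_L (g := g⁻¹) (x := x)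
    rw [h1, conjSub_mul, conjSub_mul]
    refine and_congr_left fun _ => ⟨fun h2 => ?_, fun h2 => ?_⟩
    · exact (by simpa using conjSub_inv_eq h2 : conjSub g A = _).symm
    · rw [h2, ← conjSub_mul, inv_mul_cancel, conjSub_one]
  · rw [if_neg h, if_neg (mt hiff.mp h)]
    ext x
    simp only [mem_conjSub, Subgroup.mem_bot]
    constructor
    · intro h2
      have := congrArg (fun x => g * x * g⁻¹) h2
      simpa [mul_assoc] using this
    · rintro rfl
      simp

theorem oddNormalizer_le (A : Subgroup N) : T.oddNormalizer A ≤ T.L := by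
  unfold oddNormalizer
  split_ifs
  · exact inf_le_right
  · exact bot_le

/-- A `2`-subgroup of `L` is conjugate to a subgroup of `R`. -/
theorem exists_conj_le_R [Finite N] {A : Subgroup N} (hA : A ≤ T.L) (hA2 : IsPGroup 2 A) :
    ∃ g ∈ T.L, conjSub g A ≤ T.R := by
  obtain ⟨g, hg⟩ := exists_conjSub_le (G := T.L) (S := T.R.subgroupOf T.L)
    (P := A.subgroupOf T.L) (p := 2) T.isPGroup_R.comap_subtype T.relIndex_R hA2.comap_subtype
  refine ⟨g, g.2, fun x hx => ?_⟩
  rw [mem_conjSub] at hx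
  have hxL : x ∈ T.L := by
    have := mul_mem (mul_mem g.2 (hA hx)) (inv_mem g.2)
    simpa [mul_assoc] using this
  exact hg (x := ⟨x, hxL⟩) (mem_conjSub.mpr hx)

/-- If a `2`-subgroup `A` of `L` has odd index in its normalizer in `L`, it is conjugate
to `R`. -/
theorem exists_eq_conj_R [Finite N] {A : Subgroup N} (hA : A ≤ T.L) (hA2 : IsPGroup 2 A)
    (hi : ¬ 2 ∣ A.relIndex (Subgroup.normalizer (A : Set N) ⊓ T.L)) :
    ∃ u, A = conjSub u T.R := by
  obtain ⟨g, hg, hgA⟩ := exists_conj_le_R hA hA2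
  refine ⟨g⁻¹, ?_⟩
  by_contra hne
  have hne' : A ≠ conjSub g⁻¹ T.R := hne
  have hle : A ≤ conjSub g⁻¹ T.R := by
    have := conjSub_mono (g := g⁻¹) hgA
    rwa [← conjSub_mul, inv_mul_cancel, conjSub_one] at this
  -- Otherwise `A` is proper in the Sylow subgroup above it, and a `2`-element `y ∉ A` normalizes
  -- `A`. The power of `y` by the odd index of `A` in `N_L(A)` lies in `A`, and a power of `y` by
  -- some `2 ^ k` is trivial. By Bézout, `y ∈ A`.
  obtain ⟨y, hy, hyA, hyn⟩ :=
    (T.isPGroup_R.conjSub g⁻¹).exists_mem_normalizer hle hne'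
  have hyL : y ∈ T.L := (conjSub_le_of_normal T.R_le) hy
  set B := Subgroup.normalizer (A : Set N) ⊓ T.L with hB
  have hAB : A ≤ B := le_inf Subgroup.le_normalizer hA
  have : (A.subgroupOf B).Normal :=
    (Subgroup.normal_subgroupOf_iff_le_normalizer hAB).mpr inf_le_left
  have h1 : (⟨y, hyn, hyL⟩ : B) ^ (A.subgroupOf B).index ∈ A.subgroupOf B :=
    Subgroup.pow_index_mem _ _
  rw [Subgroup.mem_subgroupOf] at h1
  have h1 : y ^ (A.relIndex B) ∈ A := h1
  obtain ⟨k, hk⟩ := (T.isPGroup_R.conjSub g⁻¹) ⟨y, hy⟩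
  have hk : y ^ 2 ^ k = 1 := congrArg Subtype.val hk
  apply hyA
  have hcop : Nat.Coprime (A.relIndex B) (2 ^ k) := by
    apply Nat.Coprime.pow_right
    exact ((Nat.Prime.coprime_iff_not_dvd Nat.prime_two).mpr hi).symm
  have hbez := Nat.gcd_eq_gcd_ab (A.relIndex B) (2 ^ k)
  rw [hcop.gcd_eq_one] at hbez
  have : y = (y ^ (A.relIndex B)) ^ (Nat.gcdA (A.relIndex B) (2 ^ k)) *
      (y ^ 2 ^ k) ^ (Nat.gcdB (A.relIndex B) (2 ^ k)) := by
    rw [← zpow_natCast, ← zpow_natCast, ← zpow_mul, ← zpow_mul, ← zpow_add, ← hbez]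
    simp
  rw [this, hk, one_zpow, mul_one]
  exact zpow_mem h1 _

section

variable [Finite N] {G : Type*} [Group G] [Finite G] {π : T.M →* G} {S : Subgroup G}

instance : Finite (PermWreath N 3) :=
  Finite.of_equiv _ SemidirectProduct.equivProd.symm

open FusionSystem

theorem IsModel.isRadicalTwo_hat (hm : IsModel π S) {P : Subgroup S}
    (hP : (ofGroup S).IsCentricRadical 2 P) : IsRadicalTwo (hat π P) := by
  refine ⟨?_, fun H hH hn => hP.le_hat hm.surj hm.isPGroup_ker hm.isPGroup hm.index hH hn⟩
  have h1 : IsPGroup 2 (P.map S.subtype) := (hm.isPGroup.to_subgroup P).map _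
  exact h1.comap_of_ker_isPGroup π hm.isPGroup_ker

/-- Either an element of odd order of `N_L(Aᵢ)` acts nontrivially on `Aᵢ`, and the subgroup
structure of `R` forces a conjugate of `Q`; or none does, and `not_dvd_relIndex`, applied to the
product of the groups `oddNormalizer`, shows that `Aᵢ` has odd index in `N_L(Aᵢ)`. -/
theorem IsModel.exists_proj_eq (hm : IsModel π S) {P : Subgroup S}
    (hP : (ofGroup S).IsCentricRadical 2 P) (i : Fin 3) :
    ∃ u, proj (hat π P) i = conjSub u T.Q ∨ proj (hat π P) i = conjSub u T.R := by
  have hY := hm.isRadicalTwo_hat hP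
  set Y := hat π P with hYdef
  set A := proj Y with hA
  have hA2 : ∀ i, IsPGroup 2 (A i) := isPGroup_proj hY.1
  have hAL : ∀ i, A i ≤ T.L := proj_le Y
  by_cases hc : T.OddCentralizes (A i)
  · suffices hi : ¬ 2 ∣ (A i).relIndex (Subgroup.normalizer (A i : Set N) ⊓ T.L) by
      obtain ⟨u, hu⟩ := exists_eq_conj_R (hAL i) (hA2 i) hi
      exact ⟨u, Or.inr hu⟩
    set H := T.box fun j => T.oddNormalizer (A j) with hH
    have hHL : H ≤ T.boxL := box_le_boxL fun j => oddNormalizer_le _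
    have hHn : ∀ m ∈ Subgroup.normalizer (Y : Set T.M), conjSub m H = H := by
      intro m hm
      rw [mem_normalizer_iff_conjSub] at hm
      rw [hH, conjSub_box]
      congr 1
      funext j
      rw [conjSub_oddNormalizer, conj_proj hm]
    -- For `h ∈ H` of odd order normalizing `Y` and `x ∈ Y`, the commutator lies in `Y ∩ H`, hence
    -- in the product of the projections. There `h` acts trivially coordinate by coordinate, by the
    -- choice of `H`. So `h` commutes with the commutator, and then with `x`.
    have h1 := hP.not_dvd_relIndex hm.surj hm.isPGroup_ker hm.isPGroup hm.index hHn (by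
      intro h hh hhn ho x hx
      refine commute_of_commutator (P := Y) hY.1 ho ?_ ?_
      · exact Y.mul_mem ((Subgroup.mem_normalizer_iff.mp hhn x).mp hx) (Y.inv_mem hx)
      · have hu : h * x * h⁻¹ * x⁻¹ ∈ T.box A := by
          rw [hA, ← IsRadicalTwo.inf_boxL hY]
          refine ⟨Y.mul_mem ((Subgroup.mem_normalizer_iff.mp hhn x).mp hx) (Y.inv_mem hx), ?_⟩
          apply hHL
          have h2 : x * h⁻¹ * x⁻¹ ∈ H := by
            have := conj_mem_conjSub (g := x).mpr (inv_mem hh)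
            rwa [hHn x (Subgroup.le_normalizer hx)] at this
          have := mul_mem hh h2
          simpa [mul_assoc] using this
        generalize h * x * h⁻¹ * x⁻¹ = u at hu ⊢
        ext j
        · rw [co_mul, co_mul, hh.1, hu.1]
          simp only [perm_symm_one, Equiv.Perm.coe_one, id_eq]
          have hj : co h j ∈ T.oddNormalizer (A j) := hh.2 j
          unfold oddNormalizer at hj
          split_ifs at hj with hcj
          · refine hcj _ hj.2 ?_ (mem_normalizer_iff_conjSub.mp hj.1) _ (hu.2 j)
            have h3 : orderOf (co h j) ∣ orderOf h := by
              apply orderOf_dvd_of_pow_eq_one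
              rw [← (co_pow hh.1 _ j).1, pow_orderOf_eq_one, co_one]
            exact Odd.of_dvd_nat (Nat.coprime_two_right.mp ho) h3
          · rw [Subgroup.mem_bot] at hj
            simp [hj]
        · simp [hh.1, hu.1])
    intro hdvd
    apply h1
    set B := Subgroup.normalizer (A i : Set N) ⊓ T.L with hB
    have hBi : T.oddNormalizer (A i) = B := if_pos hc
    -- The projection to coordinate `i` maps `H` onto `N_L(Aᵢ)` and `Y ∩ H` into `Aᵢ`, so the index
    -- of `Aᵢ` divides the odd index of `Y ∩ H` in `H`.
    let f : H →* B :=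
      { toFun := fun m => ⟨co m.1 i, hBi ▸ m.2.2 i⟩
        map_one' := rfl
        map_mul' := fun a b => Subtype.ext (by simp [a.2.1]) }
    have hf : Function.Surjective f := by
      rintro ⟨b, hb⟩
      obtain ⟨m, hm1, hm2, hm3⟩ := exists_single (T := T) i hb.2
      refine ⟨⟨m, hm1, fun j => ?_⟩, Subtype.ext hm2⟩
      by_cases hj : j = i
      · subst hj
        change co m j ∈ T.oddNormalizer (A j)
        rw [hm2, hBi]
        exact hb
      · rw [hm3 j hj]
        exact one_mem _
    have h4 : (Y.subgroupOf H).map f ≤ (A i).subgroupOf B := by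
      rintro _ ⟨m, hmY, rfl⟩
      exact ⟨m, hmY, hHL m.2, rfl⟩
    exact hdvd.trans ((Subgroup.index_dvd_of_le h4).trans (Subgroup.index_map_dvd _ hf))
  · unfold OddCentralizes at hc
    push Not at hc
    obtain ⟨h, hh, ho, hhA, a, ha, hne⟩ := hc
    obtain ⟨g, hg, hgA⟩ := exists_conj_le_R (hAL i) (hA2 i)
    obtain ⟨u, hu⟩ := T.exists_eq_conj_Q _ hgA (g * h * g⁻¹) (T.normal_L.conj_mem _ hh g) (by
        have : g * h * g⁻¹ = MulAut.conj g h := by simp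
        rwa [this, MulEquiv.orderOf_eq]) (by
        rw [← conjSub_mul, inv_mul_cancel_right, conjSub_mul, hhA]) (by
        intro hcomm
        apply hne
        have h1 := hcomm _ (conj_mem_conjSub.mpr ha)
        have h2 := congrArg (fun x => g⁻¹ * x * g) h1
        simpa [mul_assoc] using h2)
    refine ⟨g⁻¹ * u, Or.inl ?_⟩
    rw [conjSub_mul, ← hu, ← conjSub_mul, inv_mul_cancel, conjSub_one]

end

end QuaternionData

end

section

namespace QuaternionData

variable {N : Type*} [Group N] {T : QuaternionData N}

theorem proj_conjSub_le (m : T.M) (P : Subgroup T.M) (i : Fin 3) :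
    proj (conjSub m P) i ≤ conjSub (co m i) (proj P ((pm m).symm i)) := by
  rintro _ ⟨x, hx, hx', rfl⟩
  rw [mem_conjSub]
  refine ⟨m⁻¹ * x * m, mem_conjSub.mp hx, ?_, by simp [hx'.1]⟩
  rwa [← mem_conjSub, conjSub_boxL]

theorem proj_conjSub (m : T.M) (P : Subgroup T.M) (i : Fin 3) :
    proj (conjSub m P) i = conjSub (co m i) (proj P ((pm m).symm i)) := by
  refine le_antisymm (proj_conjSub_le m P i) ?_
  have h := proj_conjSub_le m⁻¹ (conjSub m P) ((pm m).symm i)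
  rw [← conjSub_mul, inv_mul_cancel, conjSub_one] at h
  have h2 := conjSub_mono (g := co m i) h
  rw [← conjSub_mul] at h2
  simpa using h2

/-! ### The standard products -/

variable (T) in
/-- The element `e` or `1`. -/
def ePow (b : Bool) : N := if b then T.e else 1

theorem ePow_mem_L {b : Bool} : T.ePow b ∈ T.L ↔ b = false := by
  cases b <;> simp [ePow, T.e_notMem]

theorem conj_ePow_R (b : Bool) : conjSub (T.ePow b) T.R = T.R := by
  cases b <;> simp [ePow, T.conj_e_R]

theorem conj_of_forall_commute {g : N} {A : Subgroup N} (h : ∀ x, g * x = x * g) :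
    conjSub g A = A := by
  ext x
  rw [mem_conjSub, mul_assoc, ← h, inv_mul_cancel_left]

/-- As `e² = ε` is central, conjugation by `e` is an involution on subgroups; in particular it
interchanges `Q` and `Q'`. -/
theorem conj_e_ePow (b : Bool) (A : Subgroup N) :
    conjSub T.e (conjSub (T.ePow b) A) = conjSub (T.ePow !b) A := by
  cases b
  · simp [ePow]
  · rw [← conjSub_mul]
    simp [ePow, T.e_mul_e, conj_of_forall_commute T.ε_comm]

variable (T) in
/-- The group `Q` or `R`. -/
def base (j : Bool) : Subgroup N := if j then T.Q else T.R

variable (T) in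
/-- The triple of subgroups with `i`-th component `Q`, `Q' = e Q e⁻¹` or `R`. -/
def std (J b : Fin 3 → Bool) (i : Fin 3) : Subgroup N := conjSub (T.ePow (b i)) (T.base (J i))

theorem std_eq_R {J b : Fin 3 → Bool} {i : Fin 3} (h : J i = false) : T.std J b i = T.R := by
  simp [std, h, base, conj_ePow_R]

theorem std_eq_Q {J b : Fin 3 → Bool} {i : Fin 3} (h : J i = true) :
    T.std J b i = conjSub (T.ePow (b i)) T.Q := by
  simp [std, h, base]

/-- `e` normalizes `R`, so `b` is irrelevant at the coordinates carrying `R`. Masking it there makes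
the label canonical. -/
theorem std_and (J b : Fin 3 → Bool) : T.std J (fun i => J i && b i) = T.std J b := by
  funext i
  cases h : J i
  · rw [std_eq_R h, std_eq_R h]
  · rw [std_eq_Q h, std_eq_Q h, h, Bool.true_and]

theorem std_le_R (J b : Fin 3 → Bool) (i : Fin 3) : T.std J b i ≤ T.R := by
  cases h : J i
  · rw [std_eq_R h]
  · rw [std_eq_Q h]
    have := conjSub_mono (g := T.ePow (b i)) T.Q_le
    rwa [conj_ePow_R] at this

theorem conj_Q_le_std (J b : Fin 3 → Bool) (i : Fin 3) :
    conjSub (T.ePow (b i)) T.Q ≤ T.std J b i := by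
  cases h : J i
  · rw [std_eq_R h]
    have := conjSub_mono (g := T.ePow (b i)) T.Q_le
    rwa [conj_ePow_R] at this
  · rw [std_eq_Q h]

theorem std_le_L (J b : Fin 3 → Bool) (i : Fin 3) : T.std J b i ≤ T.L :=
  (std_le_R J b i).trans T.R_le

theorem isPGroup_std (J b : Fin 3 → Bool) (i : Fin 3) : IsPGroup 2 (T.std J b i) :=
  T.isPGroup_R.to_le (std_le_R J b i)

/-- Conjugation by `g` takes the base of type `j` to that of type `j'` only for `j = j'`. -/
theorem base_type_eq {g : N} {j j' b b' : Bool}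
    (h : conjSub g (conjSub (T.ePow b) (T.base j)) = conjSub (T.ePow b') (T.base j')) :
    j = j' := by
  have h1 : Nat.card (T.base j) = Nat.card (T.base j') := by
    have := congrArg (fun A : Subgroup N => Nat.card A) h
    simpa only [card_conjSub] using this
  have h2 := T.card_R_gt
  have h3 := T.card_Q
  cases j <;> cases j' <;> simp [base] at h1 ⊢ <;> omega

/-- Conjugates of `Q` by elements of different cosets of `L` are not conjugate in `L`. -/
theorem mem_L_of_conj_conj {g u v : N}
    (h : conjSub g (conjSub u T.Q) = conjSub v T.Q) : v⁻¹ * g * u ∈ T.L := by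
  apply T.mem_L_of_conj
  rw [mul_assoc, conjSub_mul, conjSub_mul, h, ← conjSub_mul, inv_mul_cancel, conjSub_one]

/-! ### The normalizer of a standard product -/

variable (T) in
/-- The normalizer of a standard product. -/
def nor (J b : Fin 3 → Bool) : Subgroup T.M :=
  Subgroup.normalizer (T.box (T.std J b) : Set T.M)

theorem mem_nor {J b : Fin 3 → Bool} {m : T.M} :
    m ∈ T.nor J b ↔
      ∀ i, conjSub (co m i) (T.std J b ((pm m).symm i)) = T.std J b i := by
  rw [nor, mem_normalizer_iff_conjSub, conjSub_box, box_inj]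
  · intro i
    exact conjSub_le_of_normal (std_le_L _ _ _)
  · exact std_le_L _ _

theorem type_symm {J b : Fin 3 → Bool} {m : T.M} (hm : m ∈ T.nor J b) (i : Fin 3) :
    J ((pm m).symm i) = J i :=
  base_type_eq (mem_nor.mp hm i)

variable (T) in
/-- The components of an element of the normalizer of a standard product, in the frame given
by this product. -/
def frameCo (b : Fin 3 → Bool) (m : T.M) (i : Fin 3) : N :=
  (T.ePow (b i))⁻¹ * co m i * T.ePow (b ((pm m).symm i))

theorem conj_frameCo {J b : Fin 3 → Bool} {m : T.M} (hm : m ∈ T.nor J b) {i : Fin 3}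
    (hi : J i = true) : conjSub (T.frameCo b m i) T.Q = T.Q := by
  have h := mem_nor.mp hm i
  rw [std_eq_Q hi, std_eq_Q ((type_symm hm i).trans hi)] at h
  rw [frameCo, mul_assoc, conjSub_mul, conjSub_mul, h, ← conjSub_mul, inv_mul_cancel,
    conjSub_one]

/-- The frame elements at the intermediate coordinate cancel. This cocycle identity is what makes
`psi` multiplicative. -/
theorem frameCo_mul (b : Fin 3 → Bool) (m n : T.M) (i : Fin 3) :
    T.frameCo b (m * n) i = T.frameCo b m i * T.frameCo b n ((pm m).symm i) := by
  have : (pm m * pm n).symm i = (pm n).symm ((pm m).symm i) := rfl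
  simp [frameCo, mul_assoc, this]

theorem co_conj_R {J b : Fin 3 → Bool} {m : T.M} (hm : m ∈ T.nor J b) {i : Fin 3}
    (hi : J i = false) : conjSub (co m i) T.R = T.R := by
  have h := mem_nor.mp hm i
  rwa [std_eq_R hi, std_eq_R ((type_symm hm i).trans hi)] at h

variable (T) in
/-- The action of the normalizer of a standard product on its quaternion factors. -/
def psi (J b : Fin 3 → Bool) : T.nor J b →* PermWreath Sym3 3 where
  toFun m := ⟨fun i => if J i then T.θ (T.frameCo b m i) else 1, pm m.1⟩
  map_one' := by
    refine SemidirectProduct.ext (funext fun i => ?_) rfl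
    have h : T.θ 1 = 1 := (T.θ_eq_one_iff 1 (conjSub_one _)).mpr (one_mem _)
    have : T.frameCo b (1 : T.M) i = 1 := by simp [frameCo]
    simp [this, h]
  map_mul' m n := by
    refine SemidirectProduct.ext (funext fun i => ?_) rfl
    have h1 := type_symm m.2 i
    change (if J i then T.θ (T.frameCo b (m.1 * n.1) i) else 1) =
      (if J i then T.θ (T.frameCo b m.1 i) else 1) *
        (if J ((pm m.1).symm i) then T.θ (T.frameCo b n.1 ((pm m.1).symm i)) else 1)
    rw [h1]
    cases hi : J i
    · simp
    · simp only [if_true]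
      rw [frameCo_mul, T.θ_mul _ _ (conj_frameCo m.2 hi) (conj_frameCo n.2 (h1.trans hi))]

@[simp] theorem psi_right {J b : Fin 3 → Bool} (m : T.nor J b) :
    (T.psi J b m).right = pm m.1 := rfl

theorem psi_left {J b : Fin 3 → Bool} (m : T.nor J b) (i : Fin 3) :
    (T.psi J b m).left i = if J i then T.θ (T.frameCo b m i) else 1 := rfl

variable (T) in
/-- The kernel of `psi`. -/
def lam (J b : Fin 3 → Bool) : Subgroup T.M :=
  T.box fun i => if J i then T.std J b i else Subgroup.normalizer (T.R : Set N)

theorem psi_eq_one_iff {J b : Fin 3 → Bool} (m : T.nor J b) :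
    T.psi J b m = 1 ↔ m.1 ∈ T.lam J b := by
  constructor
  · intro h
    have h1 : pm m.1 = 1 := congrArg SemidirectProduct.right h
    refine ⟨h1, fun i => ?_⟩
    have h2 : (if J i then T.θ (T.frameCo b m i) else 1) = 1 :=
      congrFun (congrArg SemidirectProduct.left h) i
    cases hi : J i
    · beta_reduce
      rw [if_neg (by simp [hi])]
      exact mem_normalizer_iff_conjSub.mpr (co_conj_R m.2 hi)
    · simp only [hi, if_true] at h2 ⊢
      rw [T.θ_eq_one_iff _ (conj_frameCo m.2 hi)] at h2
      rw [std_eq_Q hi, mem_conjSub]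
      simpa [frameCo, h1] using h2
  · intro h
    refine SemidirectProduct.ext (funext fun i => ?_) h.1
    rw [psi_left]
    cases hi : J i
    · rfl
    · simp only [if_true]
      change _ = (1 : Sym3)
      rw [T.θ_eq_one_iff _ (conj_frameCo m.2 hi)]
      have h2 := h.2 i
      simp only [hi, if_true] at h2
      rw [std_eq_Q hi, mem_conjSub] at h2
      simpa [frameCo, h.1] using h2

/-- Inside `L` the normalizer of `R` is `R`. Outside `L` one has `g = r e` with `r ∈ R`, and `g² = r
(e r e⁻¹) ε`. -/
theorem sq_mem_R {g : N} (hg : conjSub g T.R = T.R) : g ^ 2 ∈ T.R := by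
  by_cases hL : g ∈ T.L
  · exact pow_mem (T.mem_R_of_conj g hL hg) 2
  · have h1 : g * T.e⁻¹ ∈ T.R := by
      apply T.mem_R_of_conj _ (T.mul_inv_mem _ _ hL T.e_notMem)
      rw [conjSub_mul, conjSub_inv_eq T.conj_e_R, hg]
    have h2 : T.e * (g * T.e⁻¹) * T.e⁻¹ ∈ T.R := by
      have := conj_mem_conjSub (g := T.e).mpr h1
      rwa [T.conj_e_R] at this
    have h3 : g ^ 2 = (g * T.e⁻¹) * (T.e * (g * T.e⁻¹) * T.e⁻¹) * (T.e * T.e) := by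
      rw [pow_two]; group
    rw [h3, T.e_mul_e]
    exact mul_mem (mul_mem h1 h2) (T.Q_le T.ε_mem)

theorem isPGroup_normalizer_R : IsPGroup 2 (Subgroup.normalizer (T.R : Set N)) := by
  rintro ⟨g, hg⟩
  obtain ⟨k, hk⟩ := T.isPGroup_R ⟨g ^ 2, sq_mem_R (mem_normalizer_iff_conjSub.mp hg)⟩
  refine ⟨k + 1, Subtype.ext ?_⟩
  have : (g ^ 2) ^ 2 ^ k = 1 := congrArg Subtype.val hk
  rw [← pow_mul, ← pow_succ'] at this
  exact this

theorem isPGroup_lam (J b : Fin 3 → Bool) : IsPGroup 2 (T.lam J b) := by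
  apply isPGroup_box
  intro i
  cases hi : J i
  · rw [if_neg (by simp)]
    exact isPGroup_normalizer_R
  · rw [if_pos rfl]
    exact isPGroup_std J b i

theorem lam_le_nor (J b : Fin 3 → Bool) : T.lam J b ≤ T.nor J b := by
  intro m hm
  rw [mem_nor]
  intro i
  have h := hm.2 i
  rw [hm.1]
  cases hi : J i
  · simp only [hi, Bool.false_eq_true, if_false] at h
    simpa [std_eq_R hi] using mem_normalizer_iff_conjSub.mp h
  · simp only [hi, if_true] at h
    exact conjSub_eq_self_of_mem h

theorem box_std_le_lam (J b : Fin 3 → Bool) : T.box (T.std J b) ≤ T.lam J b := by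
  refine box_mono fun i => ?_
  split_ifs with h
  · exact le_rfl
  · rw [std_eq_R (by simpa using h)]
    exact Subgroup.le_normalizer

/-- The quaternion coordinate lies in `L`, and all coordinates share their coset. The coordinates
normalizing `R` thus lie in `N_L(R) = R`. -/
theorem lam_eq_box {J b : Fin 3 → Bool} {i : Fin 3} (hi : J i = true) :
    T.lam J b = T.box (T.std J b) := by
  refine le_antisymm (fun m hm => ⟨hm.1, fun j => ?_⟩) (box_std_le_lam J b)
  have h := hm.2 i
  simp only [hi, if_true] at h
  have hL := (co_iff m i j).mp (std_le_L J b i h)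
  have hj := hm.2 j
  cases hJ : J j
  · simp only [hJ, Bool.false_eq_true, if_false] at hj
    rw [std_eq_R hJ]
    exact T.mem_R_of_conj _ hL (mem_normalizer_iff_conjSub.mp hj)
  · simpa only [hJ, if_true] using hj

theorem lam_inf_boxL (J b : Fin 3 → Bool) : T.lam J b ⊓ T.boxL = T.box (T.std J b) := by
  refine le_antisymm ?_ (le_inf (box_std_le_lam J b) (box_le_boxL (std_le_L J b)))
  rintro m ⟨hm, hmL⟩
  refine ⟨hm.1, fun j => ?_⟩
  have hj := hm.2 j
  cases hJ : J j
  · simp only [hJ, Bool.false_eq_true, if_false] at hj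
    rw [std_eq_R hJ]
    exact T.mem_R_of_conj _ (hmL.2 j) (mem_normalizer_iff_conjSub.mp hj)
  · simpa only [hJ, if_true] using hj

/-- The permutations that occur in the normalizer of a standard product. -/
def Compat (J b : Fin 3 → Bool) (σ : Equiv.Perm (Fin 3)) : Prop :=
  (∀ i, J (σ i) = J i) ∧ ∃ δ : Bool, ∀ i, J i = true → b (σ i) = (b i ^^ δ)

instance (J b : Fin 3 → Bool) (σ : Equiv.Perm (Fin 3)) : Decidable (Compat J b σ) := by
  unfold Compat
  infer_instance

/-- At a quaternion coordinate the frame component normalizes `Q` and so lies in `L`. The common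
coset of the coordinates, recorded by `δ`, must therefore account for every passage between `Q` and
`Q'`. Beyond this there is no constraint, since `L` induces all of `S₃` on `Q`. -/
theorem mem_range_psi {J b : Fin 3 → Bool} {w : PermWreath Sym3 3} :
    w ∈ (T.psi J b).range ↔ Compat J b w.right ∧ ∀ i, J i = false → w.left i = 1 := by
  classical
  constructor
  · rintro ⟨m, rfl⟩
    refine ⟨⟨fun i => ?_, decide (co m.1 0 ∉ T.L), fun i hi => ?_⟩, fun i hi => ?_⟩
    · have := type_symm m.2 (pm m.1 i)
      simpa using this.symm
    · have h0 : J (pm m.1 i) = true := by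
        have := type_symm m.2 (pm m.1 i)
        simp only [Equiv.symm_apply_apply] at this
        rw [← this, hi]
      have h1 := T.mem_L_of_conj (conj_frameCo m.2 h0)
      rw [frameCo, T.mul_mem_L_iff, T.mul_mem_L_iff, inv_mem_iff, ePow_mem_L, ePow_mem_L,
        co_iff _ _ 0] at h1
      rw [psi_right]
      by_cases hc : co m.1 0 ∈ T.L <;> cases hb : b i <;> cases hb' : b (pm m.1 i) <;>
        simp_all
    · rw [psi_left, hi]
      rfl
  · rintro ⟨⟨hJ, δ, hδ⟩, hw⟩
    choose n hnL hnQ hn using fun i => T.θ_surj (w.left i)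
    have hJ' : ∀ i, J (w.right.symm i) = J i := fun i => by
      have := hJ (w.right.symm i)
      simpa using this.symm
    -- At quaternion coordinates the lift of the prescribed permutation is moved between the two
    -- frames. At the other coordinates `ePow δ` normalizes `R` and only supplies the correct coset.
    set f : Fin 3 → N := fun i =>
      if J i then T.ePow (b i) * n i * (T.ePow (b (w.right.symm i)))⁻¹ else T.ePow δ with hf
    have hfL : ∀ i, f i ∈ T.L ↔ δ = false := by
      intro i
      simp only [hf]
      split_ifs with hi
      · have := hδ (w.right.symm i) ((hJ' i).trans hi)
        rw [Equiv.apply_symm_apply] at this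
        rw [T.mul_mem_L_iff, T.mul_mem_L_iff, inv_mem_iff, ePow_mem_L, ePow_mem_L, this]
        simp only [hnL, iff_true]
        cases δ <;> cases b (w.right.symm i) <;> simp
      · exact ePow_mem_L
    set m : T.M := T.tri f w.right (fun i j => by rw [hfL, hfL]) with hm
    have hmn : m ∈ T.nor J b := by
      rw [mem_nor]
      intro i
      rw [hm, co_tri, pm_tri]
      simp only [hf]
      cases hi : J i
      · simp only [Bool.false_eq_true, if_false]
        rw [std_eq_R hi, std_eq_R ((hJ' i).trans hi), conj_ePow_R]
      · simp only [if_true]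
        rw [std_eq_Q hi, std_eq_Q ((hJ' i).trans hi), ← conjSub_mul, inv_mul_cancel_right,
          conjSub_mul, hnQ]
    refine ⟨⟨m, hmn⟩, SemidirectProduct.ext (funext fun i => ?_) rfl⟩
    rw [psi_left]
    cases hi : J i
    · simpa using (hw i hi).symm
    · simp only [if_true]
      rw [← hn i]
      congr 1
      simp [frameCo, hm, hf, hi, mul_assoc]

end QuaternionData

end

/-! ### The six types, and the radical subgroups over each of them -/

section

namespace QuaternionData

/-- The list of standard types. -/
def stdTypes : List ((Fin 3 → Bool) × (Fin 3 → Bool)) :=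
  [(![true, true, true], ![false, false, false]), (![true, true, true], ![false, false, true]),
    (![true, true, false], ![false, false, false]), (![true, true, false], ![false, true, false]),
    (![false, false, true], ![false, false, false]),
    (![false, false, false], ![false, false, false])]

-- A permutation sorts the coordinates, and conjugation by `(e, e, e)`, expressed by `δ`, flips all
-- entries of `b` at once. What remains is the number of factors `R` and whether the quaternion
-- factors are all `L`-conjugate.
set_option maxRecDepth 10000 in
theorem exists_stdTypes : ∀ J b : Fin 3 → Bool, ∃ σ : Equiv.Perm (Fin 3), ∃ δ : Bool,
    ((fun i => J (σ i)), (fun i => J (σ i) && (b (σ i) ^^ δ))) ∈ stdTypes := by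
  decide

theorem exists_compat_conj_swap : ∀ t ∈ stdTypes, ∀ σ, Compat t.1 t.2 σ → σ * σ = 1 → σ ≠ 1 →
    ∃ ρ, Compat t.1 t.2 ρ ∧ ρ * σ * ρ⁻¹ = Equiv.swap 0 1 := by
  decide

theorem compat_swap : ∀ t ∈ stdTypes, Compat t.1 t.2 (Equiv.swap 0 1) := by
  decide

/-- The form in which it is used that a `2`-subgroup of `S₃` has order at most two. -/
theorem perm_eq_of_sq : ∀ σ τ : Equiv.Perm (Fin 3), σ * σ = 1 → τ * τ = 1 →
    (σ * τ) * (σ * τ) = 1 → σ ≠ 1 → τ ≠ 1 → σ = τ := by decide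

theorem perm_sq_or_cube : ∀ σ : Equiv.Perm (Fin 3), σ ^ 2 = 1 ∨ σ ^ 3 = 1 := by decide
theorem eq_swap_of_commute : ∀ σ : Equiv.Perm (Fin 3), σ * Equiv.swap 0 1 = Equiv.swap 0 1 * σ → σ = 1 ∨ σ = Equiv.swap 0 1 := by decide

theorem symm_compat_of_RRQ : ∀ σ, Compat ![false, false, true] ![false, false, false] σ →
    σ * Equiv.swap 0 1 = Equiv.swap 0 1 * σ := by decide

variable {N : Type*} [Group N] {T : QuaternionData N}

/-! ### Subgroups between the kernel of `psi` and the normalizer of a standard product -/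

variable (T) in
/-- The preimage of `V` under `psi`. -/
def pull (J b : Fin 3 → Bool) (V : Subgroup (PermWreath Sym3 3)) : Subgroup T.M :=
  (V.comap (T.psi J b)).map (T.nor J b).subtype

variable (T) in
/-- The image of `Y` under `psi`. -/
def push (J b : Fin 3 → Bool) (Y : Subgroup T.M) : Subgroup (PermWreath Sym3 3) :=
  (Y.subgroupOf (T.nor J b)).map (T.psi J b)

variable {J b : Fin 3 → Bool}

theorem mem_pull {V : Subgroup (PermWreath Sym3 3)} {m : T.M} :
    m ∈ T.pull J b V ↔ ∃ h : m ∈ T.nor J b, T.psi J b ⟨m, h⟩ ∈ V := by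
  constructor
  · rintro ⟨⟨m, h⟩, hm, rfl⟩
    exact ⟨h, hm⟩
  · rintro ⟨h, hm⟩
    exact ⟨⟨m, h⟩, hm, rfl⟩

theorem pull_mono {V V' : Subgroup (PermWreath Sym3 3)} (h : V ≤ V') :
    T.pull J b V ≤ T.pull J b V' :=
  fun _ hm => mem_pull.mpr ⟨(mem_pull.mp hm).1, h (mem_pull.mp hm).2⟩

theorem pull_bot : T.pull J b ⊥ = T.lam J b := by
  ext m
  rw [mem_pull]
  constructor
  · rintro ⟨h, hm⟩
    exact (psi_eq_one_iff ⟨m, h⟩).mp hm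
  · intro h
    exact ⟨lam_le_nor J b h, (psi_eq_one_iff ⟨m, _⟩).mpr h⟩

theorem lam_le_pull (V : Subgroup (PermWreath Sym3 3)) : T.lam J b ≤ T.pull J b V := by
  rw [← pull_bot]
  exact pull_mono bot_le

theorem isPGroup_ker_psi : IsPGroup 2 (T.psi J b).ker := by
  rintro ⟨m, hm⟩
  obtain ⟨k, hk⟩ := isPGroup_lam (T := T) J b ⟨m, (psi_eq_one_iff m).mp hm⟩
  have : (m : T.M) ^ 2 ^ k = 1 := congrArg Subtype.val hk
  exact ⟨k, Subtype.ext (Subtype.ext this)⟩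

theorem isPGroup_pull {V : Subgroup (PermWreath Sym3 3)} (hV : IsPGroup 2 V) :
    IsPGroup 2 (T.pull J b V) :=
  (hV.comap_of_ker_isPGroup _ isPGroup_ker_psi).map _

theorem conjSub_pull (m : T.nor J b) (V : Subgroup (PermWreath Sym3 3)) :
    conjSub (m : T.M) (T.pull J b V) = T.pull J b (conjSub (T.psi J b m) V) := by
  ext x
  rw [mem_conjSub, mem_pull, mem_pull]
  constructor
  · rintro ⟨h, hx⟩
    have hx' : x ∈ T.nor J b := by
      have := mul_mem (mul_mem m.2 h) (inv_mem m.2)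
      simpa [mul_assoc] using this
    refine ⟨hx', ?_⟩
    rw [mem_conjSub, ← map_inv, ← map_mul, ← map_mul]
    exact hx
  · rintro ⟨h, hx⟩
    refine ⟨mul_mem (mul_mem (inv_mem m.2) h) m.2, ?_⟩
    rw [mem_conjSub, ← map_inv, ← map_mul, ← map_mul] at hx
    exact hx

theorem push_conjSub (m : T.nor J b) (Y : Subgroup T.M) :
    T.push J b (conjSub (m : T.M) Y) = conjSub (T.psi J b m) (T.push J b Y) := by
  ext x
  rw [mem_conjSub]
  constructor
  · rintro ⟨y, hy, rfl⟩
    exact ⟨m⁻¹ * y * m, mem_conjSub.mp (Subgroup.mem_subgroupOf.mp hy), by simp⟩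
  · rintro ⟨y, hy, h⟩
    refine ⟨m * y * m⁻¹, ?_, by rw [map_mul, map_mul, h]; simp [mul_assoc]⟩
    exact conj_mem_conjSub.mpr hy

/-- The correspondence theorem for subgroups between the kernel `lam` and the domain `nor` of `psi`.
-/
theorem pull_push {Y : Subgroup T.M} (h : T.lam J b ≤ Y) (h' : Y ≤ T.nor J b) :
    T.pull J b (T.push J b Y) = Y := by
  ext m
  rw [mem_pull]
  constructor
  · rintro ⟨hm, y, hy, hym⟩
    have h1 : T.psi J b (y⁻¹ * ⟨m, hm⟩) = 1 := by rw [map_mul, map_inv, hym]; simp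
    have h2 := h ((psi_eq_one_iff _).mp h1)
    have h3 := mul_mem (show (y : T.M) ∈ Y from hy) h2
    simpa using h3
  · intro hm
    exact ⟨h' hm, ⟨m, h' hm⟩, hm, rfl⟩

theorem conjSub_bot {G : Type*} [Group G] (g : G) : conjSub g (⊥ : Subgroup G) = ⊥ := by
  ext x
  simp only [mem_conjSub, Subgroup.mem_bot]
  rw [mul_assoc, inv_mul_eq_one, eq_comm, mul_eq_right]

/-- `Y` is a radical `2`-subgroup that meets `L × L × L` in a standard product. -/
structure IsOver (J b : Fin 3 → Bool) (Y : Subgroup T.M) : Prop where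
  radical : IsRadicalTwo Y
  proj_eq : proj Y = T.std J b

namespace IsOver

variable {Y : Subgroup T.M}

theorem inf_boxL (hY : IsOver J b Y) : Y ⊓ T.boxL = T.box (T.std J b) := by
  rw [IsRadicalTwo.inf_boxL hY.radical, hY.proj_eq]

theorem normalizer_le (hY : IsOver J b Y) :
    Subgroup.normalizer (Y : Set T.M) ≤ T.nor J b := by
  intro m hm
  rw [nor, mem_normalizer_iff_conjSub, ← hY.proj_eq]
  exact conjSub_box_proj (mem_normalizer_iff_conjSub.mp hm)

theorem le_nor (hY : IsOver J b Y) : Y ≤ T.nor J b :=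
  Subgroup.le_normalizer.trans hY.normalizer_le

/-- `lam` is a `2`-group and is normal in `nor`, which contains the normalizer of `Y`. -/
theorem lam_le (hY : IsOver J b Y) : T.lam J b ≤ Y := by
  refine hY.radical.2 _ (isPGroup_lam J b) fun m hm => ?_
  rw [← pull_bot, conjSub_pull ⟨m, hY.normalizer_le hm⟩]
  congr 1
  exact conjSub_bot _

theorem pull_push (hY : IsOver J b Y) : T.pull J b (T.push J b Y) = Y :=
  QuaternionData.pull_push hY.lam_le hY.le_nor

theorem conjSub (hY : IsOver J b Y) (m : T.nor J b) : IsOver J b (conjSub (m : T.M) Y) := by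
  refine ⟨hY.radical.conjSub _, funext fun i => ?_⟩
  rw [proj_conjSub, hY.proj_eq]
  exact mem_nor.mp m.2 i

theorem isPGroup_push (hY : IsOver J b Y) : IsPGroup 2 (T.push J b Y) :=
  (hY.radical.1.comap_subtype).map _

/-- The preimage of `⟨a⟩` is a `2`-group. Elements normalizing `Y` have images that normalize the
image of `Y`, hence commute with `a`, so they normalize this preimage; radicality absorbs it into
`Y`. -/
theorem mem_push (hY : IsOver J b Y) {a : PermWreath Sym3 3} (ha : a ∈ (T.psi J b).range)
    (ha2 : a * a = 1)
    (hc : ∀ w ∈ (T.psi J b).range, _root_.conjSub w (T.push J b Y) = T.push J b Y →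
      w * a = a * w) : a ∈ T.push J b Y := by
  have hle := hY.radical.2 (T.pull J b (Subgroup.zpowers a)) (by
      apply isPGroup_pull
      apply IsPGroup.of_card_dvd_pow (n := 1)
      rw [Nat.card_zpowers]
      exact orderOf_dvd_of_pow_eq_one (by rw [pow_one, pow_two, ha2])) (by
      intro m hm
      rw [conjSub_pull ⟨m, hY.normalizer_le hm⟩]
      congr 1
      have h1 := push_conjSub (T := T) ⟨m, hY.normalizer_le hm⟩ Y
      rw [mem_normalizer_iff_conjSub.mp hm] at h1
      have h2 := hc _ ⟨_, rfl⟩ h1.symm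
      ext x
      rw [mem_conjSub, Subgroup.mem_zpowers_iff, Subgroup.mem_zpowers_iff]
      refine exists_congr fun k => ?_
      have h3 : T.psi J b ⟨m, hY.normalizer_le hm⟩ * a ^ k =
        a ^ k * T.psi J b ⟨m, hY.normalizer_le hm⟩ :=
        Commute.zpow_right (show Commute _ _ from h2) k
      constructor
      · intro h
        have h4 := h3
        nth_rw 1 [h] at h4
        rw [← mul_assoc, ← mul_assoc, mul_inv_cancel, one_mul] at h4
        exact (mul_right_cancel h4).symm
      · rintro rfl
        rw [mul_assoc, ← h3, inv_mul_cancel_left])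
  obtain ⟨m, rfl⟩ := ha
  exact ⟨m, hle (mem_pull.mpr ⟨m.2, Subgroup.mem_zpowers _⟩), rfl⟩

/-- With trivial permutation part, a quaternion coordinate forces all coordinates into `L`, so the
element comes from `Y ∩ L³`, which lies in the kernel of `psi`. Without quaternion coordinates,
`psi` sees the permutation part only. -/
theorem eq_one_of_right (hY : IsOver J b Y) {x : PermWreath Sym3 3} (hx : x ∈ T.push J b Y)
    (h : x.right = 1) : x = 1 := by
  obtain ⟨m, hm, rfl⟩ := hx
  rw [psi_eq_one_iff]
  have hp : pm m.1 = 1 := h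
  by_cases hJ : ∃ i, J i = true
  · obtain ⟨i, hi⟩ := hJ
    rw [lam_eq_box hi, ← hY.inf_boxL]
    refine ⟨hm, hp, fun j => ?_⟩
    rw [co_iff m.1 j i]
    have := T.mem_L_of_conj (conj_frameCo m.2 hi)
    rw [frameCo, hp, T.mul_mem_L_iff, T.mul_mem_L_iff, inv_mem_iff] at this
    simp only [perm_symm_one, Equiv.Perm.coe_one, id_eq] at this
    tauto
  · push Not at hJ
    rw [← psi_eq_one_iff]
    refine SemidirectProduct.ext (funext fun i => ?_) h
    rw [psi_left, if_neg (hJ i)]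
    rfl

end IsOver

/-- The transposition `(1, 2)` in the wreath product. -/
def swapW : PermWreath Sym3 3 := ⟨1, Equiv.swap 0 1⟩

/-- The subgroup generated by `swapW`, or the trivial subgroup. -/
def flagSub (f : Bool) : Subgroup (PermWreath Sym3 3) := if f then Subgroup.zpowers swapW else ⊥

theorem swapW_mul_swapW : swapW * swapW = 1 := by
  refine SemidirectProduct.ext ?_ ?_
  · rw [SemidirectProduct.mul_left]
    simp [swapW]
  · rw [SemidirectProduct.mul_right]
    simp [swapW]

theorem swapW_ne_one : swapW ≠ 1 := by
  intro h
  have : (Equiv.swap 0 1 : Equiv.Perm (Fin 3)) = 1 := congrArg SemidirectProduct.right h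
  revert this
  decide

theorem mem_zpowers_of_sq {G : Type*} [Group G] {a x : G} (h : a * a = 1) :
    x ∈ Subgroup.zpowers a ↔ x = 1 ∨ x = a := by
  constructor
  · rintro ⟨k, rfl⟩
    rcases Int.even_or_odd' k with ⟨n, rfl | rfl⟩
    · left
      simp only [zpow_mul]
      rw [zpow_two, h, one_zpow]
    · right
      simp only [zpow_add, zpow_mul, zpow_one]
      rw [zpow_two, h, one_zpow, one_mul]
  · rintro (rfl | rfl)
    · exact one_mem _
    · exact Subgroup.mem_zpowers _

theorem swapW_mem_range {t : (Fin 3 → Bool) × (Fin 3 → Bool)} (ht : t ∈ stdTypes) :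
    swapW ∈ (T.psi t.1 t.2).range :=
  mem_range_psi.mpr ⟨compat_swap t ht, fun _ _ => rfl⟩

theorem isPGroup_flagSub (f : Bool) : IsPGroup 2 (flagSub f) := by
  cases f
  · exact IsPGroup.of_bot
  · apply IsPGroup.of_card_dvd_pow (n := 1)
    rw [flagSub, if_pos rfl, Nat.card_zpowers]
    exact orderOf_dvd_of_pow_eq_one (by rw [pow_one, pow_two, swapW_mul_swapW])

theorem commute_swapW_iff {w : PermWreath Sym3 3} :
    w * swapW = swapW * w ↔ (w.right = 1 ∨ w.right = Equiv.swap 0 1) ∧ w.left 0 = w.left 1 := by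
  have hl : ∀ i, (w * swapW).left i = w.left i := fun i => by
    rw [SemidirectProduct.mul_left]
    simp [swapW]
  have hl' : ∀ i, (swapW * w).left i = w.left (Equiv.swap 0 1 i) := fun i => by
    rw [SemidirectProduct.mul_left]
    simp [swapW]
    rfl
  constructor
  · intro h
    refine ⟨eq_swap_of_commute _ (congrArg SemidirectProduct.right h), ?_⟩
    have := congrFun (congrArg SemidirectProduct.left h) 0
    rw [hl, hl'] at this
    simpa using this
  · rintro ⟨h1, h2⟩
    refine SemidirectProduct.ext (funext fun i => ?_) ?_
    · rw [hl, hl']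
      fin_cases i
      · simpa using h2
      · simpa using h2.symm
      · rfl
    · change w.right * Equiv.swap 0 1 = Equiv.swap 0 1 * w.right
      rcases h1 with h1 | h1 <;> simp [h1]

/-- A radical `2`-subgroup over a standard product is conjugate to a standard one. -/
theorem IsOver.exists_conj_eq {t : (Fin 3 → Bool) × (Fin 3 → Bool)} (ht : t ∈ stdTypes)
    {Y : Subgroup T.M} (hY : IsOver t.1 t.2 Y) :
    ∃ m f, _root_.conjSub m Y = T.pull t.1 t.2 (flagSub f) ∧
      (t = (![false, false, true], ![false, false, false]) → f = true) := by
  obtain ⟨J, b⟩ := t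
  by_cases hD : T.push J b Y = ⊥
  · refine ⟨1, false, ?_, fun h => ?_⟩
    · rw [conjSub_one, ← hY.pull_push, hD]
      rfl
    · exfalso
      have := hY.mem_push (swapW_mem_range ht) swapW_mul_swapW (by
        intro w hw _
        obtain ⟨h1, h2⟩ := mem_range_psi.mp hw
        simp only [Prod.mk.injEq] at h
        rw [h.1, h.2] at h1
        rw [h.1] at h2
        rw [commute_swapW_iff]
        refine ⟨eq_swap_of_commute _ (symm_compat_of_RRQ _ h1), ?_⟩
        rw [h2 0 rfl, h2 1 rfl])
      rw [hD, Subgroup.mem_bot] at this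
      exact swapW_ne_one this
  · obtain ⟨⟨t, htD⟩, ht1⟩ := Subgroup.ne_bot_iff_exists_ne_one.mp hD
    replace ht1 : t ≠ 1 := fun h => ht1 (Subtype.ext h)
    -- A permutation part of order three would give `x³ = 1` in a `2`-group, so it does not occur.
    have hsq : ∀ x ∈ T.push J b Y, x.right * x.right = 1 := by
      intro x hx
      rcases perm_sq_or_cube x.right with h | h
      · rw [← pow_two, h]
      · have hx3 : x ^ 3 = 1 := by
          apply hY.eq_one_of_right (pow_mem hx 3)
          change SemidirectProduct.rightHom (x ^ 3) = 1
          rw [map_pow]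
          exact h
        rw [hY.isPGroup_push.eq_one_of_pow_eq_one hx (by norm_num) hx3]
        rfl
    -- The permutation part is injective on the image of `Y`, which therefore embeds in `S₃` as a
    -- `2`-subgroup and has the single nontrivial element `t`.
    have hmem : ∀ x ∈ T.push J b Y, x = 1 ∨ x = t := by
      intro x hx
      by_cases hx1 : x = 1
      · exact Or.inl hx1
      right
      have hxr : x.right ≠ 1 := fun h => hx1 (hY.eq_one_of_right hx h)
      have htr : t.right ≠ 1 := fun h => ht1 (hY.eq_one_of_right htD h)
      have h1 := perm_eq_of_sq _ _ (hsq _ hx) (hsq _ htD) (hsq _ (mul_mem hx htD)) hxr htr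
      have h2 := hY.eq_one_of_right (mul_mem hx (inv_mem htD)) (by
        rw [SemidirectProduct.mul_right, SemidirectProduct.inv_right, h1, mul_inv_cancel])
      exact mul_inv_eq_one.mp h2
    have htt : t * t = 1 := hY.eq_one_of_right (mul_mem htD htD) (hsq t htD)
    have hrange : ∀ x ∈ T.push J b Y, x ∈ (T.psi J b).range := by
      rintro _ ⟨m, -, rfl⟩
      exact ⟨m, rfl⟩
    obtain ⟨ρ, hρ, hρt⟩ := exists_compat_conj_swap _ ht t.right
      (mem_range_psi.mp (hrange t htD)).1 (hsq t htD) (fun h => ht1 (hY.eq_one_of_right htD h))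
    set w₁ : PermWreath Sym3 3 := ⟨1, ρ⟩ with hw₁
    set t₁ := w₁ * t * w₁⁻¹ with ht₁
    have hw₁r : w₁ ∈ (T.psi J b).range := mem_range_psi.mpr ⟨hρ, fun _ _ => rfl⟩
    have ht₁r : t₁ ∈ (T.psi J b).range :=
      mul_mem (mul_mem hw₁r (hrange t htD)) (inv_mem hw₁r)
    have ht₁s : t₁.right = Equiv.swap 0 1 := hρt
    have ht₁t : t₁ * t₁ = 1 := by
      have : t₁ * t₁ = w₁ * (t * t) * w₁⁻¹ := by rw [ht₁]; group
      rw [this, htt]; group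
    clear_value t₁
    have hg : t₁.left 0 * t₁.left 1 = 1 := by
      have := congrFun (congrArg SemidirectProduct.left ht₁t) 0
      rw [SemidirectProduct.mul_left, ht₁s] at this
      exact this
    -- Since `t₁² = 1`, the first two coordinates of `t₁` are inverse to each other. Conjugation by
    -- the inverse of the first one, placed in the first coordinate, makes both trivial.
    set w₂ : PermWreath Sym3 3 := ⟨Pi.mulSingle 0 (t₁.left 0)⁻¹, 1⟩ with hw₂
    have hw₂r : w₂ ∈ (T.psi J b).range := by
      refine mem_range_psi.mpr ⟨⟨fun _ => rfl, false, fun _ _ => by simp [hw₂]⟩, fun i hi => ?_⟩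
      by_cases h0 : i = 0
      · subst h0
        change Pi.mulSingle (M := fun _ => Sym3) 0 (t₁.left 0)⁻¹ 0 = 1
        rw [Pi.mulSingle_eq_same, (mem_range_psi.mp ht₁r).2 0 hi, inv_one]
      · exact Pi.mulSingle_eq_of_ne h0 _
    set t₂ := w₂ * t₁ * w₂⁻¹ with ht₂
    have ht₂r : t₂ ∈ (T.psi J b).range := mul_mem (mul_mem hw₂r ht₁r) (inv_mem hw₂r)
    have ht₂s : t₂.right = Equiv.swap 0 1 := by
      rw [ht₂, SemidirectProduct.mul_right, SemidirectProduct.mul_right,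
        SemidirectProduct.inv_right, ht₁s]
      simp [hw₂]
    have hl : ∀ i, t₂.left i = w₂.left i * t₁.left i * (w₂.left (Equiv.swap 0 1 i))⁻¹ := by
      intro i
      have h1 : t₂ * w₂ = w₂ * t₁ := by rw [ht₂]; group
      have := congrFun (congrArg SemidirectProduct.left h1) i
      rw [SemidirectProduct.mul_left, SemidirectProduct.mul_left, ht₂s] at this
      exact eq_mul_inv_of_mul_eq this
    have hl0 : t₂.left 0 = 1 := by
      rw [hl]
      simp [hw₂]
    have hl1 : t₂.left 1 = 1 := by
      rw [hl]
      simp only [Equiv.swap_apply_right, hw₂, Pi.mulSingle_eq_same, inv_inv]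
      rw [Pi.mulSingle_eq_of_ne (by decide), one_mul]
      exact mul_eq_one_comm.mp hg
    have ht₂t : t₂ * t₂ = 1 := by
      have : t₂ * t₂ = w₂ * (t₁ * t₁) * w₂⁻¹ := by rw [ht₂]; group
      rw [this, ht₁t]; group
    obtain ⟨m, hm⟩ := mul_mem hw₂r hw₁r
    have hY' := hY.conjSub m
    have hpush := push_conjSub (T := T) (J := J) (b := b) m Y
    have ht₂c : t₂ = T.psi J b m * t * (T.psi J b m)⁻¹ := by
      rw [hm, ht₂, ht₁]
      group
    have ht₂mem : t₂ ∈ T.push J b (_root_.conjSub (m : T.M) Y) := by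
      rw [hpush, ht₂c]
      exact conj_mem_conjSub.mpr htD
    have hmem' : ∀ x ∈ T.push J b (_root_.conjSub (m : T.M) Y), x = 1 ∨ x = t₂ := by
      intro x hx
      rw [hpush, mem_conjSub] at hx
      rcases hmem _ hx with h | h
      · left
        rwa [mul_assoc, inv_mul_eq_one, eq_comm, mul_eq_right] at h
      · right
        rw [ht₂c, ← h]
        group
    clear_value t₂
    have hne : t₂ ≠ 1 := by
      rintro rfl
      have : (1 : Equiv.Perm (Fin 3)) = Equiv.swap 0 1 := ht₂s
      revert this
      decide
    have hcs : t₂ * swapW = swapW * t₂ := commute_swapW_iff.mpr ⟨Or.inr ht₂s, hl0.trans hl1.symm⟩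
    -- Now `t₂ = (1, 1, s) swapW`, and `t₂ swapW = (1, 1, s)` commutes with all elements of the
    -- range that normalize the image of `Y`, since these centralize `t₂` and hence `swapW`. It thus
    -- lies in that image; having trivial permutation part, it is `1`, and `t₂ = swapW`.
    have ha := hY'.mem_push (a := t₂ * swapW) (mul_mem ht₂r (swapW_mem_range ht)) (by
        calc t₂ * swapW * (t₂ * swapW) = t₂ * (swapW * t₂) * swapW := by group
          _ = (t₂ * t₂) * (swapW * swapW) := by rw [← hcs]; group
          _ = 1 := by rw [ht₂t, swapW_mul_swapW, one_mul]) (by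
        intro w hw hwc
        have h1 : w * t₂ * w⁻¹ = t₂ := by
          have h2 := conj_mem_conjSub (g := w).mpr ht₂mem
          rw [hwc] at h2
          rcases hmem' _ h2 with h3 | h3
          · exact absurd (by simpa using h3) hne
          · exact h3
        rw [mul_inv_eq_iff_eq_mul] at h1
        have h4 : w * swapW = swapW * w := by
          have h5 := eq_swap_of_commute w.right (by
            have := congrArg SemidirectProduct.right h1
            rwa [SemidirectProduct.mul_right, SemidirectProduct.mul_right, ht₂s] at this)
          refine commute_swapW_iff.mpr ⟨h5, ?_⟩
          have h6 := congrFun (congrArg SemidirectProduct.left h1) 0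
          rw [SemidirectProduct.mul_left, SemidirectProduct.mul_left, ht₂s] at h6
          have h7 : w.left 0 * t₂.left (w.right⁻¹ 0) = t₂.left 0 * w.left 1 := h6
          rw [hl0, one_mul] at h7
          rcases h5 with h5 | h5 <;> rw [h5] at h7
          · simpa [hl0] using h7
          · simpa [hl1] using h7
        rw [← mul_assoc, h1, mul_assoc, h4, mul_assoc])
    have ha1 := hY'.eq_one_of_right ha (by
      rw [SemidirectProduct.mul_right, ht₂s]
      exact Equiv.swap_mul_self 0 1)
    have ht₂sw : t₂ = swapW := by
      have h1 := mul_eq_one_iff_eq_inv.mp ha1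
      rw [h1]
      exact inv_eq_of_mul_eq_one_left swapW_mul_swapW
    refine ⟨m, true, ?_, fun _ => rfl⟩
    rw [← hY'.pull_push]
    congr 1
    ext x
    rw [flagSub, if_pos rfl, mem_zpowers_of_sq swapW_mul_swapW]
    constructor
    · intro hx
      exact ht₂sw ▸ hmem' x hx
    · rintro (rfl | rfl)
      · exact one_mem _
      · exact ht₂sw ▸ ht₂mem

end QuaternionData

end

section

namespace QuaternionData

theorem eq_of_stdTypes_conj : ∀ t ∈ stdTypes, ∀ t' ∈ stdTypes, ∀ (σ : Equiv.Perm (Fin 3))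
    (δ : Bool), (∀ i, t.1 (σ i) = t'.1 i) →
    (∀ i, t'.1 i = true → t'.2 i = (t.2 (σ i) ^^ δ)) → t = t' := by decide

variable {N : Type*} [Group N] {T : QuaternionData N}

/-! ### Conjugation to standard products -/

theorem conj_ePow_ePow (δ b : Bool) (A : Subgroup N) :
    conjSub (T.ePow δ) (conjSub (T.ePow b) A) = conjSub (T.ePow (b ^^ δ)) A := by
  cases δ
  · simp [ePow]
  · rw [Bool.xor_true, ← conj_e_ePow]
    rfl

/-- If `uᵢ` denotes the conjugating element, then `uᵢ⁻¹`, or `e uᵢ⁻¹` when `uᵢ ∉ L`, lies in `L`.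
Such elements may be chosen independently in the coordinates and bring every factor to `Q`, `Q'` or
`R`. A permutation together with `(e, e, e)` then reaches the list of types. -/
theorem exists_isOver {Y : Subgroup T.M} (hY : IsRadicalTwo Y)
    (h : ∀ i, ∃ u, proj Y i = conjSub u T.Q ∨ proj Y i = conjSub u T.R) :
    ∃ m, ∃ t ∈ stdTypes, IsOver t.1 t.2 (conjSub m Y) := by
  classical
  have h' : ∀ i, ∃ u j, proj Y i = conjSub u (T.base j) := by
    intro i
    obtain ⟨u, hu | hu⟩ := h i
    · exact ⟨u, true, hu⟩
    · exact ⟨u, false, hu⟩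
  choose u J hu using h'
  set b : Fin 3 → Bool := fun i => decide (u i ∉ T.L) with hb
  obtain ⟨σ, δ, hσ⟩ := exists_stdTypes J b
  have hL : ∀ i, T.ePow (b i) * (u i)⁻¹ ∈ T.L := by
    intro i
    rw [T.mul_mem_L_iff, ePow_mem_L, inv_mem_iff]
    simp [hb]
  set m₁ : T.M := T.tri (fun i => T.ePow (b i) * (u i)⁻¹) 1
    (fun i j => by simp only [hL]) with hm₁
  set m₂ : T.M := T.tri (fun _ => T.ePow δ) σ⁻¹ (fun _ _ => Iff.rfl) with hm₂
  refine ⟨m₂ * m₁, _, hσ, ?_⟩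
  rw [conjSub_mul]
  refine ⟨(hY.conjSub _).conjSub _, funext fun i => ?_⟩
  rw [proj_conjSub, proj_conjSub, hu]
  simp only [hm₂, hm₁, co_tri, pm_tri, perm_symm_inv, perm_symm_one, Equiv.Perm.coe_one, id_eq]
  rw [conjSub_mul, ← conjSub_mul (u (σ i))⁻¹, inv_mul_cancel, conjSub_one, conj_ePow_ePow]
  rw [std_and (fun i => J (σ i)) (fun i => b (σ i) ^^ δ)]
  rfl

open FusionSystem in
/-- Every centric radical subgroup is conjugate to a standard one. -/
theorem IsModel.exists_conj_eq [Finite N] {G : Type*} [Group G] [Finite G] {π : T.M →* G}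
    {S : Subgroup G} (hm : IsModel π S) {P : Subgroup S}
    (hP : (ofGroup S).IsCentricRadical 2 P) :
    ∃ m, ∃ t ∈ stdTypes, ∃ f, conjSub m (hat π P) = T.pull t.1 t.2 (flagSub f) ∧
      (t = (![false, false, true], ![false, false, false]) → f = true) := by
  obtain ⟨m, t, ht, hY⟩ := exists_isOver (hm.isRadicalTwo_hat hP) (hm.exists_proj_eq hP)
  obtain ⟨n, f, h, hf⟩ := hY.exists_conj_eq ht
  exact ⟨n * m, t, ht, f, by rw [conjSub_mul, h], hf⟩

/-! ### Standard subgroups are not conjugate to each other -/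

variable {J b : Fin 3 → Bool}

theorem mem_flagSub {f : Bool} {x : PermWreath Sym3 3} (hx : x ∈ flagSub f) :
    x = 1 ∨ x = swapW := by
  cases f
  · exact Or.inl (Subgroup.mem_bot.mp hx)
  · exact (mem_zpowers_of_sq swapW_mul_swapW).mp hx

/-- Elements over `swapW` permute coordinates nontrivially, so the flag is invisible in `L × L × L`.
-/
theorem pull_inf_boxL (f : Bool) : T.pull J b (flagSub f) ⊓ T.boxL = T.box (T.std J b) := by
  rw [← lam_inf_boxL]
  refine le_antisymm ?_ (inf_le_inf_right _ (lam_le_pull _))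
  rintro m ⟨hm, hmL⟩
  refine ⟨?_, hmL⟩
  obtain ⟨h, hm⟩ := mem_pull.mp hm
  refine (psi_eq_one_iff ⟨m, h⟩).mp ?_
  rcases mem_flagSub hm with h1 | h1
  · exact h1
  · exfalso
    have h2 := congrArg SemidirectProduct.right h1
    rw [psi_right, hmL.1] at h2
    revert h2
    decide

theorem conj_box_of_conj_pull {J' b' : Fin 3 → Bool} {f f' : Bool} {m : T.M}
    (h : conjSub m (T.pull J b (flagSub f)) = T.pull J' b' (flagSub f')) :
    conjSub m (T.box (T.std J b)) = T.box (T.std J' b') := by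
  rw [← pull_inf_boxL f, ← pull_inf_boxL f']
  ext x
  rw [mem_conjSub, Subgroup.mem_inf, Subgroup.mem_inf, ← mem_conjSub, h, ← mem_conjSub,
    conjSub_boxL]

/-- Orders distinguish `Q` from `R`. At the quaternion coordinates the coset of `m` decides
uniformly whether `Q` and `Q'` are interchanged, and the list of types contains no two labels
related in this way. -/
theorem stdTypes_eq_of_conj {t t' : (Fin 3 → Bool) × (Fin 3 → Bool)} (ht : t ∈ stdTypes)
    (ht' : t' ∈ stdTypes) {m : T.M}
    (h : conjSub m (T.box (T.std t.1 t.2)) = T.box (T.std t'.1 t'.2)) : t = t' := by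
  classical
  rw [conjSub_box, box_inj (fun i => conjSub_le_of_normal (std_le_L _ _ _)) (std_le_L _ _)] at h
  have hJ : ∀ i, t.1 ((pm m).symm i) = t'.1 i := fun i => base_type_eq (h i)
  refine eq_of_stdTypes_conj t ht t' ht' (pm m).symm (decide (co m 0 ∉ T.L)) hJ fun i hi => ?_
  have h1 := h i
  rw [std_eq_Q hi, std_eq_Q ((hJ i).trans hi)] at h1
  have h2 := T.mem_L_of_conj_conj h1
  rw [T.mul_mem_L_iff, T.mul_mem_L_iff, inv_mem_iff, ePow_mem_L, ePow_mem_L,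
    co_iff m i 0] at h2
  by_cases hc : co m 0 ∈ T.L <;> cases hb : t'.2 i <;> cases hb' : t.2 ((pm m).symm i) <;>
    simp_all

theorem card_comap_of_le_range {G H : Type*} [Group G] [Group H] (f : G →* H) {V : Subgroup H}
    (hV : V ≤ f.range) : Nat.card (V.comap f) = Nat.card f.ker * Nat.card V := by
  have hle : f.ker ≤ V.comap f := fun x hx => by
    rw [Subgroup.mem_comap, MonoidHom.mem_ker.mp hx]
    exact one_mem _
  rw [← Subgroup.card_mul_index (f.ker.subgroupOf (V.comap f)),
    Nat.card_congr (Subgroup.subgroupOfEquivOfLe hle).toEquiv]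
  congr 1
  change f.ker.relIndex _ = _
  rw [Subgroup.relIndex_ker, Subgroup.map_comap_eq, inf_eq_right.mpr hV]

theorem card_flagSub (f : Bool) : Nat.card (flagSub f) = if f then 2 else 1 := by
  cases f
  · simp [flagSub]
  · rw [flagSub, if_pos rfl, if_pos rfl, Nat.card_zpowers]
    exact orderOf_eq_prime (by rw [pow_two, swapW_mul_swapW]) swapW_ne_one

theorem flagSub_le_range {t : (Fin 3 → Bool) × (Fin 3 → Bool)} (ht : t ∈ stdTypes) (f : Bool) :
    flagSub f ≤ (T.psi t.1 t.2).range := by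
  intro x hx
  rcases mem_flagSub hx with rfl | rfl
  · exact one_mem _
  · exact swapW_mem_range ht

theorem card_pull {t : (Fin 3 → Bool) × (Fin 3 → Bool)} (ht : t ∈ stdTypes) (f : Bool) :
    Nat.card (T.pull t.1 t.2 (flagSub f)) =
      Nat.card (T.lam t.1 t.2) * if f then 2 else 1 := by
  have hk : T.lam t.1 t.2 = (T.psi t.1 t.2).ker.map (T.nor t.1 t.2).subtype := by
    rw [← pull_bot]
    rfl
  rw [pull, Subgroup.card_map_of_injective (Subgroup.subtype_injective _),
    card_comap_of_le_range _ (flagSub_le_range ht f), card_flagSub, hk,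
    Subgroup.card_map_of_injective (Subgroup.subtype_injective _)]

/-- The intersection with `L × L × L` determines the type. Given the type, the order determines the
flag, since adjoining the transposition doubles it. -/
theorem pull_conj_inj [Finite N] {t t' : (Fin 3 → Bool) × (Fin 3 → Bool)} (ht : t ∈ stdTypes)
    (ht' : t' ∈ stdTypes) {f f' : Bool} {m : T.M}
    (h : conjSub m (T.pull t.1 t.2 (flagSub f)) = T.pull t'.1 t'.2 (flagSub f')) :
    t = t' ∧ f = f' := by
  have h1 := stdTypes_eq_of_conj ht ht' (conj_box_of_conj_pull h)
  subst h1
  refine ⟨rfl, ?_⟩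
  have h2 := congrArg (fun A : Subgroup T.M => Nat.card A) h
  simp only [card_conjSub] at h2
  rw [card_pull ht, card_pull ht] at h2
  have h3 : 0 < Nat.card (T.lam t.1 t.2) := Nat.card_pos
  have h4 := Nat.eq_of_mul_eq_mul_left h3 h2
  cases f <;> cases f' <;> simp at h4 ⊢

/-! ### Centralizers -/

theorem co_εM (i : Fin 3) : co T.εM i = T.ε := rfl

theorem eq_one_or_of_conj_comm {u g : N} (h : ∀ a ∈ conjSub u T.Q, g * a = a * g) :
    g = 1 ∨ g = T.ε := by
  have h1 := T.eq_of_comm (u⁻¹ * g * u) (by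
    intro a ha
    have h2 := congrArg (fun x => u⁻¹ * x * u) (h _ (conj_mem_conjSub.mpr ha))
    simpa [mul_assoc] using h2)
  have h3 : g = u * (u⁻¹ * g * u) * u⁻¹ := by group
  rcases h1 with h1 | h1
  · left
    rw [h3, h1]
    group
  · right
    rw [h3, h1, ← T.ε_comm, mul_inv_cancel_right]

/-- A subgroup of order eight is not contained in `{1, ε}`. -/
theorem exists_mem_conj_Q (u : N) : ∃ a ∈ conjSub u T.Q, a ≠ 1 ∧ a ≠ T.ε := by
  by_contra hcon
  push Not at hcon
  have hle : conjSub u T.Q ≤ Subgroup.zpowers T.ε := by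
    intro a ha
    rw [mem_zpowers_of_sq T.ε_mul_ε]
    by_cases h : a = 1
    · exact Or.inl h
    · exact Or.inr (hcon a ha h)
  have h1 : Nat.card (Subgroup.zpowers T.ε) ∣ 2 := by
    rw [Nat.card_zpowers]
    exact orderOf_dvd_of_pow_eq_one (by rw [pow_two, T.ε_mul_ε])
  have h2 := (Subgroup.card_dvd_of_le hle).trans h1
  rw [card_conjSub, T.card_Q] at h2
  exact absurd h2 (by decide)

/-- An element that centralizes a product of quaternion groups modulo `(ε, ε, ε)` has all
coordinates in `{1, ε}`. -/
theorem eq_one_or_of_comm (u : Fin 3 → N) {m : T.M}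
    (h : ∀ x ∈ T.box (fun i => conjSub (u i) T.Q), m * x = x * m ∨ m * x = T.εM * (x * m)) :
    pm m = 1 ∧ ∀ i, co m i = 1 ∨ co m i = T.ε := by
  have hQL : ∀ i, conjSub (u i) T.Q ≤ T.L := fun i => conjSub_le_of_normal T.Q_le_L
  have key : ∀ i, ∀ a ∈ conjSub (u i) T.Q, ∃ x : T.M, pm x = 1 ∧ co x i = a ∧
      (∀ j, j ≠ i → co x j = 1) ∧ x ∈ T.box (fun i => conjSub (u i) T.Q) := by
    intro i a ha
    obtain ⟨x, h1, h2, h3⟩ := exists_single (T := T) i (hQL i ha)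
    refine ⟨x, h1, h2, h3, h1, fun j => ?_⟩
    by_cases hj : j = i
    · subst hj
      rw [h2]
      exact ha
    · rw [h3 j hj]
      exact one_mem _
  -- If `m` moved coordinate `i`, take `x` supported there with entry `a`. Comparing coordinate `i`
  -- of `m x` and `x m` would force `a ∈ {1, ε}`.
  have hpm : pm m = 1 := by
    ext i : 1
    by_contra hi
    obtain ⟨a, ha, ha1, ha2⟩ := exists_mem_conj_Q (T := T) (u i)
    obtain ⟨x, h1, h2, h3, hx⟩ := key i a ha
    have hi' : (pm m).symm i ≠ i := by
      intro h'
      apply hi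
      conv_lhs => rw [← h']
      simp
    rcases h x hx with h4 | h4
    · have h5 := congrArg (fun y => co y i) h4
      simp only [co_mul, h1, h2, h3 _ hi', perm_symm_one, Equiv.Perm.coe_one, id_eq,
        mul_one] at h5
      exact ha1 (right_eq_mul.mp h5)
    · have h5 := congrArg (fun y => co y i) h4
      have hε : pm T.εM = 1 := rfl
      simp only [co_mul, h1, h2, hε, h3 _ hi', perm_symm_one, Equiv.Perm.coe_one, id_eq,
        mul_one, co_εM] at h5
      rw [← mul_assoc, right_eq_mul] at h5
      exact ha2 ((mul_eq_one_iff_inv_eq.mp h5).symm.trans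
        (inv_eq_of_mul_eq_one_left T.ε_mul_ε))
  refine ⟨hpm, fun i => eq_one_or_of_conj_comm (u := u i) fun a ha => ?_⟩
  obtain ⟨x, h1, h2, h3, hx⟩ := key i a ha
  rcases h x hx with h4 | h4
  · have h5 := congrArg (fun y => co y i) h4
    simpa [hpm, h1, h2] using h5
  -- The alternative with `(ε, ε, ε)` fails at a coordinate `j ≠ i`: there `x` is trivial and the
  -- equation reads `ε = 1`.
  · exfalso
    obtain ⟨j, hj⟩ : ∃ j : Fin 3, j ≠ i := exists_ne i
    have h5 := congrArg (fun y => co y j) h4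
    have hε : pm T.εM = 1 := rfl
    simp only [co_mul, h1, hpm, hε, h3 j hj, perm_symm_one, Equiv.Perm.coe_one, id_eq,
      mul_one, one_mul, co_εM] at h5
    exact T.ε_ne_one (right_eq_mul.mp h5)

theorem box_one_ε_le_lam {m : T.M} (h : pm m = 1) (h' : ∀ i, co m i = 1 ∨ co m i = T.ε) :
    m ∈ T.lam J b := by
  apply box_std_le_lam
  refine ⟨h, fun i => conj_Q_le_std J b i ?_⟩
  rw [mem_conjSub]
  rcases h' i with h1 | h1 <;> rw [h1]
  · simp
  · rw [mul_assoc, T.ε_comm, inv_mul_cancel_left]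
    exact T.ε_mem

/-- The preimage contains a product of three conjugates of `Q`. Its centralizer modulo `(ε, ε, ε)`
consists of triples with entries `1` and `ε`, which lie in that product. -/
theorem IsModel.mem_of_centralizes {G : Type*} [Group G] {π : T.M →* G} {S : Subgroup G}
    (hm : IsModel π S) {V : Subgroup (PermWreath Sym3 3)} {m : T.M}
    (h : ∀ x ∈ T.pull J b V, π (m * x) = π (x * m)) : m ∈ T.pull J b V := by
  obtain ⟨h1, h2⟩ := eq_one_or_of_comm (T := T) (fun i => T.ePow (b i)) (m := m) (by
    intro x hx
    have h1 := h x (lam_le_pull V (box_std_le_lam J b (box_mono (conj_Q_le_std J b) hx)))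
    have h2 : π (m * x * (x * m)⁻¹) = 1 := by rw [map_mul, map_inv, h1, mul_inv_cancel]
    rcases (hm.ker_iff _).mp h2 with h3 | h3
    · exact Or.inl (mul_inv_eq_one.mp h3)
    · exact Or.inr (mul_inv_eq_iff_eq_mul.mp h3))
  exact lam_le_pull V (box_one_ε_le_lam h1 h2)

end QuaternionData

end

section

namespace QuaternionData

variable {N : Type*} [Group N] {T : QuaternionData N}

/-! ### Outer automorphism groups -/

/-- Normalizing the preimage forces normalizing its intersection with `L × L × L`, hence membership
in `nor`. A group of order two in the image is normalized only by its centralizer. -/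
theorem mem_normalizer_pull {t : (Fin 3 → Bool) × (Fin 3 → Bool)} (ht : t ∈ stdTypes) {f : Bool}
    {m : T.M} :
    m ∈ Subgroup.normalizer (T.pull t.1 t.2 (flagSub f) : Set T.M) ↔
      ∃ h : m ∈ T.nor t.1 t.2, f = true →
        T.psi t.1 t.2 ⟨m, h⟩ * swapW = swapW * T.psi t.1 t.2 ⟨m, h⟩ := by
  rw [mem_normalizer_iff_conjSub]
  constructor
  · intro hm
    have h : m ∈ T.nor t.1 t.2 := by
      rw [nor, mem_normalizer_iff_conjSub]
      exact conj_box_of_conj_pull hm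
    refine ⟨h, ?_⟩
    rintro rfl
    obtain ⟨y, hy⟩ := swapW_mem_range (T := T) ht
    have hyp : (y : T.M) ∈ T.pull t.1 t.2 (flagSub true) :=
      mem_pull.mpr ⟨y.2, by
        change T.psi t.1 t.2 y ∈ _
        rw [hy]
        exact Subgroup.mem_zpowers _⟩
    have h1 := conj_mem_conjSub (g := m).mpr hyp
    rw [hm] at h1
    obtain ⟨h2, h3⟩ := mem_pull.mp h1
    have h4 : T.psi t.1 t.2 ⟨m * y * m⁻¹, h2⟩ =
        T.psi t.1 t.2 ⟨m, h⟩ * swapW * (T.psi t.1 t.2 ⟨m, h⟩)⁻¹ := by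
      rw [← hy, ← map_inv, ← map_mul, ← map_mul]
      rfl
    rw [h4] at h3
    rcases mem_flagSub h3 with h5 | h5
    · exact absurd (by simpa using h5) swapW_ne_one
    · exact mul_inv_eq_iff_eq_mul.mp h5
  · rintro ⟨h, hc⟩
    rw [conjSub_pull ⟨m, h⟩]
    congr 1
    cases f
    · exact conjSub_bot _
    · have hc := hc rfl
      ext x
      rw [mem_conjSub, flagSub, if_pos rfl, mem_zpowers_of_sq swapW_mul_swapW,
        mem_zpowers_of_sq swapW_mul_swapW]
      constructor
      · rintro (h1 | h1)
        · left
          rwa [mul_assoc, inv_mul_eq_one, eq_comm, mul_eq_right] at h1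
        · right
          rw [mul_assoc, inv_mul_eq_iff_eq_mul, hc] at h1
          exact mul_right_cancel h1
      · rintro (rfl | rfl)
        · left; simp
        · right; rw [mul_assoc, ← hc, inv_mul_cancel_left]

/-- The centralizer of the transposition acts on its two blocks. -/
def blocks : Subgroup.centralizer ({swapW} : Set (PermWreath Sym3 3)) →* Sym3 × Sym3 where
  toFun w := (w.1.left 0, w.1.left 2)
  map_one' := rfl
  map_mul' := by
    rintro ⟨w, hw⟩ ⟨v, hv⟩
    rw [Subgroup.mem_centralizer_iff] at hw hv
    obtain ⟨hw1, -⟩ := commute_swapW_iff.mp (hw _ rfl).symm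
    obtain ⟨-, hv2⟩ := commute_swapW_iff.mp (hv _ rfl).symm
    have h : ∀ i, (w * v).left i = w.left i * v.left (w.right⁻¹ i) := fun i => rfl
    refine Prod.ext ?_ ?_
    · change (w * v).left 0 = w.left 0 * v.left 0
      rw [h]
      rcases hw1 with hw1 | hw1 <;> rw [hw1]
      · rfl
      · rw [Equiv.swap_inv, Equiv.swap_apply_left, hv2]
    · change (w * v).left 2 = w.left 2 * v.left 2
      rw [h]
      rcases hw1 with hw1 | hw1 <;> rw [hw1] <;> rfl

theorem blocks_eq_one_iff (w : Subgroup.centralizer ({swapW} : Set (PermWreath Sym3 3))) :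
    blocks w = 1 ↔ w.1 ∈ flagSub true := by
  obtain ⟨w, hw⟩ := w
  rw [Subgroup.mem_centralizer_iff] at hw
  obtain ⟨h1, h2⟩ := commute_swapW_iff.mp (hw _ rfl).symm
  rw [flagSub, if_pos rfl, mem_zpowers_of_sq swapW_mul_swapW]
  constructor
  · intro h
    have h3 : w.left 0 = 1 := congrArg Prod.fst h
    have h4 : w.left 2 = 1 := congrArg Prod.snd h
    have h5 : w.left = 1 := by
      funext i
      fin_cases i
      · exact h3
      · exact h2.symm.trans h3
      · exact h4
    rcases h1 with h1 | h1
    · exact Or.inl (SemidirectProduct.ext h5 h1)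
    · exact Or.inr (SemidirectProduct.ext h5 h1)
  · rintro (rfl | rfl) <;> rfl

section

variable {G : Type*} [Group G] {π : T.M →* G} {S : Subgroup G}

open FusionSystem

theorem IsModel.isCentric (hm : IsModel π S) {P : Subgroup S} {J b : Fin 3 → Bool}
    {V : Subgroup (PermWreath Sym3 3)} (hP : hat π P = T.pull J b V) :
    (ofGroup S).IsCentric P := by
  apply isCentric_of_centralizer_le hm.surj
  rw [hP]
  exact fun m h => hm.mem_of_centralizes h

/-- Without the transposition the normalizer is all of `nor`, so the outer automorphism group is the
whole range of `psi`. -/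
theorem IsModel.nonempty_out_false (hm : IsModel π S) {P : Subgroup S}
    {t : (Fin 3 → Bool) × (Fin 3 → Bool)} (ht : t ∈ stdTypes)
    (hP : hat π P = T.pull t.1 t.2 (flagSub false)) {D : Type*} [Group D]
    (ρ : D →* PermWreath Sym3 3) (hρ : Function.Injective ρ)
    (hr : ∀ w, w ∈ ρ.range ↔ Compat t.1 t.2 w.right ∧ ∀ i, t.1 i = false → w.left i = 1) :
    Nonempty ((ofGroup S).Out P ≃* D) := by
  have hle : Subgroup.normalizer (hat π P : Set T.M) ≤ T.nor t.1 t.2 := by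
    rw [hP]
    exact fun m h => ((mem_normalizer_pull ht).mp h).1
  have hge : ∀ m ∈ T.nor t.1 t.2, m ∈ Subgroup.normalizer (hat π P : Set T.M) := by
    rw [hP]
    exact fun m h => (mem_normalizer_pull ht).mpr ⟨h, by simp⟩
  refine nonempty_out_mulEquiv hm.surj (by
      rw [hP]
      exact fun m h => hm.mem_of_centralizes h)
    ((T.psi t.1 t.2).comp (Subgroup.inclusion hle)) (fun m => ?_) ρ hρ ?_
  · have hPm : (m : T.M) ∈ hat π P ↔ (m : T.M) ∈ T.pull t.1 t.2 (flagSub false) :=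
      SetLike.ext_iff.mp hP _
    rw [hPm]
    change T.psi t.1 t.2 ⟨m, _⟩ = 1 ↔ _
    rw [psi_eq_one_iff, ← pull_bot]
    rfl
  · ext w
    rw [hr, ← mem_range_psi (T := T)]
    constructor
    · rintro ⟨m, rfl⟩
      exact ⟨⟨m, hge m m.2⟩, rfl⟩
    · rintro ⟨m, rfl⟩
      exact ⟨_, rfl⟩

/-- With the transposition the outer automorphism group is the centralizer of `swapW` in the range
of `psi`, modulo `swapW`. Its elements agree in the first two coordinates, so coordinates `0` and
`2` suffice to describe it. -/
theorem IsModel.nonempty_out_true (hm : IsModel π S) {P : Subgroup S}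
    {t : (Fin 3 → Bool) × (Fin 3 → Bool)} (ht : t ∈ stdTypes)
    (hP : hat π P = T.pull t.1 t.2 (flagSub true)) {D : Type*} [Group D]
    (ρ : D →* Sym3 × Sym3) (hρ : Function.Injective ρ)
    (hr : ∀ w, w ∈ ρ.range ↔ (t.1 0 = false → w.1 = 1) ∧ (t.1 2 = false → w.2 = 1)) :
    Nonempty ((ofGroup S).Out P ≃* D) := by
  have hle : ∀ m ∈ Subgroup.normalizer (hat π P : Set T.M), ∃ h : m ∈ T.nor t.1 t.2,
      T.psi t.1 t.2 ⟨m, h⟩ ∈ Subgroup.centralizer ({swapW} : Set (PermWreath Sym3 3)) := by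
    rw [hP]
    intro m h
    obtain ⟨h1, h2⟩ := (mem_normalizer_pull ht).mp h
    refine ⟨h1, Subgroup.mem_centralizer_iff.mpr ?_⟩
    rintro _ rfl
    exact (h2 rfl).symm
  refine nonempty_out_mulEquiv hm.surj (by
      rw [hP]
      exact fun m h => hm.mem_of_centralizes h)
    (blocks.comp (((T.psi t.1 t.2).comp (Subgroup.inclusion fun m h => (hle m h).1)).codRestrict
      _ fun m => (hle m m.2).2)) (fun m => ?_) ρ hρ ?_
  · have hPm : (m : T.M) ∈ hat π P ↔ (m : T.M) ∈ T.pull t.1 t.2 (flagSub true) :=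
      SetLike.ext_iff.mp hP _
    rw [hPm]
    change blocks ⟨T.psi t.1 t.2 ⟨m, _⟩, _⟩ = 1 ↔ _
    rw [blocks_eq_one_iff, mem_pull]
    constructor
    · intro h
      exact ⟨_, h⟩
    · rintro ⟨_, h⟩
      exact h
  · have hJ := (compat_swap t ht).1 0
    ext w
    rw [hr]
    constructor
    · rintro ⟨h0, h2⟩
      obtain ⟨m, hmw⟩ : (⟨![w.1, w.1, w.2], 1⟩ : PermWreath Sym3 3) ∈ (T.psi t.1 t.2).range := by
        refine mem_range_psi.mpr ⟨⟨fun _ => rfl, false, fun _ _ => by simp⟩, fun i hi => ?_⟩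
        fin_cases i
        · exact h0 hi
        · rw [Equiv.swap_apply_left] at hJ
          exact h0 (hJ.symm.trans hi)
        · exact h2 hi
      refine ⟨⟨m, ?_⟩, ?_⟩
      · rw [hP, mem_normalizer_pull ht]
        refine ⟨m.2, fun _ => ?_⟩
        change T.psi t.1 t.2 m * _ = _ * T.psi t.1 t.2 m
        rw [hmw, commute_swapW_iff]
        exact ⟨Or.inl rfl, rfl⟩
      · change ((T.psi t.1 t.2 m).left 0, (T.psi t.1 t.2 m).left 2) = w
        rw [hmw]
        rfl
    · rintro ⟨m, rfl⟩
      obtain ⟨h1, h2⟩ := mem_range_psi.mp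
        (⟨⟨m, (hle m m.2).1⟩, rfl⟩ : T.psi t.1 t.2 ⟨m, (hle m m.2).1⟩ ∈ (T.psi t.1 t.2).range)
      exact ⟨h2 0, h2 2⟩

theorem IsModel.card_hat (hm : IsModel π S) (P : Subgroup S) :
    Nat.card (hat π P) = 2 * Nat.card P := by
  rw [hat, card_comap_of_le_range _ (by rw [MonoidHom.range_eq_top.mpr hm.surj]; exact le_top),
    Subgroup.card_map_of_injective S.subtype_injective]
  congr 1
  have h1 : π.ker = Subgroup.zpowers T.εM := by
    ext m
    rw [MonoidHom.mem_ker, hm.ker_iff, mem_zpowers_of_sq εM_mul_εM]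
  rw [h1, Nat.card_zpowers]
  refine orderOf_eq_prime (by rw [pow_two, εM_mul_εM]) fun h => T.ε_ne_one ?_
  exact congrArg (fun m => co m 0) h

end

/-! ### Orders -/

theorem card_box {A : Fin 3 → Subgroup N} (hA : ∀ i, A i ≤ T.L) :
    Nat.card (T.box A) = Nat.card (A 0) * Nat.card (A 1) * Nat.card (A 2) := by
  let f : T.box A ≃ ((i : Fin 3) → A i) :=
    { toFun := fun m i => ⟨co m.1 i, m.2.2 i⟩
      invFun := fun a => ⟨T.tri (fun i => a i) 1 fun i j => by
        simp [hA i (a i).2, hA j (a j).2], rfl, fun i => (a i).2⟩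
      left_inv := fun m => Subtype.ext (M_ext (fun i => rfl) m.2.1.symm)
      right_inv := fun a => rfl }
  rw [Nat.card_congr f, Nat.card_pi, Fin.prod_univ_three]

theorem card_std (J b : Fin 3 → Bool) (i : Fin 3) :
    Nat.card (T.std J b i) = if J i then 8 else Nat.card T.R := by
  rw [std, card_conjSub]
  cases J i
  · rfl
  · exact T.card_Q

theorem card_lam {J b : Fin 3 → Bool} {i : Fin 3} (hi : J i = true) :
    Nat.card (T.lam J b) = (if J 0 then 8 else Nat.card T.R) * (if J 1 then 8 else Nat.card T.R) *
      (if J 2 then 8 else Nat.card T.R) := by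
  rw [lam_eq_box hi, card_box (std_le_L J b), card_std, card_std, card_std]

/-- With no quaternion factor nothing forces the coordinates into `L`; the element `(e, e, e)`
accounts for the additional factor two. -/
theorem card_lam_of_forall {J b : Fin 3 → Bool} (hJ : ∀ i, J i = false) :
    Nat.card (T.lam J b) = Nat.card T.R ^ 3 * 2 := by
  have hle := box_std_le_lam (T := T) J b
  rw [← Subgroup.card_mul_index ((T.box (T.std J b)).subgroupOf (T.lam J b)),
    Nat.card_congr (Subgroup.subgroupOfEquivOfLe hle).toEquiv, card_box (std_le_L J b),
    card_std, card_std, card_std]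
  simp only [hJ, Bool.false_eq_true, if_false]
  congr 1
  · ring
  · rw [Subgroup.index_eq_two_iff]
    set a : T.M := T.tri (fun _ => T.e) 1 fun _ _ => Iff.rfl with ha
    have ham : a ∈ T.lam J b := by
      refine ⟨rfl, fun i => ?_⟩
      simp only [hJ, Bool.false_eq_true, if_false]
      exact mem_normalizer_iff_conjSub.mpr T.conj_e_R
    have key : ∀ m ∈ T.lam J b, m ∈ T.box (T.std J b) ↔ co m 0 ∈ T.L := by
      intro m hm
      rw [← lam_inf_boxL]
      exact ⟨fun h => h.2.2 0, fun h => ⟨hm, hm.1, fun i => (co_iff m 0 i).mp h⟩⟩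
    refine ⟨⟨a, ham⟩, fun m => ?_⟩
    rw [Subgroup.mem_subgroupOf, Subgroup.mem_subgroupOf, key _ m.2, key _ (m * ⟨a, ham⟩).2]
    have h1 : co ((m * ⟨a, ham⟩ : T.lam J b) : T.M) 0 = co m.1 0 * T.e := rfl
    rw [h1, T.mul_mem_L_iff]
    have := T.e_notMem
    by_cases h : co m.1 0 ∈ T.L <;> simp [h, this]

end QuaternionData

/-! ### Groups without normal `2`-subgroups -/

/-- `G` has no nontrivial normal `2`-subgroup. -/
def TwoFree (G : Type*) [Group G] : Prop :=
  ∀ H : Subgroup G, H.Normal → IsPGroup 2 H → H = ⊥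

theorem TwoFree.pCore_eq {G : Type*} [Group G] (h : TwoFree G) : pCore 2 G = ⊥ :=
  le_bot_iff.mp (sSup_le fun H hH => (h H hH.1 hH.2).le)

theorem TwoFree.pCore_eq_of_equiv {G G' : Type*} [Group G] [Group G'] (h : TwoFree G')
    (e : G ≃* G') : pCore 2 G = ⊥ := by
  apply TwoFree.pCore_eq
  intro H hH hH2
  have h1 := h (H.map e.toMonoidHom) (hH.map _ e.surjective) (hH2.map _)
  exact (Subgroup.map_eq_bot_iff_of_injective H e.injective).mp h1

theorem twoFree_unit : TwoFree Unit := fun _ _ _ => Subsingleton.elim _ _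

-- A nontrivial element has cube one, or its product with a suitable conjugate is nontrivial with
-- cube one. Neither fits in a normal `2`-subgroup.
set_option maxRecDepth 20000 in
theorem twoFree_sym3 : TwoFree Sym3 := by
  intro H hH hH2
  rw [Subgroup.eq_bot_iff_forall]
  intro x hx
  by_contra hx1
  have h1 : ∀ x : Sym3, x ≠ 1 → x ^ 3 = 1 ∨ ∃ y : Sym3, (x * (y * x * y⁻¹)) ^ 3 = 1 ∧
    x * (y * x * y⁻¹) ≠ 1 := by decide
  rcases h1 x hx1 with h | ⟨y, h, hne⟩
  · exact hx1 (hH2.eq_one_of_pow_eq_one hx (by norm_num) h)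
  · exact hne (hH2.eq_one_of_pow_eq_one (mul_mem hx (hH.conj_mem x hx y)) (by norm_num) h)

theorem TwoFree.prod {G G' : Type*} [Group G] [Group G'] (h : TwoFree G) (h' : TwoFree G') :
    TwoFree (G × G') := by
  intro H hH hH2
  have h1 := h (H.map (MonoidHom.fst G G')) (hH.map _ Prod.fst_surjective) (hH2.map _)
  have h2 := h' (H.map (MonoidHom.snd G G')) (hH.map _ Prod.snd_surjective) (hH2.map _)
  rw [Subgroup.eq_bot_iff_forall] at h1 h2 ⊢
  intro x hx
  exact Prod.ext (h1 _ ⟨x, hx, rfl⟩) (h2 _ ⟨x, hx, rfl⟩)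

/-- A normal `2`-subgroup meets the base group trivially, because its coordinate projections there
are normal `2`-subgroups of `G`. It then commutes with the base group, whose centralizer lies in the
base group as `G` is nontrivial. -/
theorem TwoFree.permWreath {G : Type*} [Group G] [Nontrivial G] (h : TwoFree G) (n : ℕ) :
    TwoFree (PermWreath G n) := by
  intro H hH hH2
  have hbase : ∀ f : Fin n → G, (SemidirectProduct.inl f : PermWreath G n) ∈ H → f = 1 := by
    intro f hf
    funext i
    have h1 := h ((H.comap SemidirectProduct.inl).map (Pi.evalMonoidHom (fun _ => G) i))
      ((hH.comap _).map _ (Function.surjective_eval i))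
      ((hH2.comap_of_injective _ SemidirectProduct.inl_injective).map _)
    rw [Subgroup.eq_bot_iff_forall] at h1
    exact h1 _ ⟨f, hf, rfl⟩
  rw [Subgroup.eq_bot_iff_forall]
  intro y hy
  have hcomm : ∀ f : Fin n → G, y * SemidirectProduct.inl f = SemidirectProduct.inl f * y := by
    intro f
    have h1 : y * SemidirectProduct.inl f * y⁻¹ * SemidirectProduct.inl f⁻¹ ∈ H := by
      have := mul_mem hy (hH.conj_mem _ (inv_mem hy) (SemidirectProduct.inl f))
      simpa [mul_assoc] using this
    have h2 : ∃ g : Fin n → G,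
        y * SemidirectProduct.inl f * y⁻¹ * SemidirectProduct.inl f⁻¹ = SemidirectProduct.inl g := by
      have h3 : y * SemidirectProduct.inl f * y⁻¹ * SemidirectProduct.inl f⁻¹ ∈
          (SemidirectProduct.inl : _ →* PermWreath G n).range := by
        rw [SemidirectProduct.range_inl_eq_ker_rightHom, MonoidHom.mem_ker]
        simp
      obtain ⟨g, hg⟩ := h3
      exact ⟨g, hg.symm⟩
    obtain ⟨g, hg⟩ := h2
    rw [hg] at h1
    rw [hbase g h1, map_one, map_inv] at hg
    rw [mul_inv_eq_one, mul_inv_eq_iff_eq_mul] at hg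
    exact hg
  -- If `y` moved `i`, commuting with an element of the base group supported at `i` would make that
  -- element trivial.
  have hr : y.right = 1 := by
    ext i : 1
    by_contra hi
    obtain ⟨g, hg⟩ := exists_ne (1 : G)
    have h1 := congrFun (congrArg SemidirectProduct.left (hcomm (Pi.mulSingle i g))) (y.right i)
    have h2 : y.left (y.right i) * (Pi.mulSingle (M := fun _ => G) i g) (y.right⁻¹ (y.right i)) =
      (Pi.mulSingle (M := fun _ => G) i g) (y.right i) * y.left (y.right i) := h1
    rw [show y.right⁻¹ (y.right i) = i from y.right.symm_apply_apply i, Pi.mulSingle_eq_same,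
      Pi.mulSingle_eq_of_ne (by simpa using hi), one_mul, mul_eq_left] at h2
    exact hg h2
  have h1 : y = SemidirectProduct.inl y.left := SemidirectProduct.ext rfl hr
  rw [h1] at hy ⊢
  rw [hbase _ hy, map_one]

end

section

/-! ### Generalized quaternion groups inside the normalizer of a torus -/

/-- A group `N` with a normal subgroup `L` of index at most two and an abelian subgroup `T` (a
torus) inverted by `y`, together with an element `x` generating the `2`-torsion of `T ∩ L`. -/
structure TorusData (N : Type*) [Group N] where
  l : ℕ
  l_pos : 0 < l
  L : Subgroup N
  T : Subgroup N
  x : N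
  y : N
  e : N
  ε : N
  h : N
  normal_L : L.Normal
  mul_inv_mem : ∀ g h, g ∉ L → h ∉ L → g * h⁻¹ ∈ L
  e_notMem : e ∉ L
  e_mul_e : e * e = ε
  e_mul_x : e * x = x⁻¹ * e
  e_mul_y : e * y = x * y * e
  not_dvd : ¬ 2 ^ (l + 4) ∣ Nat.card L
  comm_T : ∀ s ∈ T, ∀ t ∈ T, s * t = t * s
  mem_T_of_comm : ∀ g, ∀ t ∈ T, t * t ≠ 1 → g * t = t * g → g ∈ T
  eq_or_of_conj : ∀ g, ∀ s ∈ T, ∀ t ∈ T, g * s = t * g → t = s ∨ t = s⁻¹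
  y_mul : ∀ t ∈ T, y * t = t⁻¹ * y
  sq_T : ∀ t ∈ T, t * t = 1 → t = 1 ∨ t = ε
  x_mem_T : x ∈ T
  x_mem_L : x ∈ L
  y_mem_L : y ∈ L
  y_mul_y : y * y = ε
  ε_comm : ∀ g, ε * g = g * ε
  orderOf_x : orderOf x = 2 ^ (l + 2)
  x_pow : x ^ 2 ^ (l + 1) = ε
  mem_zpowers_x : ∀ t ∈ T, t ∈ L → ∀ m : ℕ, t ^ 2 ^ m = 1 → t ∈ Subgroup.zpowers x
  h_mem_L : h ∈ L
  h_mul_i : h * x ^ 2 ^ l = y * h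
  h_mul_y : h * y = x ^ 2 ^ l * y * h

namespace TorusData

variable {N : Type*} [Group N] (T : TorusData N)

/-- The element `x ^ 2 ^ l` of order four. -/
def i : N := T.x ^ 2 ^ T.l

theorem i_mem_zpowers : T.i ∈ Subgroup.zpowers T.x := pow_mem (Subgroup.mem_zpowers _) _

theorem zpowers_x_le : Subgroup.zpowers T.x ≤ T.T := by simpa using T.x_mem_T

theorem i_mem_T : T.i ∈ T.T := T.zpowers_x_le T.i_mem_zpowers

theorem i_mul_i : T.i * T.i = T.ε := by
  rw [i, ← T.x_pow, ← pow_add]; congr 1; ring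

theorem ε_ne_one : T.ε ≠ 1 := by
  rw [← T.x_pow]
  refine pow_ne_one_of_lt_orderOf (by positivity) ?_
  rw [T.orderOf_x]
  exact Nat.pow_lt_pow_right (by norm_num) (by omega)

theorem ε_mul_ε : T.ε * T.ε = 1 := by
  rw [← T.x_pow, ← pow_add, ← pow_orderOf_eq_one T.x, T.orderOf_x]; congr 1; ring

theorem ε_mem_zpowers_i : T.ε ∈ Subgroup.zpowers T.i := by
  rw [← i_mul_i]; exact mul_mem (Subgroup.mem_zpowers _) (Subgroup.mem_zpowers _)

theorem ε_mem_T : T.ε ∈ T.T := by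
  rw [← i_mul_i]; exact mul_mem T.i_mem_T T.i_mem_T

theorem i_inv : T.i⁻¹ = T.ε * T.i :=
  inv_eq_of_mul_eq_one_left (by rw [mul_assoc, T.i_mul_i, T.ε_mul_ε])

theorem x_sq_ne : T.x * T.x ≠ 1 := by
  rw [← pow_two]
  refine pow_ne_one_of_lt_orderOf (by positivity) ?_
  rw [T.orderOf_x, pow_add]
  have : 0 < 2 ^ T.l := by positivity
  omega

/-- The order of `x` is at least eight because `l > 0`. This separates `x` from the elements of `R`
outside the torus, which all square to `ε`. -/
theorem x_sq_ne_ε : T.x * T.x ≠ T.ε := by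
  intro h
  have h1 : T.x ^ 4 = 1 := by
    rw [← T.ε_mul_ε, ← h, pow_succ, pow_succ, pow_succ, pow_one, mul_assoc (T.x * T.x)]
  refine pow_ne_one_of_lt_orderOf (by norm_num) ?_ h1
  rw [T.orderOf_x]
  calc 4 < 2 ^ (1 + 2) := by norm_num
    _ ≤ _ := Nat.pow_le_pow_right (by norm_num) (by have := T.l_pos; omega)

theorem orderOf_i : orderOf T.i = 4 := by
  rw [i, orderOf_pow_of_dvd (by positivity) (by rw [T.orderOf_x]; exact pow_dvd_pow _ (by omega)),
    T.orderOf_x, pow_add]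
  simp

theorem y_notMem : T.y ∉ T.T := by
  intro h
  apply T.x_sq_ne
  have h1 := T.y_mul T.x T.x_mem_T
  rw [T.comm_T _ h _ T.x_mem_T] at h1
  have := mul_right_cancel h1
  nth_rewrite 1 [this]
  simp

/-- The elements `t y` with `t` in the torus. -/
def IsOuter (w : N) : Prop := w * T.y ∈ T.T

theorem isOuter_y : T.IsOuter T.y := by rw [IsOuter, T.y_mul_y]; exact T.ε_mem_T

variable {T}

theorem IsOuter.eq {w : N} (hw : T.IsOuter w) : ∃ t ∈ T.T, w = t * T.y := by
  refine ⟨w * T.y * T.ε, mul_mem hw T.ε_mem_T, ?_⟩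
  rw [mul_assoc, T.ε_comm, mul_assoc w, ← mul_assoc T.y, T.y_mul_y, T.ε_mul_ε, mul_one]

theorem isOuter_mul {t : N} (ht : t ∈ T.T) {w : N} (hw : T.IsOuter w) : T.IsOuter (t * w) := by
  rw [IsOuter, mul_assoc]; exact mul_mem ht hw

theorem IsOuter.mul_eq {w : N} (hw : T.IsOuter w) {t : N} (ht : t ∈ T.T) : w * t = t⁻¹ * w := by
  obtain ⟨s, hs, rfl⟩ := hw.eq
  rw [mul_assoc, T.y_mul t ht, ← mul_assoc, T.comm_T s hs _ (inv_mem ht), mul_assoc]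

theorem IsOuter.mul_self {w : N} (hw : T.IsOuter w) : w * w = T.ε := by
  obtain ⟨s, hs, rfl⟩ := hw.eq
  rw [mul_assoc, ← mul_assoc T.y, T.y_mul s hs, mul_assoc, T.y_mul_y, mul_inv_cancel_left]

theorem IsOuter.notMem {w : N} (hw : T.IsOuter w) : w ∉ T.T := by
  intro h
  obtain ⟨s, hs, rfl⟩ := hw.eq
  exact T.y_notMem ((mul_mem_cancel_left hs).1 h)

theorem IsOuter.mul_mem_T {w v : N} (hw : T.IsOuter w) (hv : T.IsOuter v) : w * v ∈ T.T := by
  obtain ⟨s, hs, rfl⟩ := hw.eq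
  obtain ⟨t, ht, rfl⟩ := hv.eq
  rw [mul_assoc, ← mul_assoc T.y, T.y_mul t ht, mul_assoc, T.y_mul_y]
  exact mul_mem hs (mul_mem (inv_mem ht) T.ε_mem_T)

variable (T)

/-- The group `C ∪ C w`, for a subgroup `C` of the torus and an element `w` inverting it. -/
def dih (C : Subgroup N) (w : N) (hC : C ≤ T.T) (hε : T.ε ∈ C) (hw : T.IsOuter w) :
    Subgroup N where
  carrier := {g | g ∈ C ∨ g * w ∈ C}
  one_mem' := Or.inl (one_mem _)
  mul_mem' := by
    have key : ∀ b, b * w ∈ C → ∃ t ∈ C, b = t * w := by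
      intro b hb
      refine ⟨b * w * T.ε, mul_mem hb hε, ?_⟩
      rw [mul_assoc, T.ε_comm, mul_assoc b, ← mul_assoc w, hw.mul_self, T.ε_mul_ε, mul_one]
    rintro a b (ha | ha) (hb | hb)
    · exact Or.inl (mul_mem ha hb)
    · exact Or.inr (by rw [mul_assoc]; exact mul_mem ha hb)
    · right
      obtain ⟨t, ht, rfl⟩ := key a ha
      rw [mul_assoc t, hw.mul_eq (hC hb), mul_assoc, mul_assoc, hw.mul_self]
      exact mul_mem ht (mul_mem (inv_mem hb) hε)
    · left
      obtain ⟨t, ht, rfl⟩ := key a ha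
      obtain ⟨s, hs, rfl⟩ := key b hb
      rw [mul_assoc t, ← mul_assoc w, hw.mul_eq (hC hs), mul_assoc, hw.mul_self]
      exact mul_mem ht (mul_mem (inv_mem hs) hε)
  inv_mem' := by
    rintro a (ha | ha)
    · exact Or.inl (inv_mem ha)
    · right
      have h2 : T.IsOuter a := by
        have h3 : a = a * w * T.ε * w := by
          rw [mul_assoc, T.ε_comm, mul_assoc a, ← mul_assoc w, hw.mul_self, T.ε_mul_ε, mul_one]
        rw [h3]
        exact isOuter_mul (mul_mem (hC ha) T.ε_mem_T) hw
      have h3 : a⁻¹ = T.ε * a := by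
        refine inv_eq_of_mul_eq_one_left ?_
        rw [mul_assoc, h2.mul_self, T.ε_mul_ε]
      change a⁻¹ * w ∈ C
      rw [h3, mul_assoc]
      exact mul_mem hε ha

variable {T}

theorem mem_dih {C : Subgroup N} {w : N} {hC : C ≤ T.T} {hε : T.ε ∈ C} {hw : T.IsOuter w} {g : N} :
    g ∈ T.dih C w hC hε hw ↔ g ∈ C ∨ g * w ∈ C := Iff.rfl

theorem mem_dih' {C : Subgroup N} {w : N} {hC : C ≤ T.T} {hε : T.ε ∈ C} {hw : T.IsOuter w} {g : N} :
    g ∈ T.dih C w hC hε hw ↔ g ∈ C ∨ ∃ t ∈ C, g = t * w := by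
  rw [mem_dih]
  refine or_congr_right ⟨fun hb => ⟨g * w * T.ε, mul_mem hb hε, ?_⟩, ?_⟩
  · rw [mul_assoc, T.ε_comm, mul_assoc g, ← mul_assoc w, hw.mul_self, T.ε_mul_ε, mul_one]
  · rintro ⟨t, ht, rfl⟩
    rw [mul_assoc, hw.mul_self]
    exact mul_mem ht hε

theorem isOuter_of_mem_dih {C : Subgroup N} {w : N} {hC : C ≤ T.T} {hε : T.ε ∈ C}
    {hw : T.IsOuter w} {g : N} (hg : g ∈ T.dih C w hC hε hw) (hgT : g ∉ T.T) : T.IsOuter g := by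
  rcases mem_dih'.1 hg with h | ⟨t, ht, rfl⟩
  · exact absurd (hC h) hgT
  · exact isOuter_mul (hC ht) hw

theorem mem_of_mem_dih {C : Subgroup N} {w : N} {hC : C ≤ T.T} {hε : T.ε ∈ C}
    {hw : T.IsOuter w} {g : N} (hg : g ∈ T.dih C w hC hε hw) (hgT : g ∈ T.T) : g ∈ C := by
  rcases mem_dih'.1 hg with h | ⟨t, ht, rfl⟩
  · exact h
  · exact absurd ((mul_mem_cancel_left (hC ht)).1 hgT) hw.notMem

theorem closure_eq_dih {a w : N} (ha : a ∈ T.T) (hε : T.ε ∈ Subgroup.zpowers a)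
    (hw : T.IsOuter w) :
    Subgroup.closure {a, w} = T.dih (Subgroup.zpowers a) w (by simpa using ha) hε hw := by
  apply le_antisymm
  · rw [Subgroup.closure_le]
    rintro _ (rfl | rfl)
    · exact Or.inl (Subgroup.mem_zpowers _)
    · refine Or.inr ?_
      rw [hw.mul_self]; exact hε
  · have h1 : Subgroup.zpowers a ≤ Subgroup.closure {a, w} := by
      rw [Subgroup.zpowers_le]; exact Subgroup.subset_closure (by simp)
    intro g hg
    rcases mem_dih'.1 hg with h | ⟨t, ht, rfl⟩
    · exact h1 h
    · exact mul_mem (h1 ht) (Subgroup.subset_closure (by simp))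

theorem card_dih {C : Subgroup N} {w : N} {hC : C ≤ T.T} {hε : T.ε ∈ C} {hw : T.IsOuter w} :
    Nat.card (T.dih C w hC hε hw) = 2 * Nat.card C := by
  have hle : C ≤ T.dih C w hC hε hw := fun g hg => Or.inl hg
  have h1 : C.relIndex (T.dih C w hC hε hw) = 2 := by
    rw [Subgroup.relIndex, Subgroup.index_eq_two_iff]
    refine ⟨⟨w, mem_dih'.2 (Or.inr ⟨1, one_mem _, by simp⟩)⟩, fun b => ?_⟩
    simp only [Subgroup.mem_subgroupOf, Subgroup.coe_mul]
    rcases mem_dih'.1 b.2 with h | ⟨t, ht, h⟩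
    · refine Or.inr ⟨h, fun h2 => ?_⟩
      exact hw.notMem ((mul_mem_cancel_left (hC h)).1 (hC h2))
    · refine Or.inl ⟨b.2.resolve_left ?_, ?_⟩
      · intro h2
        rw [h] at h2
        exact hw.notMem ((mul_mem_cancel_left (hC ht)).1 (hC h2))
      · intro h2
        rw [h] at h2
        exact hw.notMem ((mul_mem_cancel_left (hC ht)).1 (hC h2))
  rw [← h1, ← Subgroup.relIndex_bot_left, ← Subgroup.relIndex_bot_left, mul_comm]
  exact (Subgroup.relIndex_mul_relIndex _ _ _ bot_le hle).symm

variable (T)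

/-- The generalized quaternion group generated by `x` and `y`. -/
def R : Subgroup N := T.dih (Subgroup.zpowers T.x) T.y T.zpowers_x_le
  (by rw [← T.x_pow]; exact pow_mem (Subgroup.mem_zpowers _) _) T.isOuter_y

/-- The quaternion group generated by `i` and `y`. -/
def Q : Subgroup N := T.dih (Subgroup.zpowers T.i) T.y (by simpa using T.i_mem_T)
  T.ε_mem_zpowers_i T.isOuter_y

theorem R_eq_closure : T.R = Subgroup.closure {T.x, T.y} :=
  (closure_eq_dih T.x_mem_T _ T.isOuter_y).symm

theorem Q_eq_closure : T.Q = Subgroup.closure {T.i, T.y} :=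
  (closure_eq_dih T.i_mem_T _ T.isOuter_y).symm

theorem card_R : Nat.card T.R = 2 ^ (T.l + 3) := by
  rw [R, card_dih, Nat.card_zpowers, T.orderOf_x]; ring

theorem card_Q : Nat.card T.Q = 8 := by
  rw [Q, card_dih, Nat.card_zpowers, T.orderOf_i]

theorem isPGroup_R : IsPGroup 2 T.R := IsPGroup.of_card T.card_R

theorem conjSub_closure (g : N) (s : Set N) :
    conjSub g (Subgroup.closure s) = Subgroup.closure ((fun a => g * a * g⁻¹) '' s) := by
  rw [conjSub_eq_map, MonoidHom.map_closure]
  rfl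

theorem e_conj_x : T.e * T.x * T.e⁻¹ = T.x⁻¹ := by rw [T.e_mul_x]; group

theorem e_conj_y : T.e * T.y * T.e⁻¹ = T.x * T.y := by rw [T.e_mul_y]; group

theorem e_conj_i : T.e * T.i * T.e⁻¹ = T.i⁻¹ := by
  rw [i, ← conj_pow, T.e_conj_x, inv_pow]

theorem conj_e_R : conjSub T.e T.R = T.R := by
  rw [R_eq_closure, conjSub_closure, Set.image_pair, T.e_conj_x, T.e_conj_y]
  have hx : T.x ∈ Subgroup.closure {T.x, T.y} := Subgroup.subset_closure (by simp)
  have hx' : T.x⁻¹ ∈ Subgroup.closure {T.x⁻¹, T.x * T.y} := Subgroup.subset_closure (by simp)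
  apply le_antisymm <;> rw [Subgroup.closure_le]
  · rintro _ (rfl | rfl)
    · exact inv_mem hx
    · exact mul_mem hx (Subgroup.subset_closure (by simp))
  · rintro _ (rfl | rfl)
    · exact inv_mem_iff.1 hx'
    · have := mul_mem hx' (Subgroup.subset_closure (by simp) :
        T.x * T.y ∈ Subgroup.closure {T.x⁻¹, T.x * T.y})
      rwa [inv_mul_cancel_left] at this

theorem conj_e_Q : conjSub T.e T.Q = Subgroup.closure {T.i, T.x * T.y} := by
  rw [Q_eq_closure, conjSub_closure, Set.image_pair, T.e_conj_i, T.e_conj_y]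
  have hx : T.i ∈ Subgroup.closure {T.i, T.x * T.y} := Subgroup.subset_closure (by simp)
  have hx' : T.i⁻¹ ∈ Subgroup.closure {T.i⁻¹, T.x * T.y} := Subgroup.subset_closure (by simp)
  apply le_antisymm <;> rw [Subgroup.closure_le]
  · rintro _ (rfl | rfl)
    · exact inv_mem hx
    · exact Subgroup.subset_closure (by simp)
  · rintro _ (rfl | rfl)
    · exact inv_mem_iff.1 hx'
    · exact Subgroup.subset_closure (by simp)

theorem R_le : T.R ≤ T.L := by
  rw [R_eq_closure, Subgroup.closure_le]
  rintro _ (rfl | rfl)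
  exacts [T.x_mem_L, T.y_mem_L]

theorem Q_le : T.Q ≤ T.R := by
  rw [R_eq_closure, Q_eq_closure, Subgroup.closure_le]
  rintro _ (rfl | rfl)
  · exact pow_mem (Subgroup.subset_closure (by simp)) _
  · exact Subgroup.subset_closure (by simp)

theorem y_mem_Q : T.y ∈ T.Q := by
  rw [Q_eq_closure]; exact Subgroup.subset_closure (by simp)

theorem i_mem_Q : T.i ∈ T.Q := by
  rw [Q_eq_closure]; exact Subgroup.subset_closure (by simp)

/-- Commuting with `i` puts `g` into the torus, which `y` inverts; commuting with `y` then gives `g²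
= 1`. -/
theorem eq_of_comm (g : N) (hi : g * T.i = T.i * g) (hy : g * T.y = T.y * g) :
    g = 1 ∨ g = T.ε := by
  have h1 : g ∈ T.T := T.mem_T_of_comm g _ T.i_mem_T (by rw [T.i_mul_i]; exact T.ε_ne_one) hi
  refine T.sq_T g h1 ?_
  rw [T.y_mul g h1] at hy
  have := mul_right_cancel hy
  nth_rewrite 1 [this]
  simp

/-- The order `2^(l+3)` of `R` is the largest power of two that can divide the order of `L`. -/
theorem relIndex_R : ¬ 2 ∣ T.R.relIndex T.L := by
  intro h
  apply T.not_dvd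
  rw [← Subgroup.relIndex_bot_left, ← Subgroup.relIndex_mul_relIndex _ _ _ bot_le T.R_le,
    Subgroup.relIndex_bot_left, T.card_R, show 2 ^ (T.l + 4) = 2 ^ (T.l + 3) * 2 by ring]
  exact mul_dvd_mul_left _ h

/-- Here `g` lies in the torus, and `g y g⁻¹ = g² y` forces `g² ∈ ⟨x⟩`. So `g` is a `2`-element of
the torus in `L`, and these are the powers of `x`. -/
theorem mem_R_of_comm_x {g : N} (hL : g ∈ T.L) (hR : conjSub g T.R = T.R)
    (hg : g * T.x = T.x * g) : g ∈ T.R := by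
  have h1 : g ∈ T.T := T.mem_T_of_comm g _ T.x_mem_T T.x_sq_ne hg
  have hy : T.y ∈ T.R := T.Q_le T.y_mem_Q
  have h2 : g * T.y * g⁻¹ ∈ T.R := (conjSub_eq_iff.1 hR _).1 hy
  have h3 : g * T.y * g⁻¹ = g * g * T.y := by
    rw [mul_assoc, T.y_mul _ (inv_mem h1), inv_inv, mul_assoc]
  rw [h3, mul_mem_cancel_right hy] at h2
  have h4 := mem_of_mem_dih h2 (mul_mem h1 h1)
  have h5 : (g * g) ^ 2 ^ (T.l + 2) = 1 := by
    rw [← T.orderOf_x]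
    exact orderOf_dvd_iff_pow_eq_one.1 (orderOf_dvd_of_mem_zpowers h4)
  refine Or.inl (T.mem_zpowers_x g h1 hL (T.l + 3) ?_)
  rw [← h5, ← pow_two, ← pow_mul]
  congr 1; ring

/-- Elements of `R` outside the torus square to `ε`, while `x² ≠ ε`; so `g x g⁻¹` stays in the torus
and equals `x` or `x⁻¹`. In the second case `y g` commutes with `x`. -/
theorem mem_R_of_conj (g : N) (hL : g ∈ T.L) (hR : conjSub g T.R = T.R) : g ∈ T.R := by
  have hy : T.y ∈ T.R := T.Q_le T.y_mem_Q
  have hx : T.x ∈ T.R := Or.inl (Subgroup.mem_zpowers _)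
  have h2 : g * T.x * g⁻¹ ∈ T.R := (conjSub_eq_iff.1 hR _).1 hx
  by_cases h3 : g * T.x * g⁻¹ ∈ T.T
  · rcases T.eq_or_of_conj g _ T.x_mem_T _ h3 (by group) with h4 | h4
    · exact T.mem_R_of_comm_x hL hR (mul_inv_eq_iff_eq_mul.1 h4)
    · have h5 : T.y * g ∈ T.R := by
        refine T.mem_R_of_comm_x (mul_mem T.y_mem_L hL) ?_ ?_
        · rw [conjSub_mul, hR, conjSub_eq_self_of_mem hy]
        · rw [mul_inv_eq_iff_eq_mul] at h4
          rw [mul_assoc, h4, ← mul_assoc, T.y_mul _ (inv_mem T.x_mem_T), inv_inv, mul_assoc]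
      exact (mul_mem_cancel_left hy).1 h5
  · exfalso
    have h4 := (isOuter_of_mem_dih h2 h3).mul_self
    apply T.x_sq_ne_ε
    have h5 : g * T.x * g⁻¹ * (g * T.x * g⁻¹) = g * (T.x * T.x) * g⁻¹ := by group
    rw [h5, mul_inv_eq_iff_eq_mul, T.ε_comm] at h4
    exact mul_left_cancel h4

/-- An element of odd order is a power of its square. -/
theorem comm_of_sq_comm {h a : N} (hh : Odd (orderOf h)) (hc : h * h * a = a * (h * h)) :
    h * a = a * h := by
  have h1 : h ∈ Subgroup.zpowers (h * h) := by
    obtain ⟨m, hm⟩ := hh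
    have h2 : (h * h) ^ (m + 1) = h := by
      have := pow_orderOf_eq_one h
      rw [hm] at this
      calc (h * h) ^ (m + 1) = h ^ (2 * m + 1) * h := by rw [← pow_two, ← pow_mul]; group
        _ = h := by rw [this, one_mul]
    exact ⟨(m + 1 : ℕ), by simpa only [zpow_natCast] using h2⟩
  obtain ⟨m, hm⟩ := h1
  have h3 : Commute (h * h) a := hc
  have h4 := h3.zpow_left m
  simp only at hm
  rw [hm] at h4
  exact h4

theorem conj_eq_dih {u w : N} (hu : u * T.i * u⁻¹ = T.i ∨ u * T.i * u⁻¹ = T.i⁻¹)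
    (hw : T.IsOuter w) (huy : u * T.y * u⁻¹ = w) :
    conjSub u T.Q = T.dih (Subgroup.zpowers T.i) w (by simpa using T.i_mem_T)
      T.ε_mem_zpowers_i hw := by
  rw [← closure_eq_dih T.i_mem_T, Q_eq_closure, conjSub_closure, Set.image_pair, huy]
  have hx : T.i ∈ Subgroup.closure {T.i, w} := Subgroup.subset_closure (by simp)
  have hx' : u * T.i * u⁻¹ ∈ Subgroup.closure {u * T.i * u⁻¹, w} :=
    Subgroup.subset_closure (by simp)
  apply le_antisymm <;> rw [Subgroup.closure_le]
  · rintro _ (rfl | rfl)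
    · rcases hu with hu | hu <;> rw [hu]
      exacts [hx, inv_mem hx]
    · exact Subgroup.subset_closure (by simp)
  · rintro _ (rfl | rfl)
    · rcases hu with hu | hu
      · rwa [hu] at hx' ⊢
      · have := inv_mem hx'
        rw [hu] at this ⊢
        rwa [inv_inv] at this
    · exact Subgroup.subset_closure (by simp)

/-- Conjugation by a power of `x` changes the exponent in `xⁿ y` by an even number, and `e y e⁻¹ = x
y` supplies odd exponents. So the quaternion subgroups `⟨i, xⁿ y⟩` form one class under `N`. -/
theorem exists_conj_y {t : N} (ht : t ∈ Subgroup.zpowers T.x) :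
    ∃ u, (u * T.i * u⁻¹ = T.i ∨ u * T.i * u⁻¹ = T.i⁻¹) ∧ u * T.y * u⁻¹ = t * T.y := by
  obtain ⟨n, rfl⟩ := ht
  have hz : ∀ s : ℤ, T.x ^ s * T.y * (T.x ^ s)⁻¹ = T.x ^ (2 * s) * T.y := by
    intro s
    rw [mul_assoc, T.y_mul _ (inv_mem (zpow_mem T.x_mem_T s)), inv_inv, ← mul_assoc, ← zpow_add]
    congr 2; ring
  have hi : ∀ s : ℤ, T.x ^ s * T.i = T.i * T.x ^ s := fun s =>
    T.comm_T _ (zpow_mem T.x_mem_T s) _ T.i_mem_T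
  rcases Int.even_or_odd' n with ⟨s, rfl | rfl⟩
  · refine ⟨T.x ^ s, Or.inl ?_, hz s⟩
    rw [hi]; group
  · refine ⟨T.x ^ s * T.e, Or.inr ?_, ?_⟩
    · calc T.x ^ s * T.e * T.i * (T.x ^ s * T.e)⁻¹
          = T.x ^ s * (T.e * T.i * T.e⁻¹) * (T.x ^ s)⁻¹ := by group
        _ = T.i⁻¹ := by
          rw [T.e_conj_i, T.comm_T _ (zpow_mem T.x_mem_T s) _ (inv_mem T.i_mem_T)]; group
    · calc T.x ^ s * T.e * T.y * (T.x ^ s * T.e)⁻¹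
          = T.x ^ s * (T.e * T.y * T.e⁻¹) * (T.x ^ s)⁻¹ := by group
        _ = T.x * (T.x ^ s * T.y * (T.x ^ s)⁻¹) := by rw [T.e_conj_y]; group
        _ = T.x ^ (2 * s + 1) * T.y := by rw [hz]; group

theorem exists_eq_conj_Q (A : Subgroup N) (hA : A ≤ T.R) (h : N)
    (hodd : Odd (orderOf h)) (hh : conjSub h A = A) (hnc : ¬ ∀ a ∈ A, h * a = a * h) :
    ∃ u, A = conjSub u T.Q := by
  have hconj : ∀ a ∈ A, h * a * h⁻¹ ∈ A := fun a ha => (conjSub_eq_iff.1 hh a).1 ha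
  have hout : ∀ a ∈ A, a ∉ T.T → T.IsOuter a := fun a ha => isOuter_of_mem_dih (hA ha)
  -- an element whose conjugate under `h` is itself or its inverse commutes with `h`
  have hcomm : ∀ a ∈ A, a ∈ T.T → h * a * h⁻¹ ∈ T.T → h * a = a * h := by
    intro a ha haT haT'
    apply comm_of_sq_comm hodd
    rcases T.eq_or_of_conj h a haT _ haT' (by group) with h1 | h1 <;>
      rw [mul_inv_eq_iff_eq_mul] at h1
    · rw [mul_assoc, h1, ← mul_assoc, h1, mul_assoc]
    · have h2 : h * a⁻¹ = a * h := by
        rw [mul_inv_eq_iff_eq_mul, mul_assoc, h1, mul_inv_cancel_left]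
      rw [mul_assoc, h1, ← mul_assoc, h2, mul_assoc]
  have hsq : ∀ a ∈ A, a ∈ T.T → a * a ≠ T.ε → h * a * h⁻¹ ∈ T.T := by
    intro a ha haT hne
    by_contra hc
    have h1 := (hout _ (hconj a ha) hc).mul_self
    have h2 : h * a * h⁻¹ * (h * a * h⁻¹) = h * (a * a) * h⁻¹ := by group
    rw [h2, mul_inv_eq_iff_eq_mul, T.ε_comm] at h1
    exact hne (mul_left_cancel h1)
  by_cases hI : A ≤ T.T
  · exact absurd (fun a ha => hcomm a ha (hI ha) (hI (hconj a ha))) hnc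
  obtain ⟨w, hwA, hwT⟩ := SetLike.not_le_iff_exists.1 hI
  have hw := hout w hwA hwT
  have hεA : T.ε ∈ A := by rw [← hw.mul_self]; exact mul_mem hwA hwA
  -- A torus element of `A` whose square is neither `1` nor `ε` stays in the torus under `h` and so
  -- commutes with `h`, which puts `h` into the torus. Then `h w h⁻¹ = h² w` makes `h²` a
  -- `2`-element of odd order, hence trivial.
  by_cases h1 : ∃ a ∈ A, a ∈ T.T ∧ a * a ≠ 1 ∧ a * a ≠ T.ε
  · exfalso
    obtain ⟨a, haA, haT, ha1, haε⟩ := h1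
    have hhT : h ∈ T.T := T.mem_T_of_comm h a haT ha1 (hcomm a haA haT (hsq a haA haT haε))
    have h2 : h * w * h⁻¹ ∈ A := hconj w hwA
    have h3 : h * w * h⁻¹ = h * h * w := by
      rw [mul_assoc, hw.mul_eq (inv_mem hhT), inv_inv, mul_assoc]
    rw [h3, mul_mem_cancel_right hwA] at h2
    apply hnc
    intro b hb
    apply comm_of_sq_comm hodd
    have h4 : h * h = 1 := by
      refine IsPGroup.eq_one_of_pow_eq_one T.isPGroup_R (hA h2) (n := orderOf h)
        (Nat.coprime_two_right.2 hodd) ?_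
      rw [← pow_two, ← pow_mul, mul_comm, pow_mul, pow_orderOf_eq_one, one_pow]
    rw [h4, one_mul, mul_one]
  push Not at h1
  -- The only square roots of `ε` in the torus are `i` and `i⁻¹`. So `A` is either `⟨i, w⟩`, or
  -- cyclic of order four generated by `w`; in the latter case `h²`, and with it `h`, centralizes
  -- `A`.
  by_cases h2 : ∃ a ∈ A, a ∈ T.T ∧ a * a ≠ 1
  · obtain ⟨a, haA, haT, ha1⟩ := h2
    have haε := h1 a haA haT ha1
    have key : ∀ b ∈ T.T, b * b = T.ε → b = T.i ∨ b = T.i⁻¹ := by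
      intro b hb hbε
      have h3 : b * T.i * (b * T.i) = 1 := by
        have := T.comm_T _ T.i_mem_T b hb
        calc b * T.i * (b * T.i) = b * (T.i * b) * T.i := by group
          _ = (b * b) * (T.i * T.i) := by rw [this]; group
          _ = 1 := by rw [hbε, T.i_mul_i, T.ε_mul_ε]
      rcases T.sq_T _ (mul_mem hb T.i_mem_T) h3 with h4 | h4
      · exact Or.inr (eq_inv_of_mul_eq_one_left h4)
      · rw [← T.i_mul_i] at h4
        exact Or.inl (mul_right_cancel h4)
    have hiA : T.i ∈ A := by
      rcases key a haT haε with h3 | h3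
      · rwa [← h3]
      · rw [← inv_inv T.i, ← h3]; exact inv_mem haA
    have hA' : A = T.dih (Subgroup.zpowers T.i) w (by simpa using T.i_mem_T)
        T.ε_mem_zpowers_i hw := by
      have hTA : ∀ b ∈ A, b ∈ T.T → b ∈ Subgroup.zpowers T.i := by
        intro b hb hbT
        by_cases hb1 : b * b = 1
        · rcases T.sq_T b hbT hb1 with rfl | rfl
          exacts [one_mem _, T.ε_mem_zpowers_i]
        · rcases key b hbT (h1 b hb hbT hb1) with rfl | rfl
          exacts [Subgroup.mem_zpowers _, inv_mem (Subgroup.mem_zpowers _)]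
      apply le_antisymm
      · intro b hb
        by_cases hbT : b ∈ T.T
        · exact Or.inl (hTA b hb hbT)
        · exact Or.inr (hTA _ (mul_mem hb hwA) ((hout b hb hbT).mul_mem_T hw))
      · intro b hb
        have h3 : Subgroup.zpowers T.i ≤ A := by simpa using hiA
        rcases mem_dih'.1 hb with h4 | ⟨t, ht, rfl⟩
        · exact h3 h4
        · exact mul_mem (h3 ht) hwA
    rcases mem_dih'.1 (hA hwA) with h3 | ⟨t, ht, h3⟩
    · exact absurd (T.zpowers_x_le h3) hwT
    · obtain ⟨u, hu1, hu2⟩ := T.exists_conj_y ht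
      refine ⟨u, ?_⟩
      rw [hA', T.conj_eq_dih hu1 hw (hu2.trans h3.symm)]
  · exfalso
    push Not at h2
    have hTA : ∀ b ∈ A, b ∈ T.T → b = 1 ∨ b = T.ε := fun b hb hbT => T.sq_T b hbT (h2 b hb hbT)
    have hwA' : ∀ b ∈ A, b ∉ T.T → b = w ∨ b = T.ε * w := by
      intro b hb hbT
      rcases hTA _ (mul_mem hb hwA) ((hout b hb hbT).mul_mem_T hw) with h3 | h3
      · right
        have h4 : w⁻¹ = T.ε * w :=
          inv_eq_of_mul_eq_one_left (by rw [mul_assoc, hw.mul_self, T.ε_mul_ε])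
        rw [← h4]; exact eq_inv_of_mul_eq_one_left h3
      · left
        rw [← hw.mul_self] at h3
        exact mul_right_cancel h3
    have hhw : h * w = w * h := by
      have h3 : h * w * h⁻¹ ∉ T.T := by
        intro h4
        rcases hTA _ (hconj w hwA) h4 with h5 | h5
        · rw [mul_inv_eq_one] at h5
          have : w = 1 := by simpa using h5
          exact hwT (this ▸ one_mem _)
        · rw [mul_inv_eq_iff_eq_mul, T.ε_comm] at h5
          exact hwT (mul_left_cancel h5 ▸ T.ε_mem_T)
      apply comm_of_sq_comm hodd
      rcases hwA' _ (hconj w hwA) h3 with h4 | h4 <;> rw [mul_inv_eq_iff_eq_mul] at h4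
      · rw [mul_assoc, h4, ← mul_assoc, h4, mul_assoc]
      · calc h * h * w = h * (h * w) := by group
          _ = T.ε * h * w * h := by rw [h4, T.ε_comm h]; group
          _ = T.ε * (h * w) * h := by group
          _ = (T.ε * T.ε) * w * h * h := by rw [h4]; group
          _ = w * (h * h) := by rw [T.ε_mul_ε]; group
    apply hnc
    intro b hb
    by_cases hbT : b ∈ T.T
    · rcases hTA b hb hbT with rfl | rfl
      · simp
      · exact (T.ε_comm h).symm
    · rcases hwA' b hb hbT with rfl | rfl
      · exact hhw
      · rw [← mul_assoc, ← T.ε_comm, mul_assoc, hhw, mul_assoc]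

end TorusData

end

/-! ### The action of the normalizer of `Q` on the three axes -/

section

namespace TorusData

variable {N : Type*} [Group N] (T : TorusData N)

/-- The three elements of order four of `Q`, up to sign. -/
def axis : Fin 3 → N := ![T.i, T.y, T.i * T.y]

@[simp] theorem axis_zero : T.axis 0 = T.i := rfl
@[simp] theorem axis_one : T.axis 1 = T.y := rfl
@[simp] theorem axis_two : T.axis 2 = T.i * T.y := rfl

theorem isOuter_iy : T.IsOuter (T.i * T.y) := isOuter_mul T.i_mem_T T.isOuter_y

theorem axis_mul_self (a : Fin 3) : T.axis a * T.axis a = T.ε := by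
  fin_cases a
  exacts [T.i_mul_i, T.y_mul_y, T.isOuter_iy.mul_self]

theorem ε_mul_cancel (g : N) : T.ε * (T.ε * g) = g := by rw [← mul_assoc, T.ε_mul_ε, one_mul]

theorem i_ne_one : T.i ≠ 1 := by
  intro h
  have := T.i_mul_i
  rw [h, mul_one] at this
  exact T.ε_ne_one this.symm

theorem i_ne_ε : T.i ≠ T.ε := by
  intro h
  have := T.i_mul_i
  rw [h, T.ε_mul_ε] at this
  exact T.ε_ne_one this.symm

theorem i_mul_y : T.i * T.y = T.ε * (T.y * T.i) := by
  rw [T.y_mul _ T.i_mem_T, T.i_inv, mul_assoc, T.ε_mul_cancel]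

theorem eq_of_axis {a b : Fin 3} (h : T.axis a = T.axis b ∨ T.axis a = T.ε * T.axis b) :
    a = b := by
  have hy := T.isOuter_y.notMem
  have hiy := T.isOuter_iy.notMem
  have hi := T.i_mem_T
  have hε := T.ε_mem_T
  have h1 : T.y ≠ T.i * T.y := fun h => T.i_ne_one (by simpa using h.symm)
  have h2 : T.y ≠ T.ε * (T.i * T.y) := by
    intro h
    have h3 : T.ε * T.y = T.i * T.y := by
      nth_rewrite 1 [h]; exact T.ε_mul_cancel _
    exact T.i_ne_ε (mul_right_cancel h3).symm
  have h3 : T.i * T.y ≠ T.ε * T.y := fun h => T.i_ne_ε (mul_right_cancel h)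
  have hεi : T.ε * T.i ∈ T.T := mul_mem hε hi
  fin_cases a <;> fin_cases b <;> first | rfl | exfalso
  all_goals
    simp only [Fin.mk_zero, Fin.mk_one, Fin.reduceFinMk, axis_zero, axis_one, axis_two,
      Fin.isValue] at h
  · rcases h with h | h
    · exact hy (h ▸ hi)
    · exact hy ((mul_mem_cancel_left hε).1 (h ▸ hi))
  · rcases h with h | h
    · exact hiy (by rw [← h]; exact hi)
    · exact hiy ((mul_mem_cancel_left hε).1 (by rw [← h]; exact hi))
  · rcases h with h | h
    · exact hy (h ▸ hi)
    · exact hy (h ▸ hεi)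
  · exact h.elim h1 h2
  · rcases h with h | h
    · exact hiy (by rw [h]; exact hi)
    · exact hiy (by rw [h]; exact hεi)
  · exact h.elim (fun h => h1 h.symm) h3

theorem mem_zpowers_i {t : N} (ht : t ∈ Subgroup.zpowers T.i) :
    t = 1 ∨ t = T.ε ∨ t = T.i ∨ t = T.ε * T.i := by
  obtain ⟨n, rfl⟩ := ht
  have h4 : T.i ^ (4 : ℤ) = 1 := by
    have := pow_orderOf_eq_one T.i
    rw [T.orderOf_i] at this
    exact_mod_cast this
  have h2 : T.i ^ (2 : ℤ) = T.ε := by rw [← T.i_mul_i]; exact zpow_two _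
  have h3 : T.i ^ (3 : ℤ) = T.ε * T.i := by
    rw [← h2, ← zpow_add_one]; rfl
  have key : T.i ^ n = T.i ^ (n % 4) := by
    conv_lhs => rw [← Int.emod_add_mul_ediv n 4, zpow_add, zpow_mul, h4, one_zpow, mul_one]
  have hn := Int.emod_nonneg n (by norm_num : (4 : ℤ) ≠ 0)
  have hn' := Int.emod_lt_of_pos n (by norm_num : (0 : ℤ) < 4)
  simp only
  rw [key]
  generalize n % 4 = m at *
  interval_cases m
  · left; simp
  · right; right; left; simp
  · right; left; exact h2
  · right; right; right; exact h3

theorem mem_Q {g : N} (hg : g ∈ T.Q) :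
    g = 1 ∨ g = T.ε ∨ ∃ a, g = T.axis a ∨ g = T.ε * T.axis a := by
  rcases mem_dih'.1 hg with h | ⟨t, ht, rfl⟩
  · rcases T.mem_zpowers_i h with h | h | h | h
    · exact Or.inl h
    · exact Or.inr (Or.inl h)
    · exact Or.inr (Or.inr ⟨0, Or.inl h⟩)
    · exact Or.inr (Or.inr ⟨0, Or.inr h⟩)
  · right; right
    rcases T.mem_zpowers_i ht with rfl | rfl | rfl | rfl
    · exact ⟨1, Or.inl (one_mul _)⟩
    · exact ⟨1, Or.inr rfl⟩
    · exact ⟨2, Or.inl rfl⟩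
    · exact ⟨2, Or.inr (mul_assoc _ _ _)⟩

theorem axis_mem_Q (a : Fin 3) : T.axis a ∈ T.Q := by
  fin_cases a
  exacts [T.i_mem_Q, T.y_mem_Q, mul_mem T.i_mem_Q T.y_mem_Q]

/-- `g` carries the axis `a` to the axis `b`. -/
def Carries (g : N) (a b : Fin 3) : Prop :=
  g * T.axis a = T.axis b * g ∨ g * T.axis a = T.ε * (T.axis b * g)

variable {T}

theorem Carries.right_unique {g : N} {a b c : Fin 3} (h : T.Carries g a b) (h' : T.Carries g a c) :
    b = c := by
  apply T.eq_of_axis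
  rcases h with h | h <;> rcases h' with h' | h' <;> rw [h] at h'
  · exact Or.inl (mul_right_cancel h')
  · exact Or.inr (mul_right_cancel (by rwa [← mul_assoc] at h'))
  · right
    refine mul_right_cancel (b := g) ?_
    rw [mul_assoc, ← h', T.ε_mul_cancel]
  · exact Or.inl (mul_right_cancel (mul_left_cancel h'))

theorem Carries.left_unique {g : N} {a b c : Fin 3} (h : T.Carries g a c) (h' : T.Carries g b c) :
    a = b := by
  apply T.eq_of_axis
  rcases h with h | h <;> rcases h' with h' | h'
  · exact Or.inl (mul_left_cancel (h.trans h'.symm))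
  · right
    have h2 : g * (T.ε * T.axis b) = g * T.axis a := by
      rw [h, ← mul_assoc, ← T.ε_comm, mul_assoc, h', T.ε_mul_cancel]
    exact (mul_left_cancel h2).symm
  · right
    rw [← h', ← mul_assoc, T.ε_comm, mul_assoc] at h
    exact mul_left_cancel h
  · exact Or.inl (mul_left_cancel (h.trans h'.symm))

theorem Carries.mul {g h : N} {a b c : Fin 3} (hg : T.Carries g b c) (hh : T.Carries h a b) :
    T.Carries (g * h) a c := by
  have key : g * h * T.axis a = g * T.axis b * h ∨ g * h * T.axis a = T.ε * (g * T.axis b * h) := by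
    rcases hh with h1 | h1
    · left; rw [mul_assoc, h1, mul_assoc]
    · right; rw [mul_assoc, h1, ← mul_assoc, ← T.ε_comm]; simp only [mul_assoc]
  rcases key with h1 | h1 <;> rcases hg with h2 | h2 <;> rw [h2] at h1
  · left; rw [h1, mul_assoc]
  · right; rw [h1]; simp only [mul_assoc]
  · right; rw [h1]; simp only [mul_assoc]
  · left; rw [h1]; simp only [mul_assoc, T.ε_mul_cancel]

variable (T)

theorem exists_carries {g : N} (hg : conjSub g T.Q = T.Q) (a : Fin 3) : ∃ b, T.Carries g a b := by
  have h1 : g * T.axis a * g⁻¹ ∈ T.Q := (conjSub_eq_iff.1 hg _).1 (T.axis_mem_Q a)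
  rcases T.mem_Q h1 with h | h | ⟨b, h | h⟩ <;> rw [mul_inv_eq_iff_eq_mul] at h
  · exfalso
    have h2 : T.axis a = 1 := by simpa using h
    have h3 := T.axis_mul_self a
    rw [h2, mul_one] at h3
    exact T.ε_ne_one h3.symm
  · exfalso
    rw [T.ε_comm] at h
    have h3 := T.axis_mul_self a
    rw [mul_left_cancel h, T.ε_mul_ε] at h3
    exact T.ε_ne_one h3.symm
  · exact ⟨b, Or.inl h⟩
  · exact ⟨b, Or.inr (by rw [h, mul_assoc])⟩

theorem exists_perm {g : N} (hg : conjSub g T.Q = T.Q) : ∃ σ : Sym3, ∀ a, T.Carries g a (σ a) := by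
  choose f hf using T.exists_carries hg
  have hinj : Function.Injective f := by
    intro a b hab
    have := hf a
    rw [hab] at this
    exact this.left_unique (hf b)
  exact ⟨Equiv.ofBijective f (Finite.injective_iff_bijective.1 hinj), hf⟩

open Classical in
/-- The permutation of the axes induced by an element normalizing `Q`. -/
noncomputable def axisPerm (g : N) : Sym3 :=
  if h : ∃ σ : Sym3, ∀ a, T.Carries g a (σ a) then h.choose else 1

theorem axisPerm_eq {g : N} {σ : Sym3} (h : ∀ a, T.Carries g a (σ a)) : T.axisPerm g = σ := by
  have h' : ∃ σ : Sym3, ∀ a, T.Carries g a (σ a) := ⟨σ, h⟩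
  rw [axisPerm, dif_pos h']
  exact Equiv.ext fun a => (h'.choose_spec a).right_unique (h a)

theorem carries_axisPerm {g : N} (hg : conjSub g T.Q = T.Q) (a : Fin 3) :
    T.Carries g a (T.axisPerm g a) := by
  obtain ⟨σ, hσ⟩ := T.exists_perm hg
  rw [T.axisPerm_eq hσ]
  exact hσ a

theorem axisPerm_mul {g h : N} (hg : conjSub g T.Q = T.Q) (hh : conjSub h T.Q = T.Q) :
    T.axisPerm (g * h) = T.axisPerm g * T.axisPerm h :=
  T.axisPerm_eq fun a => (T.carries_axisPerm hg _).mul (T.carries_axisPerm hh a)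

/-- `Q / ⟨ε⟩` is abelian, so conjugation by elements of `Q` changes the axes at most by the sign
`ε`. -/
theorem carries_self_of_mem {g : N} (hg : g ∈ T.Q) (a : Fin 3) : T.Carries g a a := by
  have hi : T.Carries T.i a a := by
    fin_cases a
    · exact Or.inl rfl
    · exact Or.inr T.i_mul_y
    · right
      change T.i * (T.i * T.y) = T.ε * (T.i * T.y * T.i)
      rw [mul_assoc T.i, ← mul_assoc T.ε, T.ε_comm, mul_assoc T.i, ← T.i_mul_y]
  have hy : T.Carries T.y a a := by
    fin_cases a
    · right
      change T.y * T.i = T.ε * (T.i * T.y)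
      rw [T.i_mul_y, T.ε_mul_cancel]
    · exact Or.inl rfl
    · right
      change T.y * (T.i * T.y) = T.ε * (T.i * T.y * T.y)
      rw [← mul_assoc T.ε, ← mul_assoc T.ε, mul_assoc (T.ε * T.i), mul_assoc T.ε, T.i_mul_y]
      have e1 : T.i * (T.y * T.y) = T.y * T.y * T.i := by rw [T.y_mul_y, T.ε_comm]
      rw [e1, ← mul_assoc, ← T.ε_comm]
      simp only [mul_assoc]
  have h1 : T.Carries 1 a a := Or.inl (by simp)
  have hε : T.Carries T.ε a a := Or.inl (T.ε_comm _)
  rcases T.mem_Q hg with rfl | rfl | ⟨b, hb⟩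
  · exact h1
  · exact hε
  · have : T.Carries (T.axis b) a a := by
      fin_cases b
      exacts [hi, hy, hi.mul hy]
    rcases hb with rfl | rfl
    exacts [this, hε.mul this]

/-- An element fixing all axes acts on `i` and `y` by signs. Conjugation by one of `1`, `i`, `y`, `i
y` realizes each of the four patterns of signs, and the resulting product centralizes `Q`, so it is
`1` or `ε`. -/
theorem axisPerm_eq_one_iff {g : N} (hg : conjSub g T.Q = T.Q) : T.axisPerm g = 1 ↔ g ∈ T.Q := by
  refine ⟨fun h => ?_, fun h => T.axisPerm_eq (T.carries_self_of_mem h)⟩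
  have hc : ∀ a, T.Carries g a a := fun a => by
    have := T.carries_axisPerm hg a
    rwa [h] at this
  have hεQ : T.ε ∈ T.Q := by rw [← T.i_mul_i]; exact mul_mem T.i_mem_Q T.i_mem_Q
  have key : ∀ u ∈ T.Q, (u * g) * T.i = T.i * (u * g) → (u * g) * T.y = T.y * (u * g) →
      g ∈ T.Q := by
    intro u hu h1 h2
    rw [← mul_mem_cancel_left hu]
    rcases T.eq_of_comm _ h1 h2 with h | h <;> rw [h]
    exacts [one_mem _, hεQ]
  have hi := hc 0
  have hy := hc 1
  simp only [Carries, axis_zero, axis_one] at hi hy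
  have hiy := T.i_mul_y
  have hεr : ∀ a b : N, a * (T.ε * b) = T.ε * (a * b) := fun a b => by
    rw [← mul_assoc, ← T.ε_comm, mul_assoc]
  have hil : ∀ a, T.i * (T.y * a) = T.ε * (T.y * (T.i * a)) := fun a => by
    rw [← mul_assoc, hiy]; simp only [mul_assoc]
  rcases hi with hi | hi <;> rcases hy with hy | hy
  · exact key 1 (one_mem _) (by simpa using hi) (by simpa using hy)
  · refine key T.i T.i_mem_Q ?_ ?_
    · rw [mul_assoc, hi]
    · rw [mul_assoc, hy, hεr, hil, T.ε_mul_cancel]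
  · refine key T.y T.y_mem_Q ?_ ?_
    · rw [mul_assoc, hi, hεr, hil]
    · rw [mul_assoc, hy]
  · refine key (T.i * T.y) (mul_mem T.i_mem_Q T.y_mem_Q) ?_ ?_
    · simp only [mul_assoc]
      rw [hi, hεr, hεr, hil, T.ε_mul_cancel, hil, hεr, hil, hεr, T.ε_mul_cancel]
    · simp only [mul_assoc]
      rw [hy, hεr, hεr, hil, hil]
      simp only [T.ε_mul_cancel, hεr]

theorem conjSub_h_Q : conjSub T.h T.Q = T.Q := by
  have h1 : T.h * T.i * T.h⁻¹ = T.y := by rw [mul_inv_eq_iff_eq_mul]; exact T.h_mul_i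
  have h2 : T.h * T.y * T.h⁻¹ = T.i * T.y := by rw [mul_inv_eq_iff_eq_mul]; exact T.h_mul_y
  rw [Q_eq_closure, TorusData.conjSub_closure, Set.image_pair, h1, h2]
  have hy : T.y ∈ Subgroup.closure {T.y, T.i * T.y} := Subgroup.subset_closure (by simp)
  have hy' : T.y ∈ Subgroup.closure {T.i, T.y} := Subgroup.subset_closure (by simp)
  apply le_antisymm <;> rw [Subgroup.closure_le]
  · rintro _ (rfl | rfl)
    · exact hy'
    · exact mul_mem (Subgroup.subset_closure (by simp)) hy'
  · rintro _ (rfl | rfl)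
    · exact (mul_mem_cancel_right hy).1 (Subgroup.subset_closure (by simp))
    · exact hy

/-- A square root of `i`. -/
def r : N := T.x ^ 2 ^ (T.l - 1)

/-- This needs `l > 0`: for `l = 0` the subtraction in the exponent `l - 1` would be truncated. -/
theorem r_mul_r : T.r * T.r = T.i := by
  rw [r, i, ← pow_add]
  congr 1
  obtain ⟨n, hn⟩ := Nat.exists_eq_add_of_lt T.l_pos
  rw [hn]
  simp only [zero_add, Nat.add_sub_cancel]
  ring

theorem r_mem_T : T.r ∈ T.T := pow_mem T.x_mem_T _

theorem r_mul_y : T.r * T.y = T.i * T.y * T.r := by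
  have := T.y_mul _ T.r_mem_T
  rw [mul_assoc, this, ← T.r_mul_r]
  group

theorem conjSub_r_Q : conjSub T.r T.Q = T.Q := by
  have h1 : T.r * T.i * T.r⁻¹ = T.i := by
    rw [T.comm_T _ T.r_mem_T _ T.i_mem_T]; group
  have h2 : T.r * T.y * T.r⁻¹ = T.i * T.y := by rw [T.r_mul_y]; group
  rw [Q_eq_closure, TorusData.conjSub_closure, Set.image_pair, h1, h2]
  have hi : T.i ∈ Subgroup.closure {T.i, T.i * T.y} := Subgroup.subset_closure (by simp)
  have hi' : T.i ∈ Subgroup.closure {T.i, T.y} := Subgroup.subset_closure (by simp)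
  apply le_antisymm <;> rw [Subgroup.closure_le]
  · rintro _ (rfl | rfl)
    · exact hi'
    · exact mul_mem hi' (Subgroup.subset_closure (by simp))
  · rintro _ (rfl | rfl)
    · exact hi
    · exact (mul_mem_cancel_left hi).1 (Subgroup.subset_closure (by simp))

theorem axisPerm_h : T.axisPerm T.h = finRotate 3 := by
  apply T.axisPerm_eq
  intro a
  have h2 : T.h * (T.i * T.y) = T.ε * (T.i * T.h) ∨ T.h * (T.i * T.y) = T.i * T.h := by
    have : T.h * (T.i * T.y) = T.y * T.i * T.y * T.h := by
      have e1 : T.h * T.i = T.y * T.h := T.h_mul_i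
      have e2 : T.h * T.y = T.i * T.y * T.h := T.h_mul_y
      rw [← mul_assoc, e1, mul_assoc, e2]; simp only [mul_assoc]
    right
    rw [this, mul_assoc T.y]
    have : T.y * (T.i * T.y) = T.i := by
      rw [T.i_mul_y, ← mul_assoc, ← T.ε_comm, mul_assoc, ← mul_assoc T.y, T.y_mul_y,
        T.ε_mul_cancel]
    rw [this]
  fin_cases a
  · exact Or.inl T.h_mul_i
  · exact Or.inl T.h_mul_y
  · exact h2.symm

theorem axisPerm_r : T.axisPerm T.r = Equiv.swap 1 2 := by
  apply T.axisPerm_eq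
  intro a
  fin_cases a
  · exact Or.inl (T.comm_T _ T.r_mem_T _ T.i_mem_T)
  · exact Or.inl T.r_mul_y
  · right
    change T.r * (T.i * T.y) = T.ε * (T.y * T.r)
    rw [← mul_assoc, T.comm_T _ T.r_mem_T _ T.i_mem_T, mul_assoc, T.r_mul_y, mul_assoc T.i,
      ← mul_assoc T.i, T.i_mul_i]

/-- The three-cycle induced by `h` and the transposition induced by `r` generate `S₃`, and both
elements lie in `L`. -/
theorem axisPerm_surj (s : Sym3) : ∃ a ∈ T.L, conjSub a T.Q = T.Q ∧ T.axisPerm a = s := by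
  have hr : T.r ∈ T.L := pow_mem T.x_mem_L _
  have key : ∀ s : Sym3, ∃ m : Fin 3, ∃ n : Fin 2,
      s = finRotate 3 ^ (m : ℕ) * Equiv.swap 1 2 ^ (n : ℕ) := by decide
  have hpow : ∀ g, conjSub g T.Q = T.Q → ∀ n : ℕ, conjSub (g ^ n) T.Q = T.Q ∧
      T.axisPerm (g ^ n) = T.axisPerm g ^ n := by
    intro g hg n
    induction n with
    | zero => exact ⟨by simp [conjSub_one], by
        simp only [pow_zero]; exact (T.axisPerm_eq_one_iff (conjSub_one _)).2 (one_mem _)⟩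
    | succ n ih =>
      rw [pow_succ, pow_succ]
      exact ⟨by rw [conjSub_mul, hg, ih.1], by rw [T.axisPerm_mul ih.1 hg, ih.2]⟩
  obtain ⟨m, n, rfl⟩ := key s
  have h1 := hpow _ T.conjSub_h_Q m
  have h2 := hpow _ T.conjSub_r_Q n
  refine ⟨T.h ^ (m : ℕ) * T.r ^ (n : ℕ), mul_mem (pow_mem T.h_mem_L _) (pow_mem hr _), ?_, ?_⟩
  · rw [conjSub_mul, h2.1, h1.1]
  · rw [T.axisPerm_mul h1.1 h2.1, h1.2, h2.2, axisPerm_h, axisPerm_r]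

/-- The quaternion subgroups of `N`. -/
noncomputable def toQuaternionData : QuaternionData N where
  L := T.L
  R := T.R
  Q := T.Q
  ε := T.ε
  e := T.e
  θ := T.axisPerm
  normal_L := T.normal_L
  mul_inv_mem := T.mul_inv_mem
  e_notMem := T.e_notMem
  e_mul_e := T.e_mul_e
  ε_ne_one := T.ε_ne_one
  ε_mul_ε := T.ε_mul_ε
  ε_comm := T.ε_comm
  R_le := T.R_le
  Q_le := T.Q_le
  ε_mem := by rw [← T.i_mul_i]; exact mul_mem T.i_mem_Q T.i_mem_Q
  conj_e_R := T.conj_e_R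
  card_Q := T.card_Q
  card_R_gt := by
    rw [T.card_R, show 8 = 2 ^ 3 by norm_num]
    exact Nat.pow_lt_pow_right (by norm_num) (by have := T.l_pos; omega)
  isPGroup_R := T.isPGroup_R
  relIndex_R := T.relIndex_R
  eq_of_comm g hg := T.eq_of_comm g (hg _ T.i_mem_Q) (hg _ T.y_mem_Q)
  mem_R_of_conj := T.mem_R_of_conj
  θ_mul _ _ := T.axisPerm_mul
  θ_eq_one_iff _ := T.axisPerm_eq_one_iff
  θ_surj := T.axisPerm_surj
  exists_eq_conj_Q A hA h _ := T.exists_eq_conj_Q A hA h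

end TorusData

end

section

/-! ### The two-dimensional special linear groups -/

/-- The `2`-part of `5^(2^n) - 1` is `2^(n+2)`: squaring a number of the form `1 + 2^(n+2) · odd`
gives one of the form `1 + 2^(n+3) · odd`. -/
theorem exists_five_pow_eq (n : ℕ) : ∃ m, 5 ^ 2 ^ n = 1 + 2 ^ (n + 2) * (2 * m + 1) := by
  induction n with
  | zero => exact ⟨0, by norm_num⟩
  | succ n ih =>
    obtain ⟨m, hm⟩ := ih
    refine ⟨m + 2 ^ n * (2 * m + 1) ^ 2, ?_⟩
    rw [pow_succ 2 n, pow_mul, hm]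
    ring

open Matrix

theorem card_SL_two (k : Type*) [Field k] [Finite k] :
    Nat.card (SpecialLinearGroup (Fin 2) k) = Nat.card k * (Nat.card k ^ 2 - 1) := by
  classical
  have := Fintype.ofFinite k
  have hq : 1 < Nat.card k := Finite.one_lt_card
  have h1 := Matrix.card_GL_field (𝔽 := k) 2
  rw [← Nat.card_eq_fintype_card, Fin.prod_univ_two] at h1
  let d : GL (Fin 2) k →* kˣ := GeneralLinearGroup.det
  have hd : Function.Surjective d := GeneralLinearGroup.det_surjective
  have h2 : Nat.card (GL (Fin 2) k) = Nat.card d.ker * Nat.card kˣ := by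
    have := QuaternionData.card_comap_of_le_range d (V := ⊤) (by rw [MonoidHom.range_eq_top.2 hd])
    simpa using this
  have h3 : d.ker = (SpecialLinearGroup.toGL : SpecialLinearGroup (Fin 2) k →* _).range := by
    ext g
    constructor
    · intro hg
      refine ⟨⟨g.1, ?_⟩, Units.ext rfl⟩
      have := congrArg Units.val (MonoidHom.mem_ker.1 hg)
      simpa [d] using this
    · rintro ⟨g, rfl⟩
      rw [MonoidHom.mem_ker]
      apply Units.ext
      simp [d]
  have h4 : Nat.card d.ker = Nat.card (SpecialLinearGroup (Fin 2) k) := by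
    rw [h3]
    exact (Nat.card_congr
      (MonoidHom.ofInjective SpecialLinearGroup.toGL_injective).toEquiv).symm
  rw [h2, h4, Nat.card_units] at h1
  obtain ⟨n, hn⟩ := Nat.exists_eq_add_of_lt hq
  rw [hn] at h1 ⊢
  have e1 : (1 + n + 1) ^ 2 - 1 = (n + 1) * (n + 3) := by
    rw [Nat.sub_eq_iff_eq_add (Nat.one_le_pow _ _ (by omega))]; ring
  have e2 : (1 + n + 1) ^ 2 - (1 + n + 1) ^ 1 = (n + 2) * (n + 1) := by
    rw [Nat.sub_eq_iff_eq_add (Nat.pow_le_pow_right (by omega) (by norm_num))]; ring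
  simp only [Fin.val_zero, Fin.val_one, pow_zero, Fin.isValue] at h1
  rw [e1, e2, show 1 + n + 1 - 1 = n + 1 by omega] at h1
  rw [e1]
  apply Nat.eq_of_mul_eq_mul_right (Nat.succ_pos n)
  rw [Nat.succ_eq_add_one, h1]
  ring

namespace Matrix.SpecialLinearGroup

variable {F : Type*} [Field F]

theorem det_two (g : SpecialLinearGroup (Fin 2) F) : g 0 0 * g 1 1 - g 0 1 * g 1 0 = 1 := by
  rw [← Matrix.det_fin_two]; exact g.2

theorem ext_two {g h : SpecialLinearGroup (Fin 2) F} (h00 : g 0 0 = h 0 0) (h01 : g 0 1 = h 0 1)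
    (h10 : g 1 0 = h 1 0) (h11 : g 1 1 = h 1 1) : g = h := by
  ext i j
  fin_cases i <;> fin_cases j <;> assumption

theorem mul_apply_two (g h : SpecialLinearGroup (Fin 2) F) (i j : Fin 2) :
    (g * h) i j = g i 0 * h 0 j + g i 1 * h 1 j := by
  change (g.1 * h.1) i j = _
  rw [Matrix.mul_apply, Fin.sum_univ_two]

theorem inv_apply_two (g : SpecialLinearGroup (Fin 2) F) :
    g⁻¹ 0 0 = g 1 1 ∧ g⁻¹ 0 1 = - g 0 1 ∧ g⁻¹ 1 0 = - g 1 0 ∧ g⁻¹ 1 1 = g 0 0 := by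
  rw [SL2_inv_expl]
  exact ⟨rfl, rfl, rfl, rfl⟩

/-- The matrix with rows `(a, b)` and `(c, d)`. -/
def mkTwo (a b c d : F) (h : a * d - b * c = 1) : SpecialLinearGroup (Fin 2) F :=
  ⟨!![a, b; c, d], by rw [Matrix.det_fin_two_of, h]⟩

section

variable (a b c d : F) (h : a * d - b * c = 1)

@[simp] theorem mkTwo_zero_zero : mkTwo a b c d h 0 0 = a := rfl
@[simp] theorem mkTwo_zero_one : mkTwo a b c d h 0 1 = b := rfl
@[simp] theorem mkTwo_one_zero : mkTwo a b c d h 1 0 = c := rfl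
@[simp] theorem mkTwo_one_one : mkTwo a b c d h 1 1 = d := rfl

end

/-- The diagonal matrices of determinant one. -/
def diagTorus (F : Type*) [Field F] : Subgroup (SpecialLinearGroup (Fin 2) F) where
  carrier := {g | g 0 1 = 0 ∧ g 1 0 = 0}
  one_mem' := ⟨by simp, by simp⟩
  mul_mem' := by
    rintro a b ⟨ha, ha'⟩ ⟨hb, hb'⟩
    exact ⟨by rw [mul_apply_two, ha, hb]; ring, by rw [mul_apply_two, ha', hb']; ring⟩
  inv_mem' := by
    rintro a ⟨ha, ha'⟩
    have := inv_apply_two a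
    exact ⟨by rw [this.2.1, ha, neg_zero], by rw [this.2.2.1, ha', neg_zero]⟩

theorem diagTorus_mul {t : SpecialLinearGroup (Fin 2) F} (ht : t ∈ diagTorus F) :
    t 0 0 * t 1 1 = 1 := by
  have := det_two t
  rwa [ht.1, zero_mul, sub_zero] at this

theorem diagTorus_ext {s t : SpecialLinearGroup (Fin 2) F} (hs : s ∈ diagTorus F)
    (ht : t ∈ diagTorus F) (h : s 0 0 = t 0 0) : s = t := by
  refine ext_two h (by rw [hs.1, ht.1]) (by rw [hs.2, ht.2]) ?_
  have h1 := diagTorus_mul hs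
  have h2 := diagTorus_mul ht
  rw [h] at h1
  exact mul_left_cancel₀ (left_ne_zero_of_mul_eq_one h2) (h1.trans h2.symm)

theorem diagTorus_comm {s t : SpecialLinearGroup (Fin 2) F} (hs : s ∈ diagTorus F)
    (ht : t ∈ diagTorus F) : s * t = t * s := by
  refine diagTorus_ext (mul_mem hs ht) (mul_mem ht hs) ?_
  rw [mul_apply_two, mul_apply_two, hs.1, ht.1]; ring

/-- When `t² ≠ 1` the two diagonal entries of `t` differ, and only diagonal matrices commute with
it. -/
theorem mem_diagTorus_of_comm {g t : SpecialLinearGroup (Fin 2) F} (ht : t ∈ diagTorus F)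
    (h1 : t * t ≠ 1) (h : g * t = t * g) : g ∈ diagTorus F := by
  have h2 := diagTorus_mul ht
  have h3 : t 0 0 - t 1 1 ≠ 0 := by
    intro h4
    apply h1
    refine diagTorus_ext (mul_mem ht ht) (one_mem _) ?_
    rw [mul_apply_two, ht.1]
    simp only [coe_one, one_apply_eq]
    linear_combination h2 + t 0 0 * h4
  have e1 : (g * t) 0 1 = (t * g) 0 1 := by rw [h]
  have e2 : (g * t) 1 0 = (t * g) 1 0 := by rw [h]
  rw [mul_apply_two, mul_apply_two, ht.1] at e1
  rw [mul_apply_two, mul_apply_two, ht.2] at e2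
  constructor
  · refine (mul_eq_zero.1 ?_).resolve_right h3
    linear_combination -e1
  · refine (mul_eq_zero.1 ?_).resolve_right h3
    linear_combination e2

/-- One entry in the first row of `g` is nonzero; comparing that entry in `g s = t g` identifies the
first diagonal entry of `t` with one of those of `s`. -/
theorem eq_or_of_conj_diagTorus {g s t : SpecialLinearGroup (Fin 2) F} (hs : s ∈ diagTorus F)
    (ht : t ∈ diagTorus F) (h : g * s = t * g) : t = s ∨ t = s⁻¹ := by
  have e0 : (g * s) 0 0 = (t * g) 0 0 := by rw [h]
  have e1 : (g * s) 0 1 = (t * g) 0 1 := by rw [h]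
  rw [mul_apply_two, mul_apply_two, ht.1, hs.2] at e0
  rw [mul_apply_two, mul_apply_two, ht.1, hs.1] at e1
  by_cases h0 : g 0 0 = 0
  · have h1 : g 0 1 ≠ 0 := by
      intro h1
      have := det_two g
      rw [h0, h1] at this
      simp at this
    right
    refine diagTorus_ext ht (inv_mem hs) ?_
    rw [(inv_apply_two s).1]
    apply mul_left_cancel₀ h1
    linear_combination -e1
  · left
    refine diagTorus_ext ht hs ?_
    apply mul_left_cancel₀ h0
    linear_combination -e0

theorem eq_of_sq_diagTorus {t u : SpecialLinearGroup (Fin 2) F} (ht : t ∈ diagTorus F)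
    (hu : u ∈ diagTorus F) (hu1 : u 0 0 = -1) (h : t * t = 1) : t = 1 ∨ t = u := by
  have e : (t * t) 0 0 = 1 := by rw [h]; simp
  rw [mul_apply_two, ht.1] at e
  have e' : t 0 0 * t 0 0 = 1 := by linear_combination e
  rcases mul_self_eq_one_iff.1 e' with h1 | h1
  · exact Or.inl (diagTorus_ext ht (one_mem _) (by simp [h1]))
  · exact Or.inr (diagTorus_ext ht hu (by rw [h1, hu1]))

/-- The diagonal matrix with entries `u` and `u⁻¹`. -/
def dg : Fˣ →* SpecialLinearGroup (Fin 2) F where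
  toFun u := mkTwo (u : F) 0 0 ((u⁻¹ : Fˣ) : F) (by simp)
  map_one' := ext_two (by simp) (by simp) (by simp) (by simp)
  map_mul' a b := by
    apply ext_two <;> rw [mul_apply_two] <;> simp [mul_comm]

theorem dg_mem (u : Fˣ) : dg u ∈ diagTorus F := ⟨rfl, rfl⟩

theorem dg_zero (u : Fˣ) : dg u 0 0 = u := rfl

theorem dg_one (u : Fˣ) : dg u 1 1 = ((u⁻¹ : Fˣ) : F) := rfl

theorem dg_injective : Function.Injective (dg : Fˣ →* SpecialLinearGroup (Fin 2) F) := by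
  intro a b h
  exact Units.ext (by rw [← dg_zero, h, dg_zero])

theorem exists_dg {t : SpecialLinearGroup (Fin 2) F} (ht : t ∈ diagTorus F) : ∃ u, t = dg u := by
  have h := diagTorus_mul ht
  refine ⟨Units.mkOfMulEqOne _ _ h, diagTorus_ext ht (dg_mem _) rfl⟩

end Matrix.SpecialLinearGroup

open Matrix.SpecialLinearGroup

section Normalizer

variable {k F : Type*} [Field k] [Field F] [Algebra k F]

theorem slIncl_apply (g : SpecialLinearGroup (Fin 2) k) (i j : Fin 2) :
    slIncl k F g i j = algebraMap k F (g i j) := rfl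

theorem mem_range_slIncl {g : SpecialLinearGroup (Fin 2) F} :
    g ∈ (slIncl k F).range ↔ ∀ i j, g i j ∈ (algebraMap k F).range := by
  constructor
  · rintro ⟨g, rfl⟩ i j
    exact ⟨_, rfl⟩
  · intro h
    choose f hf using h
    have hdet : (Matrix.of f).det = 1 := by
      apply (algebraMap k F).injective
      rw [Matrix.det_fin_two, map_sub, map_mul, map_mul, map_one]
      simp only [Matrix.of_apply, hf]
      exact det_two g
    exact ⟨⟨Matrix.of f, hdet⟩, by ext i j; exact hf i j⟩

theorem slIncl_injective : Function.Injective (slIncl k F) := by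
  intro a b h
  ext i j
  apply (algebraMap k F).injective
  rw [← slIncl_apply, h, slIncl_apply]

/-- Conjugating the two elementary unipotent matrices produces entries that are, up to signs and a
summand `1`, products of two entries of `g` from the same column. -/
theorem mul_mem_of_mem_slNormalizer {g : SpecialLinearGroup (Fin 2) F}
    (hg : g ∈ slNormalizer k F) (i j i' j' : Fin 2) :
    g i j * g i' j' ∈ (algebraMap k F).range := by
  set K := (algebraMap k F).range
  rw [slNormalizer, Subgroup.mem_normalizer_iff] at hg
  have e1 : mkTwo (1 : F) 1 0 1 (by simp) ∈ (slIncl k F).range := by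
    rw [mem_range_slIncl]
    intro i j
    fin_cases i <;> fin_cases j <;> first | exact one_mem K | exact zero_mem K
  have e2 : mkTwo (1 : F) 0 1 1 (by simp) ∈ (slIncl k F).range := by
    rw [mem_range_slIncl]
    intro i j
    fin_cases i <;> fin_cases j <;> first | exact one_mem K | exact zero_mem K
  have h1 := mem_range_slIncl.1 ((hg _).1 e1)
  have h2 := mem_range_slIncl.1 ((hg _).1 e2)
  obtain ⟨i00, i01, i10, i11⟩ := inv_apply_two g
  have hdet := det_two g
  set a := g 0 0
  set b := g 0 1
  set c := g 1 0
  set d := g 1 1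
  have haa : a * a ∈ K := by
    have := h1 0 1
    rw [mul_apply_two, mul_apply_two, mul_apply_two, i01, i11] at this
    convert this using 1
    simp [a, b]; ring
  have hac : a * c ∈ K := by
    have := sub_mem (h1 1 1) (one_mem K)
    rw [mul_apply_two, mul_apply_two, mul_apply_two, i01, i11] at this
    convert this using 1
    simp only [mkTwo_zero_zero, mkTwo_zero_one, mkTwo_one_zero, mkTwo_one_one]
    linear_combination -hdet
  have hcc : c * c ∈ K := by
    have := neg_mem (h1 1 0)
    rw [mul_apply_two, mul_apply_two, mul_apply_two, i00, i10] at this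
    convert this using 1
    simp [c, d]; ring
  have hbb : b * b ∈ K := by
    have := neg_mem (h2 0 1)
    rw [mul_apply_two, mul_apply_two, mul_apply_two, i01, i11] at this
    convert this using 1
    simp [a, b]; ring
  have hdd : d * d ∈ K := by
    have := h2 1 0
    rw [mul_apply_two, mul_apply_two, mul_apply_two, i00, i10] at this
    convert this using 1
    simp [c, d]; ring
  have hbd : b * d ∈ K := by
    have := sub_mem (h2 0 0) (one_mem K)
    rw [mul_apply_two, mul_apply_two, mul_apply_two, i00, i10] at this
    convert this using 1
    simp only [mkTwo_zero_zero, mkTwo_zero_one, mkTwo_one_zero, mkTwo_one_one]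
    linear_combination -hdet
  -- The mixed products follow from the others after multiplication by `a d - b c = 1`.
  have had : a * d ∈ K := by
    have := sub_mem (mul_mem haa hdd) (mul_mem hac hbd)
    convert this using 1
    linear_combination -a * d * hdet
  have hab : a * b ∈ K := by
    have := sub_mem (mul_mem haa hbd) (mul_mem hac hbb)
    convert this using 1
    linear_combination -a * b * hdet
  have hcd : c * d ∈ K := by
    have := sub_mem (mul_mem hac hdd) (mul_mem hcc hbd)
    convert this using 1
    linear_combination -c * d * hdet
  have hbc : b * c ∈ K := by
    have := sub_mem had (one_mem K)
    convert this using 1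
    linear_combination -hdet
  fin_cases i <;> fin_cases j <;> fin_cases i' <;> fin_cases j' <;>
    first | assumption | (rw [mul_comm]; assumption)

end Normalizer

end

/-! ### Arithmetic of the field with `5^(2^l)` elements, and the matrices `x`, `y`, `c` -/

section

open Matrix Matrix.SpecialLinearGroup

namespace SolSetup

variable {l : ℕ} {k F : Type*} [Field k] [Field F] [Algebra k F] (D : SolSetup l k F)

/-- The `2`-part of the order `5^(2^l) - 1` of the multiplicative group is `2^(l+2)`. -/
theorem pow_orderOf_eq_one_of_two_pow (hk : Nat.card k = 5 ^ 2 ^ l) {a : kˣ} {m : ℕ}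
    (ha : a ^ 2 ^ m = 1) : a ^ 2 ^ (l + 2) = 1 := by
  have : Finite k := Nat.finite_of_card_ne_zero (by rw [hk]; positivity)
  obtain ⟨s, hs⟩ := exists_five_pow_eq l
  have h1 : orderOf a ∣ 2 ^ (l + 2) * (2 * s + 1) := by
    have := orderOf_dvd_natCard a
    rwa [Nat.card_units, hk, hs, Nat.add_sub_cancel_left] at this
  have h2 : orderOf a ∣ 2 ^ m := orderOf_dvd_of_pow_eq_one ha
  refine orderOf_dvd_iff_pow_eq_one.1 (Nat.Coprime.dvd_of_dvd_mul_right ?_ h1)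
  refine Nat.Coprime.coprime_dvd_left h2 ?_
  refine Nat.Coprime.pow_left _ ?_
  rw [Nat.coprime_two_left]
  exact odd_two_mul_add_one s

theorem ω_pow_ne : D.ω ^ 2 ^ (l + 1) ≠ 1 := by
  refine pow_ne_one_of_lt_orderOf (by positivity) ?_
  rw [D.orderOf_ω]
  exact Nat.pow_lt_pow_right (by norm_num) (by omega)

theorem ω_pow : (D.ω : k) ^ 2 ^ (l + 1) = -1 := by
  have h1 : (D.ω : k) ^ 2 ^ (l + 1) * (D.ω : k) ^ 2 ^ (l + 1) = 1 := by
    have := pow_orderOf_eq_one D.ω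
    rw [D.orderOf_ω] at this
    have := congrArg Units.val this
    rw [← pow_add, ← two_mul, ← pow_succ']
    simpa using this
  refine (mul_self_eq_one_iff.1 h1).resolve_left fun h => D.ω_pow_ne (Units.ext ?_)
  simpa using h

/-- A square root of `ω` would have order `2^(l+3)`, which exceeds the `2`-part of the order of the
multiplicative group. -/
theorem not_isSquare_ω (hk : Nat.card k = 5 ^ 2 ^ l) : ¬ IsSquare (D.ω : k) := by
  rintro ⟨a, ha⟩
  have ha0 : a ≠ 0 := by
    rintro rfl
    rw [mul_zero] at ha
    exact D.ω.ne_zero ha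
  have h1 : Units.mk0 a ha0 ^ 2 = D.ω := Units.ext (by simp [ha, pow_two])
  have h2 : Units.mk0 a ha0 ^ 2 ^ (l + 3) = 1 := by
    rw [pow_succ', pow_mul, h1, ← D.orderOf_ω, pow_orderOf_eq_one]
  have h3 := pow_orderOf_eq_one_of_two_pow hk h2
  rw [pow_succ', pow_mul, h1] at h3
  exact D.ω_pow_ne h3

theorem z_notMem (hk : Nat.card k = 5 ^ 2 ^ l) : (D.z : F) ∉ (algebraMap k F).range := by
  rintro ⟨a, ha⟩
  refine D.not_isSquare_ω hk ⟨a, (algebraMap k F).injective ?_⟩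
  rw [← D.z_sq, map_mul, ha, pow_two]

/-- In a finite field the product of two nonsquares is a square. If `u²` is a nonsquare of `k`, then
`(u z)² = u² ω` is a square in `k`. -/
theorem mem_or_mul_z_mem (hk : Nat.card k = 5 ^ 2 ^ l) {u : F}
    (hu : u * u ∈ (algebraMap k F).range) :
    u ∈ (algebraMap k F).range ∨ u * D.z ∈ (algebraMap k F).range := by
  classical
  have : Finite k := Nat.finite_of_card_ne_zero (by rw [hk]; positivity)
  have := Fintype.ofFinite k
  obtain ⟨v, hv⟩ := hu
  have key : ∀ (w : F) (b : k), w * w = algebraMap k F b → IsSquare b →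
      w ∈ (algebraMap k F).range := by
    rintro w _ hw ⟨a, rfl⟩
    rw [map_mul] at hw
    rcases mul_self_eq_mul_self_iff.1 hw with h | h
    · exact ⟨a, h.symm⟩
    · exact ⟨-a, by rw [map_neg, h]⟩
  by_cases h : IsSquare v
  · exact Or.inl (key u v hv.symm h)
  · right
    refine key _ (v * D.ω) ?_ ?_
    · rw [map_mul, hv, ← D.z_sq]; ring
    · have h1 := quadraticChar_neg_one_iff_not_isSquare.2 h
      have h2 := quadraticChar_neg_one_iff_not_isSquare.2 (D.not_isSquare_ω hk)
      have h0 : v ≠ 0 := by rintro rfl; exact h ⟨0, by simp⟩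
      rw [← quadraticChar_one_iff_isSquare (mul_ne_zero h0 D.ω.ne_zero), map_mul, h1, h2]
      norm_num

/-- All products of two entries lie in `k`, so a single nonzero entry in `k` would bring all entries
into `k`. -/
theorem mul_z_mem_of_notMem (hk : Nat.card k = 5 ^ 2 ^ l) {g : SpecialLinearGroup (Fin 2) F}
    (hg : g ∈ slNormalizer k F) (hL : g ∉ (slIncl k F).range) (i j : Fin 2) :
    g i j * D.z ∈ (algebraMap k F).range := by
  rcases D.mem_or_mul_z_mem hk (mul_mem_of_mem_slNormalizer hg i j i j) with h | h
  · by_cases h0 : g i j = 0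
    · rw [h0, zero_mul]; exact zero_mem _
    · refine absurd (mem_range_slIncl.2 fun i' j' => ?_) hL
      obtain ⟨a, ha⟩ := h
      obtain ⟨b, hb⟩ := mul_mem_of_mem_slNormalizer hg i j i' j'
      refine ⟨a⁻¹ * b, ?_⟩
      rw [map_mul, map_inv₀, ha, hb, inv_mul_cancel_left₀ h0]
  · exact h

/-- Outside `L` all entries lie in `z⁻¹ k`, and a product of two such entries lies in `ω⁻¹ k = k`.
This gives `|N : L| ≤ 2`. -/
theorem mul_inv_mem_range (D : SolSetup l k F) (hk : Nat.card k = 5 ^ 2 ^ l) {g h : SpecialLinearGroup (Fin 2) F}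
    (hg : g ∈ slNormalizer k F) (hh : h ∈ slNormalizer k F) (hgL : g ∉ (slIncl k F).range)
    (hhL : h ∉ (slIncl k F).range) : g * h⁻¹ ∈ (slIncl k F).range := by
  have hhL' : h⁻¹ ∉ (slIncl k F).range := by rwa [inv_mem_iff]
  rw [mem_range_slIncl]
  intro i j
  rw [mul_apply_two]
  have key : ∀ m, g i m * h⁻¹ m j ∈ (algebraMap k F).range := by
    intro m
    obtain ⟨a, ha⟩ := D.mul_z_mem_of_notMem hk hg hgL i m
    obtain ⟨b, hb⟩ := D.mul_z_mem_of_notMem hk (inv_mem hh) hhL' m j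
    refine ⟨(D.ω : k)⁻¹ * (a * b), ?_⟩
    rw [map_mul, map_mul, ha, hb, map_inv₀, ← D.z_sq]
    have := D.z.ne_zero
    field_simp
  exact add_mem (key 0) (key 1)

/-- The order is `q (q² - 1)` with `q` odd and `q² = 5^(2^(l+1))`, so its `2`-part is `2^(l+3)`. -/
theorem not_two_pow_dvd_card_SL (hk : Nat.card k = 5 ^ 2 ^ l) :
    ¬ 2 ^ (l + 4) ∣ Nat.card (SpecialLinearGroup (Fin 2) k) := by
  have : Finite k := Nat.finite_of_card_ne_zero (by rw [hk]; positivity)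
  intro h
  obtain ⟨m, hm⟩ := exists_five_pow_eq (l + 1)
  rw [card_SL_two, hk, ← pow_mul, ← pow_succ, hm, Nat.add_sub_cancel_left] at h
  have h1 : Nat.Coprime (2 ^ (l + 4)) (5 ^ 2 ^ l) := Nat.Coprime.pow _ _ (by norm_num)
  have h2 := h1.dvd_of_dvd_mul_left h
  rw [show 2 ^ (l + 4) = 2 ^ (l + 1 + 2) * 2 by ring,
    Nat.mul_dvd_mul_iff_left (by positivity)] at h2
  omega

theorem x_eq_dg : D.x = dg D.ω := rfl

theorem y_eq : D.y = mkTwo (0 : k) (-1) 1 0 (by simp) := rfl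

theorem y_mul_y_eq : D.y * D.y = dg (-1) := by
  rw [y_eq]
  apply ext_two <;> rw [mul_apply_two] <;> simp [dg_zero, dg_one, (dg_mem _).1, (dg_mem _).2]

theorem y_mul_dg (t : SpecialLinearGroup (Fin 2) F) (ht : t ∈ diagTorus F) :
    slIncl k F D.y * t = t⁻¹ * slIncl k F D.y := by
  obtain ⟨h00, h01, h10, h11⟩ := inv_apply_two t
  apply ext_two <;> rw [mul_apply_two, mul_apply_two] <;>
    simp only [slIncl_apply, y_eq, mkTwo_zero_zero, mkTwo_zero_one, mkTwo_one_zero, mkTwo_one_one,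
      h00, h01, h10, h11, ht.1, ht.2, map_zero, map_one, map_neg] <;> ring

theorem slIncl_dg_mem (u : kˣ) : slIncl k F (dg u) ∈ diagTorus F :=
  ⟨by rw [slIncl_apply, (dg_mem u).1, map_zero], by rw [slIncl_apply, (dg_mem u).2, map_zero]⟩

theorem cSL_eq : D.cSL = mkTwo (D.z : F)⁻¹ 0 0 (D.z : F) (by simp) :=
  ext_two (Units.val_inv_eq_inv_val _) rfl rfl rfl

theorem sl_e_eq : slIncl k F D.y * D.cSL = mkTwo (0 : F) (-D.z) (D.z : F)⁻¹ 0 (by simp) := by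
  apply ext_two <;> rw [mul_apply_two] <;> simp [slIncl_apply, y_eq, cSL_eq]

/-- An element of order three of `SL₂(k)` that permutes the elements `i`, `y`, `i y`. -/
def hSL (hk : (2 : k) ≠ 0) : SpecialLinearGroup (Fin 2) k :=
  mkTwo ((1 + (D.ω : k) ^ 2 ^ l) / 2) (-(1 + (D.ω : k) ^ 2 ^ l) / 2)
    ((1 - (D.ω : k) ^ 2 ^ l) / 2) ((1 - (D.ω : k) ^ 2 ^ l) / 2) (by
      have h : (D.ω : k) ^ 2 ^ l * (D.ω : k) ^ 2 ^ l = -1 := by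
        rw [← D.ω_pow, ← pow_add, ← two_mul, ← pow_succ']
      field_simp
      linear_combination -2 * h)

theorem hSL_mul_i (hk : (2 : k) ≠ 0) : D.hSL hk * D.x ^ 2 ^ l = D.y * D.hSL hk := by
  have h : (D.ω : k) ^ 2 ^ l * (D.ω : k) ^ 2 ^ l = -1 := by
    rw [← D.ω_pow, ← pow_add, ← two_mul, ← pow_succ']
  have h' : (((D.ω ^ 2 ^ l)⁻¹ : kˣ) : k) = -(D.ω : k) ^ 2 ^ l := by
    rw [Units.val_inv_eq_inv_val, inv_eq_iff_eq_inv, eq_comm]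
    refine inv_eq_of_mul_eq_one_left ?_
    rw [Units.val_pow_eq_pow_val]
    linear_combination -h
  rw [x_eq_dg, ← map_pow]
  apply ext_two <;> rw [mul_apply_two, mul_apply_two] <;>
    simp only [y_eq, hSL, dg_zero, dg_one, (dg_mem _).1, (dg_mem _).2, mkTwo_zero_zero,
      mkTwo_zero_one, mkTwo_one_zero, mkTwo_one_one, h', Units.val_pow_eq_pow_val] <;> field_simp
  · linear_combination h
  · linear_combination h
  · linear_combination -h
  · linear_combination h

theorem hSL_mul_y (hk : (2 : k) ≠ 0) :
    D.hSL hk * D.y = D.x ^ 2 ^ l * D.y * D.hSL hk := by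
  have h : (D.ω : k) ^ 2 ^ l * (D.ω : k) ^ 2 ^ l = -1 := by
    rw [← D.ω_pow, ← pow_add, ← two_mul, ← pow_succ']
  have h' : (((D.ω ^ 2 ^ l)⁻¹ : kˣ) : k) = -(D.ω : k) ^ 2 ^ l := by
    rw [Units.val_inv_eq_inv_val, inv_eq_iff_eq_inv, eq_comm]
    refine inv_eq_of_mul_eq_one_left ?_
    rw [Units.val_pow_eq_pow_val]
    linear_combination -h
  rw [x_eq_dg, ← map_pow]
  apply ext_two <;> simp only [mul_apply_two] <;>
    simp only [y_eq, hSL, dg_zero, dg_one, (dg_mem _).1, (dg_mem _).2, mkTwo_zero_zero,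
      mkTwo_zero_one, mkTwo_one_zero, mkTwo_one_one, h', Units.val_pow_eq_pow_val] <;> field_simp
  · linear_combination -h
  · linear_combination -h
  · linear_combination h
  · linear_combination -h

theorem orderOf_x : orderOf D.x = 2 ^ (l + 2) := by
  rw [x_eq_dg, orderOf_injective dg dg_injective, D.orderOf_ω]

theorem x_pow : D.x ^ 2 ^ (l + 1) = D.y * D.y := by
  rw [x_eq_dg, y_mul_y_eq, ← map_pow]
  congr 1
  exact Units.ext (by simpa using D.ω_pow)

/-- The diagonal entry is a root of unity of order dividing `2^(l+2)`, hence a power of the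
primitive root `ω`. -/
theorem mem_zpowers_x (hk : Nat.card k = 5 ^ 2 ^ l) {g : SpecialLinearGroup (Fin 2) k}
    (hg : g ∈ diagTorus k) {m : ℕ} (h : g ^ 2 ^ m = 1) : g ∈ Subgroup.zpowers D.x := by
  obtain ⟨u, rfl⟩ := exists_dg hg
  rw [← map_pow] at h
  have h1 : u ^ 2 ^ m = 1 := dg_injective (by rw [h, map_one])
  have h2 := pow_orderOf_eq_one_of_two_pow hk h1
  have h3 : IsPrimitiveRoot (D.ω : k) (2 ^ (l + 2)) := by
    rw [← D.orderOf_ω]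
    exact (IsPrimitiveRoot.orderOf D.ω).map_of_injective (f := Units.coeHom k) Units.val_injective
  obtain ⟨n, -, hn⟩ := h3.eq_pow_of_pow_eq_one (ξ := (u : k)) (by
    rw [← Units.val_pow_eq_pow_val, h2, Units.val_one])
  refine ⟨n, ?_⟩
  simp only [zpow_natCast]
  rw [x_eq_dg, ← map_pow]
  congr 1
  exact Units.ext (by simpa using hn)

end SolSetup

end

/-! ### The normalizer `N` of `SL₂(k)` as an instance of the abstract data -/

section

open Matrix Matrix.SpecialLinearGroup

theorem coe_slToNormalizer {k F : Type*} [Field k] [Field F] [Algebra k F]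
    (g : SpecialLinearGroup (Fin 2) k) :
    ((slToNormalizer k F g : slNormalizer k F) : SpecialLinearGroup (Fin 2) F) = slIncl k F g := rfl

theorem slToNormalizer_injective {k F : Type*} [Field k] [Field F] [Algebra k F] :
    Function.Injective (slToNormalizer k F) := by
  intro a b h
  exact slIncl_injective (congrArg Subtype.val h)

theorem mem_range_slToNormalizer {k F : Type*} [Field k] [Field F] [Algebra k F]
    {n : slNormalizer k F} :
    n ∈ (slToNormalizer k F).range ↔
      (n : SpecialLinearGroup (Fin 2) F) ∈ (slIncl k F).range :=
  ⟨fun ⟨g, hg⟩ => ⟨g, congrArg Subtype.val hg⟩, fun ⟨g, hg⟩ => ⟨g, Subtype.ext hg⟩⟩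

namespace SolSetup

variable {l : ℕ} {k F : Type*} [Field k] [Field F] [Algebra k F] (D : SolSetup l k F)

theorem two_ne_zero_of_card (hk : Nat.card k = 5 ^ 2 ^ l) : (2 : k) ≠ 0 := by
  have : Finite k := Nat.finite_of_card_ne_zero (by rw [hk]; positivity)
  intro h
  have h1 : ((5 ^ 2 ^ l : ℕ) : k) = 0 := by
    have := Fintype.ofFinite k
    rw [← hk, Nat.card_eq_fintype_card]; exact Nat.cast_card_eq_zero k
  obtain ⟨m, hm⟩ := exists_five_pow_eq l
  rw [hm, pow_succ] at h1
  push_cast at h1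
  rw [h] at h1
  simp at h1

theorem slIncl_y_mul_y_comm (g : SpecialLinearGroup (Fin 2) F) :
    slIncl k F (D.y * D.y) * g = g * slIncl k F (D.y * D.y) := by
  rw [y_mul_y_eq]
  apply ext_two <;> rw [mul_apply_two, mul_apply_two] <;>
    simp [slIncl_apply, dg_zero, dg_one, (dg_mem _).1, (dg_mem _).2]

/-- The torus of diagonal matrices in `N`, with the elements `x`, `y` and `y c`. -/
def torusData (hl : 0 < l) (hk : Nat.card k = 5 ^ 2 ^ l) : TorusData (slNormalizer k F) where
  l := l
  l_pos := hl
  L := (slToNormalizer k F).range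
  T := (diagTorus F).subgroupOf (slNormalizer k F)
  x := slToNormalizer k F D.x
  y := slToNormalizer k F D.y
  e := slToNormalizer k F D.y * D.c
  ε := slToNormalizer k F (D.y * D.y)
  h := slToNormalizer k F (D.hSL (two_ne_zero_of_card hk))
  normal_L := by
    refine ⟨fun n hn g => ?_⟩
    rw [mem_range_slToNormalizer] at hn ⊢
    exact (Subgroup.mem_normalizer_iff.1 g.2 _).1 hn
  mul_inv_mem g h hg hh := by
    rw [mem_range_slToNormalizer] at *
    exact D.mul_inv_mem_range hk g.2 h.2 hg hh
  e_notMem := by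
    rw [mem_range_slToNormalizer, mem_range_slIncl]
    intro h
    have h1 := neg_mem (h 0 1)
    change -((slIncl k F D.y * D.cSL) 0 1) ∈ _ at h1
    rw [D.sl_e_eq, mkTwo_zero_one, neg_neg] at h1
    exact D.z_notMem hk h1
  e_mul_e := by
    apply Subtype.ext
    change (slIncl k F D.y * D.cSL) * (slIncl k F D.y * D.cSL) = slIncl k F (D.y * D.y)
    rw [y_mul_y_eq, sl_e_eq]
    apply ext_two <;> rw [mul_apply_two] <;>
      simp [slIncl_apply, dg_zero, dg_one, (dg_mem _).1, (dg_mem _).2]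
  e_mul_x := by
    apply Subtype.ext
    change (slIncl k F D.y * D.cSL) * slIncl k F D.x =
      (slIncl k F D.x)⁻¹ * (slIncl k F D.y * D.cSL)
    have hz := D.z.ne_zero
    rw [eq_inv_mul_iff_mul_eq, D.sl_e_eq, x_eq_dg]
    apply ext_two <;> simp only [mul_apply_two] <;>
      simp [slIncl_apply, dg_zero, dg_one, (dg_mem _).1, (dg_mem _).2, ← D.z_sq] <;> field_simp
  e_mul_y := by
    apply Subtype.ext
    change (slIncl k F D.y * D.cSL) * slIncl k F D.y =
      slIncl k F D.x * slIncl k F D.y * (slIncl k F D.y * D.cSL)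
    have hz := D.z.ne_zero
    rw [D.sl_e_eq, x_eq_dg]
    apply ext_two <;> simp only [mul_apply_two] <;>
      simp [slIncl_apply, dg_zero, dg_one, (dg_mem _).1, (dg_mem _).2, y_eq, ← D.z_sq] <;>
      field_simp
  not_dvd := by
    have : Nat.card (slToNormalizer k F).range = Nat.card (SpecialLinearGroup (Fin 2) k) :=
      (Nat.card_congr (MonoidHom.ofInjective slToNormalizer_injective).toEquiv).symm
    rw [this]
    exact not_two_pow_dvd_card_SL hk
  comm_T s hs t ht := Subtype.ext (diagTorus_comm hs ht)
  mem_T_of_comm g t ht h1 h2 :=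
    mem_diagTorus_of_comm (t := (t : SpecialLinearGroup (Fin 2) F)) ht
      (fun h => h1 (Subtype.ext h)) (congrArg Subtype.val h2)
  eq_or_of_conj g s hs t ht h :=
    (eq_or_of_conj_diagTorus hs ht (congrArg Subtype.val h)).imp Subtype.ext Subtype.ext
  y_mul t ht := Subtype.ext (D.y_mul_dg t ht)
  sq_T t ht h := by
    refine (eq_of_sq_diagTorus ht (D.y_mul_y_eq ▸ slIncl_dg_mem (-1)) ?_
      (congrArg Subtype.val h)).imp Subtype.ext Subtype.ext
    rw [coe_slToNormalizer, slIncl_apply, y_mul_y_eq, dg_zero]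
    simp
  x_mem_T := slIncl_dg_mem _
  x_mem_L := ⟨_, rfl⟩
  y_mem_L := ⟨_, rfl⟩
  y_mul_y := (map_mul _ _ _).symm
  ε_comm g := Subtype.ext (D.slIncl_y_mul_y_comm _)
  orderOf_x := by rw [orderOf_injective _ slToNormalizer_injective, D.orderOf_x]
  x_pow := by rw [← map_pow, D.x_pow]
  mem_zpowers_x t ht htL m h := by
    obtain ⟨g, rfl⟩ := htL
    have h1 : g ^ 2 ^ m = 1 :=
      slToNormalizer_injective (k := k) (F := F) (by rw [map_pow, h, map_one])
    have h2 : g ∈ diagTorus k := by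
      constructor
      · apply (algebraMap k F).injective
        rw [map_zero]; exact ht.1
      · apply (algebraMap k F).injective
        rw [map_zero]; exact ht.2
    have h3 := D.mem_zpowers_x hk h2 h1
    rw [← MonoidHom.map_zpowers]
    exact ⟨g, h3, rfl⟩
  h_mem_L := ⟨_, rfl⟩
  h_mul_i := by rw [← map_pow, ← map_mul, D.hSL_mul_i, map_mul]
  h_mul_y := by rw [← map_pow, ← map_mul, D.hSL_mul_y, map_mul, map_mul]

/-- The quaternion subgroups of `N`. -/
noncomputable def quatData (hl : 0 < l) (hk : Nat.card k = 5 ^ 2 ^ l) :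
    QuaternionData (slNormalizer k F) := (D.torusData hl hk).toQuaternionData

section

variable (hl : 0 < l) (hk : Nat.card k = 5 ^ 2 ^ l)

theorem quatData_R : (D.quatData hl hk).R = D.R.map (slToNormalizer k F) := by
  rw [R, MonoidHom.map_closure, Set.image_pair]
  exact (D.torusData hl hk).R_eq_closure

theorem quatData_Q : (D.quatData hl hk).Q = D.Q.map (slToNormalizer k F) := by
  rw [Q, MonoidHom.map_closure, Set.image_pair, map_pow]
  exact (D.torusData hl hk).Q_eq_closure

theorem quatData_conj_Q : conjSub (D.quatData hl hk).e (D.quatData hl hk).Q =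
    D.Q'.map (slToNormalizer k F) := by
  rw [Q', MonoidHom.map_closure, Set.image_pair, map_pow, map_mul]
  exact (D.torusData hl hk).conj_e_Q

theorem card_quatData_R : Nat.card (D.quatData hl hk).R = 2 ^ (l + 3) :=
  (D.torusData hl hk).card_R

end

end SolSetup

end

/-! ### The Sylow `2`-subgroup of `M`, and generators of the standard subgroups -/

section

namespace QuaternionData

variable {N : Type*} [Group N] {T : QuaternionData N}

theorem index_L : T.L.index = 2 := by
  rw [Subgroup.index_eq_two_iff]
  refine ⟨T.e, fun b => ?_⟩
  have := T.e_notMem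
  rw [T.mul_mem_L_iff]
  by_cases h : b ∈ T.L <;> simp [h, this]

variable (T) in
/-- The coset of the coordinates of an element of `M`, together with its permutation part. -/
def cosetPerm : T.M →* (N ⧸ T.L) × Sym3 where
  toFun m := (QuotientGroup.mk (co m 0), pm m)
  map_one' := rfl
  map_mul' m n := by
    refine Prod.ext ?_ rfl
    change (QuotientGroup.mk (co m 0 * co n ((pm m).symm 0)) : N ⧸ T.L) =
      QuotientGroup.mk (co m 0 * co n 0)
    rw [QuotientGroup.mk_mul, QuotientGroup.mk_mul]
    congr 1
    have h := co_iff n ((pm m).symm 0) 0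
    rw [QuotientGroup.eq, T.mul_mem_L_iff, inv_mem_iff]
    exact h

theorem ker_cosetPerm : T.cosetPerm.ker = T.boxL := by
  ext m
  rw [MonoidHom.mem_ker, Prod.ext_iff]
  change QuotientGroup.mk (co m 0) = (1 : N ⧸ T.L) ∧ pm m = 1 ↔ _
  rw [QuotientGroup.eq_one_iff]
  exact ⟨fun h => ⟨h.2, fun i => (co_iff m 0 i).1 h.1⟩, fun h => ⟨h.2 0, h.1⟩⟩

/-- The quotient by `L × L × L` embeds in `N / L × S₃`, of order twelve. Divisibility is enough for
the Sylow property. -/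
theorem card_M_dvd : Nat.card T.M ∣ Nat.card T.L ^ 3 * 12 := by
  rw [← Subgroup.card_mul_index T.boxL, boxL, card_box fun _ => le_rfl]
  refine mul_dvd_mul (dvd_of_eq (by ring)) ?_
  rw [show (T.box fun _ => T.L) = T.cosetPerm.ker from ker_cosetPerm.symm, Subgroup.index_ker]
  refine (Subgroup.card_subgroup_dvd_card _).trans ?_
  rw [Nat.card_prod, ← Subgroup.index, index_L, Nat.card_eq_fintype_card, Fintype.card_perm]
  decide

variable (T) in
/-- The preimage of the Sylow subgroup `S`. -/
abbrev sylowM : Subgroup T.M := T.pull ![false, false, false] ![false, false, false] (flagSub true)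

theorem card_sylowM : Nat.card T.sylowM = Nat.card T.R ^ 3 * 4 := by
  have := card_pull (T := T) (t := (![false, false, false], ![false, false, false]))
    (by simp [stdTypes]) true
  rw [sylowM, this, card_lam_of_forall (by decide), if_pos rfl]
  ring

/-- The order `4 |R|³` takes up the `2`-part of `12 |L|³`, because `R` has odd index in `L`. -/
theorem not_two_dvd_index_sylowM [Finite N] : ¬ 2 ∣ T.sylowM.index := by
  have h1 := card_M_dvd (T := T)
  have h2 : Nat.card T.L = T.R.relIndex T.L * Nat.card T.R := by
    rw [← Subgroup.relIndex_bot_left, ← Subgroup.relIndex_bot_left T.R, mul_comm]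
    exact (Subgroup.relIndex_mul_relIndex _ _ _ bot_le T.R_le).symm
  rw [← Subgroup.card_mul_index T.sylowM, card_sylowM, h2] at h1
  have h3 : T.sylowM.index ∣ T.R.relIndex T.L ^ 3 * 3 := by
    have h4 : 0 < Nat.card T.R ^ 3 * 4 := by
      have : 0 < Nat.card T.R := Nat.card_pos
      positivity
    refine Nat.dvd_of_mul_dvd_mul_left h4 (h1.trans (dvd_of_eq ?_))
    ring
  intro h
  rcases (Nat.Prime.dvd_mul Nat.prime_two).1 (h.trans h3) with h5 | h5
  · exact T.relIndex_R (Nat.prime_two.dvd_of_dvd_pow h5)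
  · revert h5; decide

/-! ### Generators of the standard subgroups -/

theorem pull_zpowers {J b : Fin 3 → Bool} {y : T.M} (hy : y ∈ T.nor J b) :
    T.pull J b (Subgroup.zpowers (T.psi J b ⟨y, hy⟩)) = T.lam J b ⊔ Subgroup.zpowers y := by
  apply le_antisymm
  · intro m hm
    obtain ⟨h, n, hn⟩ := mem_pull.1 hm
    have h1 : m * (y ^ n)⁻¹ ∈ T.lam J b := by
      have h2 : T.psi J b (⟨m, h⟩ * (⟨y, hy⟩ ^ n)⁻¹) = 1 := by
        rw [map_mul, map_inv, map_zpow, ← hn, mul_inv_cancel]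
      exact (psi_eq_one_iff _).1 h2
    have h3 := mul_mem ((le_sup_left : _ ≤ T.lam J b ⊔ Subgroup.zpowers y) h1)
      ((le_sup_right : _ ≤ T.lam J b ⊔ Subgroup.zpowers y) ⟨n, rfl⟩)
    simpa using h3
  · refine sup_le (lam_le_pull _) ?_
    rw [Subgroup.zpowers_le, mem_pull]
    exact ⟨hy, Subgroup.mem_zpowers _⟩

variable (T) in
/-- The permutation of the first two coordinates. -/
def tauM : T.M := T.tri 1 (Equiv.swap 0 1) fun _ _ => Iff.rfl

variable (T) in
/-- The element `(e, e, e)`. -/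
def eM : T.M := T.tri (fun _ => T.e) 1 fun _ _ => Iff.rfl

/-- When the first two factors coincide, `τ` normalizes the product, and in the frame of the product
it acts as the bare transposition. -/
theorem pull_tauM {J b : Fin 3 → Bool} (hJ : J 0 = J 1) (hb : b 0 = b 1) :
    T.pull J b (flagSub true) = T.lam J b ⊔ Subgroup.zpowers T.tauM := by
  have hJ' : ∀ i, J (Equiv.swap 0 1 i) = J i := by
    intro i; fin_cases i <;> first | rfl | exact hJ | exact hJ.symm
  have hb' : ∀ i, b (Equiv.swap 0 1 i) = b i := by
    intro i; fin_cases i <;> first | rfl | exact hb | exact hb.symm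
  have hmem : T.tauM ∈ T.nor J b := by
    rw [mem_nor]
    intro i
    change conjSub 1 (T.std J b (Equiv.swap 0 1 i)) = _
    rw [conjSub_one, std, std, hJ', hb']
  have hpsi : T.psi J b ⟨T.tauM, hmem⟩ = swapW := by
    refine SemidirectProduct.ext (funext fun i => ?_) rfl
    rw [psi_left]
    have : T.frameCo b T.tauM i = 1 := by
      change (T.ePow (b i))⁻¹ * 1 * T.ePow (b (Equiv.swap 0 1 i)) = 1
      rw [hb']; group
    rw [this, (T.θ_eq_one_iff 1 (conjSub_one _)).2 (one_mem _), ite_self]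
    rfl
  rw [← pull_zpowers hmem, hpsi, flagSub, if_pos rfl]

/-- Here `τ` alone turns `Q Q'` into `Q' Q`, and the diagonal element `(e, e, e)` restores the
order. This is the reason for `τ' = 𝐝 τ`. -/
theorem pull_eM_mul_tauM : T.pull ![true, true, false] ![false, true, false] (flagSub true) =
    T.lam ![true, true, false] ![false, true, false] ⊔ Subgroup.zpowers (T.eM * T.tauM) := by
  set J : Fin 3 → Bool := ![true, true, false]
  set b : Fin 3 → Bool := ![false, true, false]
  have hQ : ∀ A, conjSub T.e (conjSub T.e A) = A := fun A => by
    have := conj_e_ePow (T := T) true A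
    simpa [ePow] using this
  have hmem : T.eM * T.tauM ∈ T.nor J b := by
    rw [mem_nor]
    intro i
    change conjSub (T.e * 1) (T.std J b (Equiv.swap 0 1 i)) = _
    rw [mul_one]
    fin_cases i
    · change conjSub T.e (conjSub T.e T.Q) = conjSub 1 T.Q
      rw [hQ, conjSub_one]
    · change conjSub T.e (conjSub 1 T.Q) = conjSub T.e T.Q
      rw [conjSub_one]
    · change conjSub T.e (conjSub 1 T.R) = conjSub 1 T.R
      rw [conjSub_one, T.conj_e_R]
  have hpsi : T.psi J b ⟨T.eM * T.tauM, hmem⟩ = swapW := by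
    refine SemidirectProduct.ext (funext fun i => ?_) rfl
    rw [psi_left]
    fin_cases i
    -- The frame component is `e² = ε`, which lies in `Q` and acts trivially modulo inner
    -- automorphisms.
    · change T.θ (1⁻¹ * (T.e * 1) * T.e) = 1
      rw [inv_one, one_mul, mul_one, T.e_mul_e]
      exact (T.θ_eq_one_iff _ (conjSub_eq_self_of_mem T.ε_mem)).2 T.ε_mem
    · change T.θ (T.e⁻¹ * (T.e * 1) * 1) = 1
      rw [mul_one, mul_one, inv_mul_cancel]
      exact (T.θ_eq_one_iff 1 (conjSub_one _)).2 (one_mem _)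
    · rfl
  rw [← pull_zpowers hmem, hpsi, flagSub, if_pos rfl]

theorem lam_eq_sup {J b : Fin 3 → Bool} (hJ : ∀ i, J i = false) :
    T.lam J b = T.box (fun _ => T.R) ⊔ Subgroup.zpowers T.eM := by
  have hstd : T.std J b = fun _ => T.R := funext fun i => std_eq_R (hJ i)
  have heM : T.eM ∈ T.lam J b := by
    refine ⟨rfl, fun i => ?_⟩
    simp only [hJ, Bool.false_eq_true, if_false]
    exact mem_normalizer_iff_conjSub.2 T.conj_e_R
  apply le_antisymm
  · intro m hm
    have key : ∀ m ∈ T.lam J b, co m 0 ∈ T.L → m ∈ T.box (fun _ => T.R) := by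
      intro m hm h
      rw [← hstd, ← lam_inf_boxL]
      exact ⟨hm, hm.1, fun i => (co_iff m 0 i).1 h⟩
    by_cases h : co m 0 ∈ T.L
    · exact (le_sup_left : _ ≤ T.box (fun _ => T.R) ⊔ Subgroup.zpowers T.eM) (key m hm h)
    · have h1 : m * T.eM⁻¹ ∈ T.box (fun _ => T.R) := by
        refine key _ (mul_mem hm (inv_mem heM)) ?_
        have : co (m * T.eM⁻¹) 0 = co m 0 * T.e⁻¹ := by simp [eM]
        rw [this]
        exact T.mul_inv_mem _ _ h T.e_notMem
      have h2 := mul_mem ((le_sup_left : _ ≤ T.box (fun _ => T.R) ⊔ Subgroup.zpowers T.eM) h1)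
        ((le_sup_right : _ ≤ T.box (fun _ => T.R) ⊔ Subgroup.zpowers T.eM)
          (Subgroup.mem_zpowers _))
      simpa using h2
  · refine sup_le ?_ (by simpa using heM)
    rw [← hstd]
    exact box_std_le_lam J b

theorem εM_mem_pull {J b : Fin 3 → Bool} (V : Subgroup (PermWreath Sym3 3)) :
    T.εM ∈ T.pull J b V :=
  lam_le_pull V (box_one_ε_le_lam rfl fun _ => Or.inr rfl)

theorem mem_lam_of_mem_sylowM {m : T.M} (hm : m ∈ T.sylowM) (h : pm m = 1) :
    m ∈ T.lam ![false, false, false] ![false, false, false] := by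
  obtain ⟨h1, h2⟩ := mem_pull.1 hm
  rcases mem_flagSub h2 with h3 | h3
  · exact (psi_eq_one_iff ⟨m, h1⟩).1 h3
  · have h4 : pm m = Equiv.swap 0 1 := congrArg SemidirectProduct.right h3
    rw [h] at h4
    exact absurd h4 (by decide)

theorem pm_of_mem_sylowM {m : T.M} (hm : m ∈ T.sylowM) : pm m = 1 ∨ pm m = Equiv.swap 0 1 := by
  obtain ⟨h1, h2⟩ := mem_pull.1 hm
  exact (mem_flagSub h2).imp (congrArg SemidirectProduct.right) (congrArg SemidirectProduct.right)

end QuaternionData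

end

/-! ### Identification of `K̂` with `M`, and of the representatives with standard subgroups -/

section

open QuaternionData FusionSystem

namespace SolSetup

variable {l : ℕ} {k F : Type*} [Field k] [Field F] [Algebra k F] (D : SolSetup l k F)
variable (hl : 0 < l) (hk : Nat.card k = 5 ^ 2 ^ l)

theorem slToNormalizer_mem_L (g : Matrix.SpecialLinearGroup (Fin 2) k) :
    slToNormalizer k F g ∈ (D.quatData hl hk).L := ⟨g, rfl⟩

theorem inl_mem_Khat {f : Fin 3 → slNormalizer k F} (hf : ∀ i, f i ∈ (D.quatData hl hk).L) :
    (SemidirectProduct.inl f : WGroup k F) ∈ Khat k F := by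
  choose g hg using hf
  refine (le_sup_left.trans le_sup_left : (slCube k F).range ≤ Khat k F) ⟨g, ?_⟩
  change SemidirectProduct.inl (fun i => slToNormalizer k F (g i)) = _
  congr 1
  exact funext hg

/-- Commuting with `X` forces constant coordinates, so the generators satisfy the coset condition.
Conversely, a triple of `M` outside `L³` becomes one in `L³` after division by the constant triple
of `e`. -/
theorem Khat_eq : Khat k F = (D.quatData hl hk).M := by
  set T := D.quatData hl hk with hT
  apply le_antisymm
  · refine sup_le (sup_le ?_ ?_) ?_
    · rintro _ ⟨g, rfl⟩ i j
      have : ∀ i, (slCube k F g).left i ∈ T.L := fun i => D.slToNormalizer_mem_L hl hk _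
      exact iff_of_true (this i) (this j)
    · rintro _ ⟨σ, rfl⟩ i j
      exact iff_of_true (one_mem T.L) (one_mem T.L)
    · rintro _ ⟨⟨f, rfl⟩, hc⟩ i j
      have h1 := Subgroup.mem_centralizer_iff.1 hc (SemidirectProduct.inr (Equiv.swap i j)) ⟨_, rfl⟩
      have h2 := congrFun (congrArg SemidirectProduct.left h1) j
      have h3 : (1 : slNormalizer k F) * f ((Equiv.swap i j)⁻¹ j) = f j * 1 := h2
      rw [one_mul, mul_one, Equiv.swap_inv, Equiv.swap_apply_right] at h3
      change f i ∈ T.L ↔ f j ∈ T.L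
      rw [h3]
  · intro m hm
    rw [← SemidirectProduct.inl_left_mul_inr_right m]
    refine mul_mem ?_ ((le_sup_right.trans le_sup_left : actingX k F ≤ Khat k F) ⟨_, rfl⟩)
    by_cases h : m.left 0 ∈ T.L
    · exact D.inl_mem_Khat hl hk fun i => (hm 0 i).1 h
    · have h1 : (SemidirectProduct.inl m.left : WGroup k F) =
          SemidirectProduct.inl (fun i => m.left i * T.e⁻¹) *
            SemidirectProduct.inl (fun _ => T.e) := by
        rw [← map_mul]
        congr 1
        funext i
        simp
      rw [h1]
      refine mul_mem (D.inl_mem_Khat hl hk fun i => ?_) (inl_const_mem_Khat _)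
      exact T.mul_inv_mem _ _ (fun hi => h ((hm 0 i).2 hi)) T.e_notMem

/-- The projection of `K̂`, described by triples, to `K`. -/
noncomputable def toK : (D.quatData hl hk).M →* KGroup k F :=
  (QuotientGroup.mk' (Subgroup.center (Khat k F))).comp
    (MulEquiv.subgroupCongr (D.Khat_eq hl hk).symm).toMonoidHom

theorem toK_surjective : Function.Surjective (D.toK hl hk) :=
  (QuotientGroup.mk'_surjective _).comp (MulEquiv.surjective _)

/-- A central element centralizes `Q × Q × Q`, so its entries are `1` or `ε`; commuting with `X`
makes them all equal. -/
theorem toK_eq_one_iff (m : (D.quatData hl hk).M) :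
    D.toK hl hk m = 1 ↔ m = 1 ∨ m = (D.quatData hl hk).εM := by
  let T := D.quatData hl hk
  have h1 : D.toK hl hk m = 1 ↔ ∀ n : T.M, n * m = m * n := by
    change QuotientGroup.mk' (Subgroup.center (Khat k F))
      ((MulEquiv.subgroupCongr (D.Khat_eq hl hk).symm) m) = 1 ↔ _
    rw [QuotientGroup.mk'_apply, QuotientGroup.eq_one_iff, Subgroup.mem_center_iff]
    constructor
    · intro h n
      apply (MulEquiv.subgroupCongr (D.Khat_eq hl hk).symm).injective
      rw [map_mul, map_mul]
      exact h _
    · intro h n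
      obtain ⟨n, rfl⟩ := (MulEquiv.subgroupCongr (D.Khat_eq hl hk).symm).surjective n
      rw [← map_mul, ← map_mul, h]
  rw [h1]
  constructor
  · intro h
    obtain ⟨h2, h3⟩ := eq_one_or_of_comm (T := T) (fun _ => 1) (m := m) fun x _ => Or.inl (h x).symm
    have h4 : ∀ i, co m i = co m 0 := by
      intro i
      have h5 := congrArg (fun x => co x i)
        (h (T.tri 1 (Equiv.swap 0 i) fun _ _ => Iff.rfl))
      simp only [co_mul, co_tri, pm_tri, h2, Pi.one_apply, one_mul, mul_one] at h5
      rw [← h5, Equiv.symm_swap, Equiv.swap_apply_right]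
    rcases h3 0 with h5 | h5
    · exact Or.inl (M_ext (fun i => (h4 i).trans h5) h2)
    · exact Or.inr (M_ext (fun i => (h4 i).trans h5) h2)
  · rintro (rfl | rfl) n
    · simp
    · exact M_ext (fun i => (T.ε_comm (co n i)).symm) ((mul_one _).trans (one_mul _).symm)

theorem comap_map_toK {H : Subgroup (D.quatData hl hk).M} (h : (D.quatData hl hk).εM ∈ H) :
    (H.map (D.toK hl hk)).comap (D.toK hl hk) = H := by
  apply Subgroup.comap_map_eq_self
  intro m hm
  rcases (D.toK_eq_one_iff hl hk m).1 hm with rfl | rfl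
  exacts [one_mem _, h]

/-- The element `(g₁, g₂, g₃)` of `L³`. -/
noncomputable def cube (g : Fin 3 → Matrix.SpecialLinearGroup (Fin 2) k) : (D.quatData hl hk).M :=
  (D.quatData hl hk).tri (fun i => slToNormalizer k F (g i)) 1 fun _ _ =>
    iff_of_true (D.slToNormalizer_mem_L hl hk _) (D.slToNormalizer_mem_L hl hk _)

theorem cubeToK_eq (g : Fin 3 → Matrix.SpecialLinearGroup (Fin 2) k) :
    cubeToK k F g = D.toK hl hk (D.cube hl hk g) := rfl

theorem tauK_eq : tauK k F = D.toK hl hk (D.quatData hl hk).tauM := rfl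

theorem d_eq : D.d = D.toK hl hk (D.quatData hl hk).eM := by
  change _ * _ = _
  rw [D.cubeToK_eq hl hk]
  have : diagToK k F D.c = D.toK hl hk ((D.quatData hl hk).tri (fun _ => D.c) 1
    fun _ _ => Iff.rfl) := rfl
  rw [this, ← map_mul]
  rfl

theorem prodSub_eq (A : Fin 3 → Subgroup (Matrix.SpecialLinearGroup (Fin 2) k)) :
    prodSub k F A = ((D.quatData hl hk).box fun i => (A i).map (slToNormalizer k F)).map
      (D.toK hl hk) := by
  ext x
  constructor
  · rintro ⟨g, hg, rfl⟩
    refine ⟨D.cube hl hk g, ⟨rfl, fun i => ⟨g i, hg i trivial, rfl⟩⟩, rfl⟩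
  · rintro ⟨m, ⟨h1, h2⟩, rfl⟩
    choose g hg hg' using h2
    refine ⟨g, fun i _ => hg i, ?_⟩
    rw [D.cubeToK_eq hl hk]
    congr 1
    exact M_ext hg' h1.symm

theorem S_eq : D.S = (D.quatData hl hk).sylowM.map (D.toK hl hk) := by
  rw [S, R0, D.prodSub_eq hl hk, D.d_eq hl hk, D.tauK_eq hl hk, sylowM, pull_tauM rfl rfl,
    lam_eq_sup (by decide), Subgroup.map_sup, Subgroup.map_sup, sup_assoc, D.quatData_R]
  congr 1
  rw [MonoidHom.map_zpowers, MonoidHom.map_zpowers, Subgroup.zpowers_eq_closure,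
    Subgroup.zpowers_eq_closure, ← Subgroup.closure_union, Set.singleton_union]

theorem comap_S : D.S.comap (D.toK hl hk) = (D.quatData hl hk).sylowM := by
  rw [D.S_eq hl hk, comap_map_toK]
  exact εM_mem_pull _

theorem isModel [Finite F] : IsModel (D.toK hl hk) D.S where
  surj := D.toK_surjective hl hk
  ker_iff := D.toK_eq_one_iff hl hk
  isPGroup := by
    rw [D.S_eq hl hk]
    exact (isPGroup_pull (isPGroup_flagSub _)).map _
  index := by
    rw [← Subgroup.index_comap_of_surjective _ (D.toK_surjective hl hk), comap_S]
    exact not_two_dvd_index_sylowM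

theorem L0_eq : L0 k F = (D.quatData hl hk).boxL.map (D.toK hl hk) := by
  ext x
  constructor
  · rintro ⟨g, rfl⟩
    exact ⟨D.cube hl hk g, ⟨rfl, fun i => ⟨g i, rfl⟩⟩, rfl⟩
  · rintro ⟨m, ⟨h1, h2⟩, rfl⟩
    choose g hg using h2
    refine ⟨g, ?_⟩
    rw [D.cubeToK_eq hl hk]
    congr 1
    exact M_ext hg h1.symm

theorem toK_eq_toK_iff {m n : (D.quatData hl hk).M} :
    D.toK hl hk m = D.toK hl hk n ↔ m = n ∨ m = (D.quatData hl hk).εM * n := by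
  rw [← mul_inv_eq_one, ← map_inv, ← map_mul, D.toK_eq_one_iff, mul_inv_eq_one,
    mul_inv_eq_iff_eq_mul]

/-- Being central in the image of `L³` means commuting modulo `(ε, ε, ε)` with `Q × Q × Q` in
particular, which already restricts the entries to `1` and `ε`. -/
theorem mem_USub_iff {x : KGroup k F} :
    x ∈ USub k F ↔ ∃ u : (D.quatData hl hk).M, pm u = 1 ∧
      (∀ i, co u i = 1 ∨ co u i = (D.quatData hl hk).ε) ∧ D.toK hl hk u = x := by
  let T := D.quatData hl hk
  constructor
  · rintro ⟨⟨x, hx⟩, hc, rfl⟩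
    have hx' := hx
    rw [D.L0_eq hl hk] at hx'
    obtain ⟨m, hm, rfl⟩ := hx'
    obtain ⟨h1, h2⟩ := eq_one_or_of_comm (T := T) (fun _ => 1) (m := m) fun y hy => by
      have hy' : D.toK hl hk y ∈ L0 k F := by
        rw [D.L0_eq hl hk]
        refine ⟨y, ⟨hy.1, fun i => ?_⟩, rfl⟩
        have := hy.2 i
        rw [conjSub_one] at this
        exact T.Q_le_L this
      have h2 := congrArg Subtype.val (Subgroup.mem_center_iff.1 hc ⟨_, hy'⟩)
      rw [← D.toK_eq_toK_iff hl hk, map_mul, map_mul]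
      exact h2.symm
    exact ⟨m, h1, h2, rfl⟩
  · rintro ⟨u, h1, h2, rfl⟩
    have huL : u ∈ T.boxL := by
      refine ⟨h1, fun i => ?_⟩
      rcases h2 i with h | h <;> rw [h]
      exacts [one_mem _, T.ε_mem_L]
    have hu : D.toK hl hk u ∈ L0 k F := by rw [D.L0_eq hl hk]; exact ⟨u, huL, rfl⟩
    refine ⟨⟨_, hu⟩, Subgroup.mem_center_iff.2 ?_, rfl⟩
    rintro ⟨y, hy⟩
    apply Subtype.ext
    rw [D.L0_eq hl hk] at hy
    obtain ⟨y, hyL, rfl⟩ := hy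
    change D.toK hl hk y * D.toK hl hk u = D.toK hl hk u * D.toK hl hk y
    rw [← map_mul, ← map_mul]
    congr 1
    refine M_ext (fun i => ?_) (by simp [h1, hyL.1])
    rw [co_mul, co_mul, h1, hyL.1]
    rcases h2 i with h | h <;> simp only [perm_symm_one, Equiv.Perm.coe_one, id_eq, h]
    · simp
    · exact (T.ε_comm _).symm

/-- The image of `(ε, 1, 1)` lies in `U` and is not centralized by elements interchanging the first
two coordinates. Elements with trivial permutation part centralize `U`, since `ε` is central. -/
theorem comap_CSU : (D.S ⊓ Subgroup.centralizer (USub k F : Set (KGroup k F))).comap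
    (D.toK hl hk) = (D.quatData hl hk).lam ![false, false, false] ![false, false, false] := by
  let T := D.quatData hl hk
  rw [Subgroup.comap_inf, D.comap_S hl hk]
  apply le_antisymm
  · rintro m ⟨hm, hc⟩
    refine mem_lam_of_mem_sylowM hm ((pm_of_mem_sylowM hm).resolve_right fun hs => ?_)
    obtain ⟨u, hu1, hu2, hu3⟩ := exists_single (T := T) 0 T.ε_mem_L
    have hu : D.toK hl hk u ∈ USub k F := by
      rw [D.mem_USub_iff hl hk]
      refine ⟨u, hu1, fun i => ?_, rfl⟩
      by_cases hi : i = 0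
      · rw [hi]; exact Or.inr hu2
      · exact Or.inl (hu3 i hi)
    have h1 := Subgroup.mem_centralizer_iff.1 hc _ hu
    rw [← map_mul, ← map_mul, D.toK_eq_toK_iff hl hk] at h1
    have e0 : (pm m).symm 0 = 1 := by rw [hs]; rfl
    have e2 : (pm m).symm 2 = 2 := by rw [hs]; rfl
    rcases h1 with h1 | h1
    -- Equality in `K` allows a factor `(ε, ε, ε)`. Coordinate `0` excludes commuting in `M`, and
    -- coordinate `2`, where the test element is trivial, excludes commuting up to that factor.
    · have h2 := congrArg (fun y => co y 0) h1
      simp only [co_mul, hu1, hu2, e0, hu3 1 (by decide), perm_symm_one, Equiv.Perm.coe_one,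
        id_eq, mul_one] at h2
      exact T.ε_ne_one (mul_eq_right.1 h2)
    · have h2 := congrArg (fun y => co y 2) h1
      have hε : pm T.εM = 1 := rfl
      have h3 := hu3 2 (by decide)
      change co u 2 * co m ((pm u).symm 2) =
        T.ε * (co m ((pm T.εM).symm 2) * co u ((pm m).symm ((pm T.εM).symm 2))) at h2
      rw [hu1, hε] at h2
      simp only [perm_symm_one, Equiv.Perm.coe_one, id_eq] at h2
      rw [e2, h3, one_mul, mul_one] at h2
      exact T.ε_ne_one (right_eq_mul.1 h2)
  · intro m hm
    refine ⟨lam_le_pull _ hm, Subgroup.mem_centralizer_iff.2 ?_⟩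
    intro x hx
    obtain ⟨u, h1, h2, rfl⟩ := (D.mem_USub_iff hl hk).1 hx
    rw [← map_mul, ← map_mul]
    congr 1
    refine M_ext (fun i => ?_) (by simp [h1, hm.1])
    rw [co_mul, co_mul, h1, hm.1]
    rcases h2 i with h | h <;> simp only [perm_symm_one, Equiv.Perm.coe_one, id_eq, h]
    · simp
    · exact T.ε_comm _

/-! ### The representatives as standard subgroups -/

/-- The type of the product of quaternion groups contained in a representative. -/
def rowType : TableRow → (Fin 3 → Bool) × (Fin 3 → Bool)
  | .S => (![false, false, false], ![false, false, false])
  | .CSU => (![false, false, false], ![false, false, false])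
  | .QQQ => (![true, true, true], ![false, false, false])
  | .QQQ' => (![true, true, true], ![false, false, true])
  | .QQR => (![true, true, false], ![false, false, false])
  | .QQ'R => (![true, true, false], ![false, true, false])
  | .QQQτ => (![true, true, true], ![false, false, false])
  | .QQQ'τ => (![true, true, true], ![false, false, true])
  | .QQRτ => (![true, true, false], ![false, false, false])
  | .QQ'Rτ' => (![true, true, false], ![false, true, false])
  | .RRQτ => (![false, false, true], ![false, false, false])

/-- Whether a representative contains an element inducing a transposition. -/
def rowFlag : TableRow → Bool
  | .S | .QQQτ | .QQQ'τ | .QQRτ | .QQ'Rτ' | .RRQτ => true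
  | .CSU | .QQQ | .QQQ' | .QQR | .QQ'R => false

theorem rowType_mem (r : TableRow) : rowType r ∈ stdTypes := by
  cases r <;> simp [rowType, stdTypes]

theorem prodSub_eq_lam {A : Fin 3 → Subgroup (Matrix.SpecialLinearGroup (Fin 2) k)}
    {J b : Fin 3 → Bool} {i : Fin 3} (hi : J i = true)
    (hA : ∀ i, (A i).map (slToNormalizer k F) = (D.quatData hl hk).std J b i) :
    prodSub k F A = ((D.quatData hl hk).lam J b).map (D.toK hl hk) := by
  rw [D.prodSub_eq hl hk, lam_eq_box hi, funext hA]

theorem map_Q_eq : D.Q.map (slToNormalizer k F) = conjSub 1 (D.quatData hl hk).Q := by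
  rw [conjSub_one, quatData_Q]

theorem map_R_eq : D.R.map (slToNormalizer k F) = conjSub 1 (D.quatData hl hk).R := by
  rw [conjSub_one, quatData_R]

theorem map_Q'_eq : D.Q'.map (slToNormalizer k F) =
    conjSub (D.quatData hl hk).e (D.quatData hl hk).Q :=
  (D.quatData_conj_Q hl hk).symm

theorem repK_eq_of_flag_false {r : TableRow} {A} {i : Fin 3} (hr : D.repK r = prodSub k F A)
    (hf : rowFlag r = false) (hi : (rowType r).1 i = true)
    (hA : ∀ i, (A i).map (slToNormalizer k F) =
      (D.quatData hl hk).std (rowType r).1 (rowType r).2 i) :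
    (D.repK r).comap (D.toK hl hk) =
      (D.quatData hl hk).pull (rowType r).1 (rowType r).2 (flagSub (rowFlag r)) := by
  rw [hr, hf, D.prodSub_eq_lam hl hk hi hA, ← pull_bot, comap_map_toK _ _ _ (εM_mem_pull _)]
  rfl

theorem repK_eq_of_flag_true {r : TableRow} {A} {i : Fin 3}
    (hr : D.repK r = prodSub k F A ⊔ Subgroup.zpowers (tauK k F))
    (hf : rowFlag r = true) (hi : (rowType r).1 i = true)
    (hA : ∀ i, (A i).map (slToNormalizer k F) =
      (D.quatData hl hk).std (rowType r).1 (rowType r).2 i)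
    (hJ : (rowType r).1 0 = (rowType r).1 1) (hb : (rowType r).2 0 = (rowType r).2 1) :
    (D.repK r).comap (D.toK hl hk) =
      (D.quatData hl hk).pull (rowType r).1 (rowType r).2 (flagSub (rowFlag r)) := by
  rw [hr, hf, D.prodSub_eq_lam hl hk hi hA, D.tauK_eq hl hk, ← MonoidHom.map_zpowers,
    ← Subgroup.map_sup, ← pull_tauM hJ hb, comap_map_toK _ _ _ (εM_mem_pull _)]

theorem comap_repK (r : TableRow) : (D.repK r).comap (D.toK hl hk) =
    (D.quatData hl hk).pull (rowType r).1 (rowType r).2 (flagSub (rowFlag r)) := by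
  have hQ := D.map_Q_eq hl hk
  have hQ' := D.map_Q'_eq hl hk
  have hR := D.map_R_eq hl hk
  cases r
  case S => exact D.comap_S hl hk
  case CSU =>
    change _ = (D.quatData hl hk).pull _ _ ⊥
    rw [pull_bot]
    exact D.comap_CSU hl hk
  case QQQ =>
    refine D.repK_eq_of_flag_false hl hk (i := 0) rfl rfl rfl fun i => ?_
    fin_cases i
    exacts [hQ, hQ, hQ]
  case QQQ' =>
    refine D.repK_eq_of_flag_false hl hk (i := 0) rfl rfl rfl fun i => ?_
    fin_cases i
    exacts [hQ, hQ, hQ']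
  case QQR =>
    refine D.repK_eq_of_flag_false hl hk (i := 0) rfl rfl rfl fun i => ?_
    fin_cases i
    exacts [hQ, hQ, hR]
  case QQ'R =>
    refine D.repK_eq_of_flag_false hl hk (i := 0) rfl rfl rfl fun i => ?_
    fin_cases i
    exacts [hQ, hQ', hR]
  case QQQτ =>
    refine D.repK_eq_of_flag_true hl hk (i := 0) rfl rfl rfl (fun i => ?_) rfl rfl
    fin_cases i
    exacts [hQ, hQ, hQ]
  case QQQ'τ =>
    refine D.repK_eq_of_flag_true hl hk (i := 0) rfl rfl rfl (fun i => ?_) rfl rfl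
    fin_cases i
    exacts [hQ, hQ, hQ']
  case QQRτ =>
    refine D.repK_eq_of_flag_true hl hk (i := 0) rfl rfl rfl (fun i => ?_) rfl rfl
    fin_cases i
    exacts [hQ, hQ, hR]
  case RRQτ =>
    refine D.repK_eq_of_flag_true hl hk (i := 2) rfl rfl rfl (fun i => ?_) rfl rfl
    fin_cases i
    exacts [hR, hR, hQ]
  case QQ'Rτ' =>
    change (prodSub k F ![D.Q, D.Q', D.R] ⊔ Subgroup.zpowers D.tau').comap _ =
      (D.quatData hl hk).pull ![true, true, false] ![false, true, false] (flagSub true)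
    have hA : ∀ i, (![D.Q, D.Q', D.R] i).map (slToNormalizer k F) =
        (D.quatData hl hk).std ![true, true, false] ![false, true, false] i := by
      intro i
      fin_cases i
      exacts [hQ, hQ', hR]
    have ht : D.tau' = D.toK hl hk ((D.quatData hl hk).eM * (D.quatData hl hk).tauM) := by
      rw [map_mul, ← D.d_eq hl hk, ← D.tauK_eq hl hk]
      rfl
    rw [D.prodSub_eq_lam hl hk (i := 0) rfl hA, ht, ← MonoidHom.map_zpowers, ← Subgroup.map_sup,
      ← pull_eM_mul_tauM, comap_map_toK _ _ _ (εM_mem_pull _)]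

theorem hat_rep (r : TableRow) : hat (D.toK hl hk) (D.rep r) =
    (D.quatData hl hk).pull (rowType r).1 (rowType r).2 (flagSub (rowFlag r)) := by
  rw [rep, hat_subgroupOf (D.repK_le_S r), D.comap_repK hl hk]

end SolSetup

end

section

open QuaternionData FusionSystem

/-! ### Embeddings of wreath products -/

/-- The embedding of the symmetric group of degree two in that of degree three. -/
def permTwo : Equiv.Perm (Fin 2) →* Sym3 where
  toFun σ := if σ = 1 then 1 else Equiv.swap 0 1
  map_one' := rfl
  map_mul' := by decide

/-- The embedding of `(S₃ ≀ C₂) × S₃` in `S₃ ≀ S₃`. -/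
def wreathProd : PermWreath Sym3 2 × Sym3 →* PermWreath Sym3 3 where
  toFun w := ⟨![w.1.left 0, w.1.left 1, w.2], permTwo w.1.right⟩
  map_one' := SemidirectProduct.ext (by funext i; fin_cases i <;> rfl) rfl
  map_mul' := by
    rintro ⟨⟨w, σ⟩, s⟩ ⟨⟨v, ρ⟩, t⟩
    refine SemidirectProduct.ext (funext fun i => ?_) (map_mul permTwo σ ρ)
    have hσ : ∀ σ : Equiv.Perm (Fin 2), σ = 1 ∨ σ = Equiv.swap 0 1 := by decide
    rcases hσ σ with rfl | rfl <;> fin_cases i <;> rfl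

theorem wreathProd_injective : Function.Injective wreathProd := by
  have hp : Function.Injective permTwo := by
    rw [injective_iff_map_eq_one]; decide
  rintro ⟨⟨w, σ⟩, s⟩ ⟨⟨v, ρ⟩, t⟩ h
  have h1 := congrArg SemidirectProduct.left h
  have h0 : w 0 = v 0 := congrFun h1 0
  have h1' : w 1 = v 1 := congrFun h1 1
  have h2 : s = t := congrFun h1 2
  have h3 : σ = ρ := hp (congrArg SemidirectProduct.right h)
  have h4 : w = v := by funext i; fin_cases i <;> assumption
  rw [h2, h3, h4]

theorem mem_range_wreathProd {w : PermWreath Sym3 3} :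
    w ∈ wreathProd.range ↔ w.right 2 = 2 := by
  constructor
  · rintro ⟨⟨⟨v, σ⟩, s⟩, rfl⟩
    have : ∀ σ : Equiv.Perm (Fin 2), permTwo σ 2 = 2 := by decide
    exact this σ
  · intro h
    have : ∀ σ : Sym3, σ 2 = 2 → ∃ ρ, permTwo ρ = σ := by decide
    obtain ⟨ρ, hρ⟩ := this _ h
    exact ⟨(⟨![w.left 0, w.left 1], ρ⟩, w.left 2),
      SemidirectProduct.ext (by funext i; fin_cases i <;> rfl) hρ⟩

theorem mem_range_wreathProd_comp_inl {w : PermWreath Sym3 3} :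
    w ∈ (wreathProd.comp (MonoidHom.inl _ _)).range ↔ w.right 2 = 2 ∧ w.left 2 = 1 := by
  rw [← mem_range_wreathProd]
  constructor
  · rintro ⟨v, rfl⟩
    exact ⟨⟨_, rfl⟩, rfl⟩
  · rintro ⟨⟨⟨v, s⟩, rfl⟩, h⟩
    have : s = 1 := h
    exact ⟨v, by rw [this]; rfl⟩

instance : Nontrivial Sym3 := inferInstanceAs (Nontrivial (Equiv.Perm (Fin 3)))

theorem QuaternionData.compat_two_one : ∀ σ : Sym3,
    (Compat ![true, true, true] ![false, false, false] σ) ∧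
    (Compat ![true, true, true] ![false, false, true] σ ↔ σ 2 = 2) ∧
    (Compat ![true, true, false] ![false, false, false] σ ↔ σ 2 = 2) ∧
    (Compat ![true, true, false] ![false, true, false] σ ↔ σ 2 = 2) ∧
    (Compat ![false, false, false] ![false, false, false] σ) := by decide

namespace SolSetup

/-- The numbering of the representatives. -/
def rowEquiv : TableRow ≃ Fin 11 where
  toFun
    | .S => 0 | .CSU => 1 | .QQQ => 2 | .QQQ' => 3 | .QQR => 4 | .QQ'R => 5 | .QQQτ => 6
    | .QQQ'τ => 7 | .QQRτ => 8 | .QQ'Rτ' => 9 | .RRQτ => 10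
  invFun := ![.S, .CSU, .QQQ, .QQQ', .QQR, .QQ'R, .QQQτ, .QQQ'τ, .QQRτ, .QQ'Rτ', .RRQτ]
  left_inv r := by cases r <;> rfl
  right_inv i := by fin_cases i <;> rfl

theorem row_injective {r r' : TableRow} (h : rowType r = rowType r')
    (h' : rowFlag r = rowFlag r') : r = r' := by
  have key : ∀ i j : Fin 11, rowType (rowEquiv.symm i) = rowType (rowEquiv.symm j) →
      rowFlag (rowEquiv.symm i) = rowFlag (rowEquiv.symm j) → i = j := by decide
  have := key (rowEquiv r) (rowEquiv r')
  simp only [Equiv.symm_apply_apply] at this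
  exact rowEquiv.injective (this h h')

/-- The rows exhaust the six types with both flags, except for `RRQ` without the transposition. -/
theorem exists_row {t : (Fin 3 → Bool) × (Fin 3 → Bool)} (ht : t ∈ stdTypes) {f : Bool}
    (hf : t = (![false, false, true], ![false, false, false]) → f = true) :
    ∃ r, rowType r = t ∧ rowFlag r = f := by
  have key : ∀ t ∈ stdTypes, ∀ f, (t = (![false, false, true], ![false, false, false]) →
      f = true) → ∃ i, rowType (rowEquiv.symm i) = t ∧ rowFlag (rowEquiv.symm i) = f := by decide
  obtain ⟨i, hi⟩ := key t ht f hf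
  exact ⟨_, hi⟩

variable {l : ℕ} {k F : Type*} [Field k] [Field F] [Algebra k F] (D : SolSetup l k F)
variable (hl : 0 < l) (hk : Nat.card k = 5 ^ 2 ^ l)


end SolSetup

end

section

open QuaternionData FusionSystem

theorem twoFree_wreath (n : ℕ) : TwoFree (PermWreath Sym3 n) := twoFree_sym3.permWreath n

theorem forall_fin_three {p : Fin 3 → Prop} : (∀ i, p i) ↔ p 0 ∧ p 1 ∧ p 2 :=
  ⟨fun h => ⟨h 0, h 1, h 2⟩, fun h i => by fin_cases i; exacts [h.1, h.2.1, h.2.2]⟩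

namespace FusionSystem

variable {S : Type*} [Group S] {𝓕 : FusionSystem S} {P Q R : Subgroup S}

theorem IsConj.refl (P : Subgroup S) : 𝓕.IsConj P P := by
  have h := 𝓕.conj_mem (P := P) (Q := P) 1 (MonoidHom.id P) (by simp)
  exact ⟨MulEquiv.refl P, h, h⟩

theorem IsConj.symm (h : 𝓕.IsConj P Q) : 𝓕.IsConj Q P := by
  obtain ⟨e, h1, h2⟩ := h
  exact ⟨e.symm, h2, h1⟩

theorem IsConj.trans (h : 𝓕.IsConj P Q) (h' : 𝓕.IsConj Q R) : 𝓕.IsConj P R := by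
  obtain ⟨e, h1, h2⟩ := h
  obtain ⟨f, h3, h4⟩ := h'
  exact ⟨e.trans f, 𝓕.comp_mem h1 h3, 𝓕.comp_mem h4 h2⟩

theorem isRadical_of_equiv {H : Type*} [Group H] (hH : TwoFree H)
    (h : Nonempty (𝓕.Out P ≃* H)) : 𝓕.IsRadical 2 P := by
  obtain ⟨e⟩ := h
  exact hH.pCore_eq_of_equiv e

end FusionSystem

namespace SolSetup

variable {l : ℕ} {k F : Type*} [Field k] [Field F] [Algebra k F] (D : SolSetup l k F)

theorem nonempty_out_false [Finite F] (hl : 0 < l) (hk : Nat.card k = 5 ^ 2 ^ l)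
    {r : TableRow} (hr : rowFlag r = false) {H : Type*} [Group H]
    (ρ : H →* PermWreath Sym3 3) (hρ : Function.Injective ρ)
    (h : ∀ w, w ∈ ρ.range ↔ Compat (rowType r).1 (rowType r).2 w.right ∧
      ∀ i, (rowType r).1 i = false → w.left i = 1) :
    Nonempty (D.fusionK.Out (D.rep r) ≃* H) :=
  (D.isModel hl hk).nonempty_out_false (rowType_mem r) (hr ▸ D.hat_rep hl hk r) ρ hρ h

theorem nonempty_out_true [Finite F] (hl : 0 < l) (hk : Nat.card k = 5 ^ 2 ^ l)
    {r : TableRow} (hr : rowFlag r = true) {H : Type*} [Group H]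
    (ρ : H →* Sym3 × Sym3) (hρ : Function.Injective ρ)
    (h : ∀ w, w ∈ ρ.range ↔ ((rowType r).1 0 = false → w.1 = 1) ∧
      ((rowType r).1 2 = false → w.2 = 1)) :
    Nonempty (D.fusionK.Out (D.rep r) ≃* H) :=
  (D.isModel hl hk).nonempty_out_true (rowType_mem r) (hr ▸ D.hat_rep hl hk r) ρ hρ h

theorem out_S [Finite F] (hl : 0 < l) (hk : Nat.card k = 5 ^ 2 ^ l) : Nonempty (D.fusionK.Out (D.rep .S) ≃* Unit) := by
  refine D.nonempty_out_true hl hk rfl (1 : Unit →* _) (Function.injective_of_subsingleton _)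
    fun w => ?_
  constructor
  · rintro ⟨_, rfl⟩
    exact ⟨fun _ => rfl, fun _ => rfl⟩
  · intro h
    exact ⟨(), (Prod.ext (h.1 rfl) (h.2 rfl)).symm⟩

theorem out_CSU [Finite F] (hl : 0 < l) (hk : Nat.card k = 5 ^ 2 ^ l) : Nonempty (D.fusionK.Out (D.rep .CSU) ≃* Sym3) := by
  refine D.nonempty_out_false hl hk rfl SemidirectProduct.inr SemidirectProduct.inr_injective
    fun w => ?_
  constructor
  · rintro ⟨σ, rfl⟩
    exact ⟨(compat_two_one σ).2.2.2.2, fun _ _ => rfl⟩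
  · rintro ⟨-, h⟩
    refine ⟨w.right, SemidirectProduct.ext (funext fun i => (h i ?_).symm) rfl⟩
    fin_cases i <;> rfl

theorem out_QQQ [Finite F] (hl : 0 < l) (hk : Nat.card k = 5 ^ 2 ^ l) : Nonempty (D.fusionK.Out (D.rep .QQQ) ≃* PermWreath Sym3 3) := by
  refine D.nonempty_out_false hl hk rfl (MonoidHom.id _) Function.injective_id fun w => ?_
  refine iff_of_true ⟨w, rfl⟩ ⟨(compat_two_one _).1, ?_⟩
  intro i
  fin_cases i <;> exact fun h => absurd h (by decide)

theorem out_QQQ' [Finite F] (hl : 0 < l) (hk : Nat.card k = 5 ^ 2 ^ l) :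
    Nonempty (D.fusionK.Out (D.rep .QQQ') ≃* PermWreath Sym3 2 × Sym3) := by
  refine D.nonempty_out_false hl hk rfl wreathProd wreathProd_injective fun w => ?_
  rw [mem_range_wreathProd, ← (compat_two_one _).2.1]
  refine ⟨fun h => ⟨h, ?_⟩, fun h => h.1⟩
  intro i
  fin_cases i <;> exact fun h => absurd h (by decide)

theorem out_QQR_aux [Finite F] (hl : 0 < l) (hk : Nat.card k = 5 ^ 2 ^ l)
    {r : TableRow} (hr : rowFlag r = false)
    (h1 : (rowType r).1 = ![true, true, false])
    (h2 : ∀ σ, Compat (rowType r).1 (rowType r).2 σ ↔ σ 2 = 2) :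
    Nonempty (D.fusionK.Out (D.rep r) ≃* PermWreath Sym3 2) := by
  refine D.nonempty_out_false hl hk hr (wreathProd.comp (MonoidHom.inl _ _))
    (wreathProd_injective.comp (fun _ _ h => congrArg Prod.fst h)) fun w => ?_
  rw [mem_range_wreathProd_comp_inl, h2, h1, forall_fin_three]
  simp

theorem out_QQR [Finite F] (hl : 0 < l) (hk : Nat.card k = 5 ^ 2 ^ l) : Nonempty (D.fusionK.Out (D.rep .QQR) ≃* PermWreath Sym3 2) :=
  D.out_QQR_aux hl hk rfl rfl fun σ => (compat_two_one σ).2.2.1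

theorem out_QQ'R [Finite F] (hl : 0 < l) (hk : Nat.card k = 5 ^ 2 ^ l) : Nonempty (D.fusionK.Out (D.rep .QQ'R) ≃* PermWreath Sym3 2) :=
  D.out_QQR_aux hl hk rfl rfl fun σ => (compat_two_one σ).2.2.2.1

theorem out_prod [Finite F] (hl : 0 < l) (hk : Nat.card k = 5 ^ 2 ^ l)
    {r : TableRow} (hr : rowFlag r = true) (h0 : (rowType r).1 0 = true)
    (h2 : (rowType r).1 2 = true) : Nonempty (D.fusionK.Out (D.rep r) ≃* Sym3 × Sym3) := by
  refine D.nonempty_out_true hl hk hr (MonoidHom.id _) Function.injective_id fun w => ?_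
  rw [h0, h2]
  exact iff_of_true ⟨w, rfl⟩ ⟨fun h => absurd h (by decide), fun h => absurd h (by decide)⟩

theorem out_inl [Finite F] (hl : 0 < l) (hk : Nat.card k = 5 ^ 2 ^ l)
    {r : TableRow} (hr : rowFlag r = true) (h0 : (rowType r).1 0 = true)
    (h2 : (rowType r).1 2 = false) : Nonempty (D.fusionK.Out (D.rep r) ≃* Sym3) := by
  refine D.nonempty_out_true hl hk hr (MonoidHom.inl _ _) (fun _ _ h => congrArg Prod.fst h) fun w => ?_
  rw [h0, h2]
  refine ⟨?_, fun h => ⟨w.1, Prod.ext rfl (h.2 rfl).symm⟩⟩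
  rintro ⟨s, rfl⟩
  exact ⟨fun h => absurd h (by decide), fun _ => rfl⟩

theorem out_inr [Finite F] (hl : 0 < l) (hk : Nat.card k = 5 ^ 2 ^ l)
    {r : TableRow} (hr : rowFlag r = true) (h0 : (rowType r).1 0 = false)
    (h2 : (rowType r).1 2 = true) : Nonempty (D.fusionK.Out (D.rep r) ≃* Sym3) := by
  refine D.nonempty_out_true hl hk hr (MonoidHom.inr _ _) (fun _ _ h => congrArg Prod.snd h) fun w => ?_
  rw [h0, h2]
  refine ⟨?_, fun h => ⟨w.2, Prod.ext (h.1 rfl).symm rfl⟩⟩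
  rintro ⟨s, rfl⟩
  exact ⟨fun _ => rfl, fun h => absurd h (by decide)⟩

theorem isCentricRadical_rep [Finite F] (hl : 0 < l) (hk : Nat.card k = 5 ^ 2 ^ l)
    (r : TableRow) : D.fusionK.IsCentricRadical 2 (D.rep r) := by
  refine ⟨(D.isModel hl hk).isCentric (D.hat_rep hl hk r), ?_⟩
  have h3 := twoFree_sym3
  cases r
  · exact isRadical_of_equiv twoFree_unit (D.out_S hl hk)
  · exact isRadical_of_equiv h3 (D.out_CSU hl hk)
  · exact isRadical_of_equiv (twoFree_wreath 3) (D.out_QQQ hl hk)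
  · exact isRadical_of_equiv ((twoFree_wreath 2).prod h3) (D.out_QQQ' hl hk)
  · exact isRadical_of_equiv (twoFree_wreath 2) (D.out_QQR hl hk)
  · exact isRadical_of_equiv (twoFree_wreath 2) (D.out_QQ'R hl hk)
  · exact isRadical_of_equiv (h3.prod h3) (D.out_prod hl hk rfl rfl rfl)
  · exact isRadical_of_equiv (h3.prod h3) (D.out_prod hl hk rfl rfl rfl)
  · exact isRadical_of_equiv h3 (D.out_inl hl hk rfl rfl rfl)
  · exact isRadical_of_equiv h3 (D.out_inl hl hk rfl rfl rfl)
  · exact isRadical_of_equiv h3 (D.out_inr hl hk rfl rfl rfl)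

theorem isConj_iff (hl : 0 < l) (hk : Nat.card k = 5 ^ 2 ^ l)
    {P Q : Subgroup D.S} : D.fusionK.IsConj P Q ↔
    ∃ m, conjSub m (hat (D.toK hl hk) P) = hat (D.toK hl hk) Q :=
  isConj_iff_hat (D.toK_surjective hl hk)

theorem eq_of_isConj_rep [Finite F] (hl : 0 < l) (hk : Nat.card k = 5 ^ 2 ^ l)
    {r r' : TableRow} (h : D.fusionK.IsConj (D.rep r) (D.rep r')) :
    r = r' := by
  obtain ⟨m, hm⟩ := (D.isConj_iff hl hk).1 h
  rw [D.hat_rep hl hk, D.hat_rep hl hk] at hm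
  have := pull_conj_inj (rowType_mem r) (rowType_mem r') hm
  exact row_injective this.1 this.2

theorem exists_isConj_rep [Finite F] (hl : 0 < l) (hk : Nat.card k = 5 ^ 2 ^ l)
    {P : Subgroup D.S} (hP : D.fusionK.IsCentricRadical 2 P) :
    ∃ r, D.fusionK.IsConj P (D.rep r) := by
  have : Finite (KGroup k F) := inferInstance
  obtain ⟨m, t, ht, f, hm, hf⟩ := (D.isModel hl hk).exists_conj_eq hP
  obtain ⟨r, rfl, rfl⟩ := exists_row ht hf
  exact ⟨r, (D.isConj_iff hl hk).2 ⟨m, by rw [hm, D.hat_rep hl hk]⟩⟩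

theorem existsUnique_isConj_rep [Finite F] (hl : 0 < l) (hk : Nat.card k = 5 ^ 2 ^ l)
    {P : Subgroup D.S} (hP : D.fusionK.IsCentricRadical 2 P) :
    ∃! r, D.fusionK.IsConj P (D.rep r) := by
  obtain ⟨r, hr⟩ := D.exists_isConj_rep hl hk hP
  refine ⟨r, hr, fun r' hr' => ?_⟩
  exact D.eq_of_isConj_rep hl hk ((hr'.symm).trans hr)

theorem centricRadicalClasses_eq [Finite F] (hl : 0 < l) (hk : Nat.card k = 5 ^ 2 ^ l) : D.fusionK.centricRadicalClasses 2 =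
    Set.range fun r => {Q | D.fusionK.IsConj (D.rep r) Q} := by
  ext C
  constructor
  · rintro ⟨P, hP, rfl⟩
    obtain ⟨r, hr⟩ := D.exists_isConj_rep hl hk hP
    exact ⟨r, Set.ext fun Q => ⟨fun h => hr.trans h, fun h => hr.symm.trans h⟩⟩
  · rintro ⟨r, rfl⟩
    exact ⟨D.rep r, D.isCentricRadical_rep hl hk r, rfl⟩

theorem ncard_centricRadicalClasses [Finite F] (hl : 0 < l) (hk : Nat.card k = 5 ^ 2 ^ l) : (D.fusionK.centricRadicalClasses 2).ncard = 11 := by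
  rw [D.centricRadicalClasses_eq hl hk, ← Set.image_univ, Set.ncard_image_of_injective,
    Set.ncard_univ, Nat.card_congr rowEquiv, Nat.card_eq_fintype_card, Fintype.card_fin]
  intro r r' h
  refine D.eq_of_isConj_rep hl hk ?_
  exact (Set.ext_iff.1 h (D.rep r')).2 (FusionSystem.IsConj.refl _)

theorem two_mul_card_rep [Finite F] (hl : 0 < l) (hk : Nat.card k = 5 ^ 2 ^ l)
    (r : TableRow) : 2 * Nat.card (D.rep r) =
    Nat.card ((D.quatData hl hk).lam (rowType r).1 (rowType r).2) *
      if rowFlag r then 2 else 1 := by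
  rw [← (D.isModel hl hk).card_hat, D.hat_rep hl hk, card_pull (rowType_mem r)]

theorem card_rep_of_exists [Finite F] (hl : 0 < l) (hk : Nat.card k = 5 ^ 2 ^ l)
    {r : TableRow} {i : Fin 3} (hi : (rowType r).1 i = true) :
    2 * Nat.card (D.rep r) =
      ((if (rowType r).1 0 then 8 else 2 ^ (l + 3)) *
        (if (rowType r).1 1 then 8 else 2 ^ (l + 3)) *
        (if (rowType r).1 2 then 8 else 2 ^ (l + 3))) * if rowFlag r then 2 else 1 := by
  rw [D.two_mul_card_rep hl hk, card_lam hi, D.card_quatData_R]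

theorem card_rep_of_forall [Finite F] (hl : 0 < l) (hk : Nat.card k = 5 ^ 2 ^ l)
    {r : TableRow} (hr : ∀ i, (rowType r).1 i = false) :
    2 * Nat.card (D.rep r) = ((2 ^ (l + 3)) ^ 3 * 2) * if rowFlag r then 2 else 1 := by
  rw [D.two_mul_card_rep hl hk, card_lam_of_forall hr, D.card_quatData_R]

end SolSetup

end

theorem proposition3p5 (l : ℕ) (hl : 0 < l) {k F : Type*} [Field k] [Field F] [Algebra k F]
    (hk : Nat.card k = 5 ^ 2 ^ l) (hF : Nat.card F = (5 ^ 2 ^ l) ^ 2) (D : SolSetup l k F) :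
    -- there are exactly eleven classes
    (D.fusionK.centricRadicalClasses 2).ncard = 11 ∧
    -- the listed subgroups are centric radical and represent each class exactly once
    (∀ r : TableRow, D.fusionK.IsCentricRadical 2 (D.rep r)) ∧
    (∀ P : Subgroup D.S, D.fusionK.IsCentricRadical 2 P →
      ∃! r : TableRow, D.fusionK.IsConj P (D.rep r)) ∧
    -- orders
    Nat.card (D.rep .S) = 2 ^ (10 + 3 * l) ∧
    Nat.card (D.rep .CSU) = 2 ^ (9 + 3 * l) ∧
    Nat.card (D.rep .QQQ) = 2 ^ 8 ∧
    Nat.card (D.rep .QQQ') = 2 ^ 8 ∧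
    Nat.card (D.rep .QQR) = 2 ^ (8 + l) ∧
    Nat.card (D.rep .QQ'R) = 2 ^ (8 + l) ∧
    Nat.card (D.rep .QQQτ) = 2 ^ 9 ∧
    Nat.card (D.rep .QQQ'τ) = 2 ^ 9 ∧
    Nat.card (D.rep .QQRτ) = 2 ^ (9 + l) ∧
    Nat.card (D.rep .QQ'Rτ') = 2 ^ (9 + l) ∧
    Nat.card (D.rep .RRQτ) = 2 ^ (9 + 2 * l) ∧
    -- outer automorphism groups
    Nonempty (D.fusionK.Out (D.rep .S) ≃* Unit) ∧
    Nonempty (D.fusionK.Out (D.rep .CSU) ≃* Sym3) ∧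
    Nonempty (D.fusionK.Out (D.rep .QQQ) ≃* PermWreath Sym3 3) ∧
    Nonempty (D.fusionK.Out (D.rep .QQQ') ≃* PermWreath Sym3 2 × Sym3) ∧
    Nonempty (D.fusionK.Out (D.rep .QQR) ≃* PermWreath Sym3 2) ∧
    Nonempty (D.fusionK.Out (D.rep .QQ'R) ≃* PermWreath Sym3 2) ∧
    Nonempty (D.fusionK.Out (D.rep .QQQτ) ≃* Sym3 × Sym3) ∧
    Nonempty (D.fusionK.Out (D.rep .QQQ'τ) ≃* Sym3 × Sym3) ∧
    Nonempty (D.fusionK.Out (D.rep .QQRτ) ≃* Sym3) ∧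
    Nonempty (D.fusionK.Out (D.rep .QQ'Rτ') ≃* Sym3) ∧
    Nonempty (D.fusionK.Out (D.rep .RRQτ) ≃* Sym3) := by
  have : Finite F := Nat.finite_of_card_ne_zero (by rw [hF]; positivity)
  -- Orders are computed on full preimages in `M`, which are twice as large as the subgroups of `S`;
  -- the factor two is cancelled here.
  have hc : ∀ {n m : ℕ}, 2 * n = 2 * m → n = m := fun h => Nat.eq_of_mul_eq_mul_left two_pos h
  refine ⟨D.ncard_centricRadicalClasses hl hk, D.isCentricRadical_rep hl hk,
    fun P hP => D.existsUnique_isConj_rep hl hk hP, ?_, ?_, ?_, ?_, ?_, ?_, ?_, ?_, ?_, ?_, ?_,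
    D.out_S hl hk, D.out_CSU hl hk, D.out_QQQ hl hk, D.out_QQQ' hl hk, D.out_QQR hl hk,
    D.out_QQ'R hl hk, D.out_prod hl hk rfl rfl rfl, D.out_prod hl hk rfl rfl rfl,
    D.out_inl hl hk rfl rfl rfl, D.out_inl hl hk rfl rfl rfl, D.out_inr hl hk rfl rfl rfl⟩ <;>
    apply hc
  · rw [D.card_rep_of_forall hl hk (by decide), SolSetup.rowFlag, if_pos rfl]; ring
  · rw [D.card_rep_of_forall hl hk (by decide), SolSetup.rowFlag, if_neg (by decide)]; ring
  all_goals
    first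
      | rw [D.card_rep_of_exists hl hk (i := 0) rfl]
      | rw [D.card_rep_of_exists hl hk (i := 2) rfl]
    simp only [SolSetup.rowType, SolSetup.rowFlag, Matrix.cons_val_zero, Matrix.cons_val_one, Matrix.cons_val,
      if_true, Bool.false_eq_true, if_false]
    ring
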